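/- **Local H theorem for the Enskog equation with the modified Enskog factor.** *Setting.* Let $m,\sigma>0$, let $D\subseteq\mathbb R^3$ be open (possibly $D=\mathbb R^3$, which contains the spatially periodic case), let $T\subseteq\mathbb R$ be an open set of times, and let $\mathcal S:[0,b)\to[0,\infty)$ be $C^1$, $0<b\le\infty$. Write $\langle\,\cdot\,\rangle=\int_{\mathbb R^3}\cdot\,d\xi$, let $\chi_D$ be the indicator function of $D$, $\theta$ the Heaviside function ($\theta(x)=1$ for $x\ge 0$), $d\Omega$ the surface measure on the unit sphere $\mathbb S^2$, and for $\alpha\in\mathbb S^2$ $$V_\alpha=(\xi_*-\xi)\cdot\alpha,\qquad \xi'=\xi+V_\alpha\alpha,\qquad \xi_*'=\xi_*-V_\alpha\alpha .$$ For a distribution function $f(t,X,\xi)$ write $f(X)=f(t,X,\xi)$, $f'(X)=f(t,X,\xi')$, $f_*(X)=f(t,X,\xi_*)$, $f'_*(X)=f(t,X,\xi_*')$, and put $$\rho=\langle f\rangle,\quad v=\tfrac1\rho\langle\xi f\rangle,\quad \mathcal R(X)=\frac1m\int_D\rho(Y)\,\theta(\sigma-|Y-X|)\,dY,\quad g(X,Y)=[\mathcal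 S(\mathcal R(X))+\mathcal S(\mathcal R(Y))]\,\chi_D(X)\chi_D(Y).$$ The Enskog equation on $T\times D\times\mathbb R^3$ is $$\partial_tf+\xi\cdot\nabla_Xf=\frac{\sigma^2}{m}\iint g(X+\sigma\alpha,X)f'_*(X+\sigma\alpha)f'(X)V_\alpha\theta(V_\alpha)\,d\xi_*d\Omega-\frac{\sigma^2}{m}\iint g(X-\sigma\alpha,X)f_*(X-\sigma\alpha)f(X)V_\alpha\theta(V_\alpha)\,d\xi_*d\Omega .$$ *Assumptions on the solution.* $f$ is a positive $C^1$ solution on $T\times D\times\mathbb R^3$ such that: for every compact $K\subset T$ and $r>0$, uniformly for $t\in K$, $X\in D$ with $|X|<r$, $f$ decays faster than every power of $|\xi|$, and $|\ln f|$ and $|\partial_t\ln f|$ are bounded by $C(1+|\xi|)^n$ for some $C,n$; for every compact $K\subset T$, $L\subset D$, also $|\nabla_X\ln f|\le C(1+|\xi|)^n$ on $K\times L$ for some $C,n$. Moreover $\mathcal R(t,X)<b$ for $t\in T$, $X\in\overline D$, and the boundary is impermeable: for every $t\in T$, $\rho v\cdot n=0$ on $\partial D$ in the weak sense, i.e. $\int_D(\rho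 v\cdot\nabla\varphi+\varphi\,\nabla\!\cdot(\rho v))\,dX=0$ for all $\varphi\in C_c^\infty(\mathbb R^3)$ (no condition if $D=\mathbb R^3$). *Definitions.* Let $$H^{(k)}=\langle f\ln f\rangle,\qquad H^{(c)}=\rho\int_0^{\mathcal R(X)}\mathcal S(x)\,dx,\qquad H=H^{(k)}+H^{(c)},\qquad J^H=\langle\xi f\ln f\rangle+J^{(k)}+J^{(c)},$$ $$J^{(k)}=\frac{\sigma^3}{2m}\int_{\mathbb S^2}\!\iint\!\int_0^1\alpha\, g(X+\tau\sigma\alpha,X+(\tau-1)\sigma\alpha)\ln\frac{f'(X+\tau\sigma\alpha)}{f(X+\tau\sigma\alpha)}\,f(X+\tau\sigma\alpha)f_*(X+(\tau-1)\sigma\alpha)V_\alpha\theta(V_\alpha)\,d\tau d\xi_*d\xi d\Omega,$$ $$J^{(c)}=H^{(c)}v-\frac{\sigma^3}{2m}\int_{\mathbb S^2}\!\int_0^1\alpha\,\big[\big(v(X^+)-v(X^-)\big)\cdot\alpha\big]\rho(X^+)\rho(X^-)\mathcal S(\mathcal R(X^+))\chi_D(X^-)\chi_D(X^+)\,d\tau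 d\Omega,\quad X^+=X+\tau\sigma\alpha,\ X^-=X+(\tau-1)\sigma\alpha,$$ $$\mathcal I=\frac{\sigma^2}{2m}\int_{\mathbb S^2}\!\iint g(X,X-\sigma\alpha)\,[f'_*(X-\sigma\alpha)f'(X)-f(X)f_*(X-\sigma\alpha)]\,V_\alpha\theta(V_\alpha)\,d\xi_*d\xi d\Omega .$$ *Detailed balance* holds at $(t,X)$ if $f'_*(X-\sigma\alpha)f'(X)=f(X)f_*(X-\sigma\alpha)$ for all $\xi,\xi_*\in\mathbb R^3$ and all $\alpha\in\mathbb S^2$ with $g(X,X-\sigma\alpha)>0$ (if $\mathcal S>0$: all $\alpha$ with $X-\sigma\alpha\in D$). *Theorem.* Let $t\in T$. 1. At every $X\in D$, $H^{(k)}$ and $H^{(c)}$ are differentiable in $t$ and $\langle\xi f\ln f\rangle$ is differentiable in $X$. If $X\in D$ and the closed ball of radius $2\sigma$ about $X$ lies in $D$, then $J^{(k)}$ and $J^{(c)}$ are $C^1$ near $X$ (so for $D=\mathbb R^3$ they are $C^1$ everywhere). 2. (Pointwise form.) Let $X\in D$ be a point near which $J^{(k)}$ and $J^{(c)}$ are $C^1$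 and such that $\{\alpha\in\mathbb S^2: X+\sigma\alpha\in\partial D\}$ has surface measure zero (both hold automatically if the closed ball of radius $2\sigma$ about $X$ lies in $D$). Then at $(t,X)$ $$\frac{\partial H^{(k)}}{\partial t}+\frac{\partial}{\partial X_i}\big(\langle\xi_if\ln f\rangle+J^{(k)}_i\big)\le\mathcal I,\qquad \frac{\partial H^{(c)}}{\partial t}+\frac{\partial J^{(c)}_i}{\partial X_i}=-\mathcal I,\qquad \frac{\partial H}{\partial t}+\frac{\partial J^H_i}{\partial X_i}\le 0,$$ and equality holds in the last inequality if and only if detailed balance holds at $(t,X)$. 3. (On all of $D$, with no condition on $\partial D$ or on the fluxes.) $\partial_tH$ and $J^H$ are locally integrable on $D$, and $\partial_tH+\partial J^H_i/\partial X_i\le 0$ in the sense of distributions on $D$, i.e. $\int_D(\varphi\,\partial_tH-J^H\cdot\nabla\varphi)\,dX\le 0$ for all $0\le\varphi\in C_c^\infty(D)$. For every open $U\subseteq D$, the distribution $\partial_tH+\partial J^H_i/\partial X_i$ vanishes on $U$ if and only if detailed balance holds at every $X\in U$. -/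

import Mathlib

open MeasureTheory Set Metric
open scoped ContDiff

noncomputable section

namespace Enskog

/-- Three-dimensional Euclidean space, used for positions, velocities and directions. -/
abbrev E3 : Type := EuclideanSpace ℝ (Fin 3)

/-- The unit sphere of directions. -/
abbrev S2 : Type := sphere (0 : E3) 1

/-- The solid-angle (surface) measure `dΩ` on the unit sphere, of total mass `4π`. -/
abbrev solidAngle : Measure S2 := (volume : Measure E3).toSphere

/-- The Heaviside function, with value `1` at `0`. -/
def heaviside (x : ℝ) : ℝ := if 0 ≤ x then 1 else 0

/-- The indicator function `χ_D`. -/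
def chi (D : Set E3) (X : E3) : ℝ := D.indicator (fun _ => (1 : ℝ)) X

/-- `V_α = (ξ_* - ξ) · α`. -/
def relVel (α ξ ξs : E3) : ℝ := inner ℝ (ξs - ξ) α

/-- `ξ' = ξ + V_α α`. -/
def post (α ξ ξs : E3) : E3 := ξ + relVel α ξ ξs • α

/-- `ξ_*' = ξ_* - V_α α`. -/
def postStar (α ξ ξs : E3) : E3 := ξs - relVel α ξ ξs • α

/-- The divergence `∂ J_i / ∂ X_i` of a vector field on `ℝ³`. -/
def div (J : E3 → E3) (X : E3) : ℝ :=
  ∑ i : Fin 3, (fderiv ℝ J X (EuclideanSpace.single i 1)) i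

section Fields

/-! In this section `F X ξ` is the distribution function at a fixed time. -/

variable (m σ : ℝ) (S : ℝ → ℝ) (D : Set E3) (F : E3 → E3 → ℝ)

/-- The density `ρ(X) = ⟨f⟩`. -/
def density (X : E3) : ℝ := ∫ ξ, F X ξ

/-- The flow velocity `v = ⟨ξ f⟩ / ρ`. -/
def flow (X : E3) : E3 := (density F X)⁻¹ • ∫ ξ, F X ξ • ξ

/-- `R(X) = (1/m) ∫_D ρ(Y) θ(σ - |Y - X|) dY`. -/
def crowding (X : E3) : ℝ :=
  (1 / m) * ∫ Y in D, density F Y * heaviside (σ - ‖Y - X‖)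

/-- The modified Enskog factor `S(R(X)) + S(R(Y))`. -/
def enskogFactor (X Y : E3) : ℝ :=
  S (crowding m σ D F X) + S (crowding m σ D F Y)

/-- The Enskog factor cut off to pairs of points of `D`. -/
def cutFactor (X Y : E3) : ℝ := enskogFactor m σ S D F X Y * chi D X * chi D Y

/-- The gain term `J^G(f)`. -/
def gain (X ξ : E3) : ℝ :=
  (σ ^ 2 / m) * ∫ α : S2, (∫ ξs : E3,
    cutFactor m σ S D F (X + σ • (α : E3)) X
      * F (X + σ • (α : E3)) (postStar α ξ ξs) * F X (post α ξ ξs)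
      * (relVel α ξ ξs * heaviside (relVel α ξ ξs))) ∂solidAngle

/-- The loss term `J^L(f)`. -/
def loss (X ξ : E3) : ℝ :=
  (σ ^ 2 / m) * ∫ α : S2, (∫ ξs : E3,
    cutFactor m σ S D F (X - σ • (α : E3)) X
      * F (X - σ • (α : E3)) ξs * F X ξ
      * (relVel α ξ ξs * heaviside (relVel α ξ ξs))) ∂solidAngle

/-- The collision term `J(f) = J^G(f) - J^L(f)`. -/
def collision (X ξ : E3) : ℝ := gain m σ S D F X ξ - loss m σ S D F X ξ

/-- The kinetic part `⟨f ln f⟩` of the local H-function. -/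
def kineticH (X : E3) : ℝ := ∫ ξ, F X ξ * Real.log (F X ξ)

/-- The collisional part `ρ(X) ∫_0^{R(X)} S(x) dx` of the local H-function. -/
def collisionalH (X : E3) : ℝ :=
  density F X * ∫ x in (0 : ℝ)..crowding m σ D F X, S x

/-- The local H-function. -/
def localH (X : E3) : ℝ := kineticH F X + collisionalH m σ S D F X

/-- The convective flux `⟨ξ f ln f⟩`. -/
def convectiveFlux (X : E3) : E3 := ∫ ξ, (F X ξ * Real.log (F X ξ)) • ξ

/-- The flux `J^(k)`. -/
def kineticFlux (X : E3) : E3 :=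
  (σ ^ 3 / (2 * m)) • ∫ α : S2, (∫ ξ : E3, ∫ ξs : E3, ∫ τ in (0 : ℝ)..1,
    (cutFactor m σ S D F (X + (τ * σ) • (α : E3)) (X + ((τ - 1) * σ) • (α : E3))
      * (Real.log (F (X + (τ * σ) • (α : E3)) (post α ξ ξs) / F (X + (τ * σ) • (α : E3)) ξ)
        * F (X + (τ * σ) • (α : E3)) ξ * F (X + ((τ - 1) * σ) • (α : E3)) ξs)
      * (relVel α ξ ξs * heaviside (relVel α ξ ξs))) • (α : E3)) ∂solidAngle

/-- The flux `J^(c)`. -/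
def collisionalFlux (X : E3) : E3 :=
  collisionalH m σ S D F X • flow F X
    - (σ ^ 3 / (2 * m)) • ∫ α : S2, (∫ τ in (0 : ℝ)..1,
      (inner ℝ (flow F (X + (τ * σ) • (α : E3)) - flow F (X + ((τ - 1) * σ) • (α : E3))) (α : E3)
        * density F (X + (τ * σ) • (α : E3)) * density F (X + ((τ - 1) * σ) • (α : E3))
        * S (crowding m σ D F (X + (τ * σ) • (α : E3)))
        * chi D (X + ((τ - 1) * σ) • (α : E3)) * chi D (X + (τ * σ) • (α : E3)))
      • (α : E3)) ∂solidAngle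

/-- The total flux `J^H = ⟨ξ f ln f⟩ + J^(k) + J^(c)`. -/
def fluxH (X : E3) : E3 :=
  convectiveFlux F X + kineticFlux m σ S D F X + collisionalFlux m σ S D F X

/-- The collision integral `I` linking the kinetic and the collisional balance. -/
def exchange (X : E3) : ℝ :=
  (σ ^ 2 / (2 * m)) * ∫ α : S2, (∫ ξ : E3, ∫ ξs : E3,
    cutFactor m σ S D F X (X - σ • (α : E3))
      * (F (X - σ • (α : E3)) (postStar α ξ ξs) * F X (post α ξ ξs)
        - F X ξ * F (X - σ • (α : E3)) ξs)
      * (relVel α ξ ξs * heaviside (relVel α ξ ξs))) ∂solidAngle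

/-- Detailed balance at `X`: `f'_*(X - σα) f'(X) = f(X) f_*(X - σα)` for all velocities and for
all directions `α` in which molecules can collide, that is, for which the cut-off Enskog factor
is positive. When `S` is positive on the values of `R`, these are, for `X ∈ D`, exactly the `α`
with `X - σα ∈ D`. -/
def DetailedBalance (X : E3) : Prop :=
  ∀ α : S2, 0 < cutFactor m σ S D F X (X - σ • (α : E3)) → ∀ ξ ξs : E3,
    F (X - σ • (α : E3)) (postStar α ξ ξs) * F X (post α ξ ξs)
      = F X ξ * F (X - σ • (α : E3)) ξs

end Fields

/-- The Enskog equation on the time set `T` and the spatial domain `D`. -/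
def SolvesEnskog (m σ : ℝ) (S : ℝ → ℝ) (D : Set E3) (T : Set ℝ) (f : ℝ → E3 → E3 → ℝ) : Prop :=
  ∀ t ∈ T, ∀ X ∈ D, ∀ ξ : E3,
    deriv (fun s => f s X ξ) t + fderiv ℝ (fun Y => f t Y ξ) X ξ
      = collision m σ S D (f t) X ξ

/-- Positive `C¹` functions on `T × D × ℝ³` with rapid decay in the velocity, locally uniformly in
time and position (up to the boundary of `D`), and with polynomially bounded `ln f`, `∂_t ln f`
and, on compact subsets of `D`, `∇_X ln f`. -/
structure IsRegular (D : Set E3) (T : Set ℝ) (f : ℝ → E3 → E3 → ℝ) : Prop where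
  pos : ∀ t ∈ T, ∀ X ∈ D, ∀ ξ, 0 < f t X ξ
  contDiff : ContDiffOn ℝ 1 (fun p : ℝ × E3 × E3 => f p.1 p.2.1 p.2.2) (T ×ˢ D ×ˢ univ)
  decay : ∀ K ⊆ T, IsCompact K → ∀ r : ℝ, ∀ n : ℕ, ∃ C : ℝ,
    ∀ t ∈ K, ∀ X ∈ D ∩ ball 0 r, ∀ ξ, (1 + ‖ξ‖) ^ n * f t X ξ ≤ C
  log_bound : ∀ K ⊆ T, IsCompact K → ∀ r : ℝ, ∃ (C : ℝ) (n : ℕ),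
    ∀ t ∈ K, ∀ X ∈ D ∩ ball 0 r, ∀ ξ,
      |Real.log (f t X ξ)| ≤ C * (1 + ‖ξ‖) ^ n ∧
      |deriv (fun s => Real.log (f s X ξ)) t| ≤ C * (1 + ‖ξ‖) ^ n
  log_grad_bound : ∀ K ⊆ T, IsCompact K → ∀ L ⊆ D, IsCompact L → ∃ (C : ℝ) (n : ℕ),
    ∀ t ∈ K, ∀ X ∈ L, ∀ ξ,
      ‖fderiv ℝ (fun Y => Real.log (f t Y ξ)) X‖ ≤ C * (1 + ‖ξ‖) ^ n

/-- Smooth test functions with compact support in `U`. -/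
def IsTest (U : Set E3) (φ : E3 → ℝ) : Prop :=
  ContDiff ℝ ∞ φ ∧ HasCompactSupport φ ∧ tsupport φ ⊆ U

/-- The normal component of the vector field `j` vanishes on the boundary of the open set `D`
(weak form of `j · n = 0` on `∂D`; no condition at all when `D` is the whole space). The test
functions do not have to vanish on `∂D`. -/
def NoNormalFlux (D : Set E3) (j : E3 → E3) : Prop :=
  ∀ φ : E3 → ℝ, IsTest univ φ → ∫ X in D, (fderiv ℝ φ X (j X) + φ X * div j X) = 0

/-- The pairing with `φ` of the distribution `∂H/∂t + ∂J_i^H/∂X_i` at time `t`. -/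
def weakBalance (m σ : ℝ) (S : ℝ → ℝ) (D : Set E3) (f : ℝ → E3 → E3 → ℝ) (t : ℝ)
    (φ : E3 → ℝ) : ℝ :=
  ∫ X in D, (deriv (fun s => localH m σ S D (f s) X) t * φ X
    - fderiv ℝ φ X (fluxH m σ S D (f t) X))

end Enskog

end

/-! Fix the time and extend `f` and `∂_t f` by zero outside `D` (`zeroExt`, `Slice`). Everything
becomes a statement about one function `F`, its rate `G`, and two-point quantities `W α Y Z`. Write
avg W for the mean of `W α X (X - σα)` over directions (`pairAvg`) and Wˢ for `W (-α) Z Y`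
(`pairSwap`). By the fundamental theorem of calculus along the segment `X + τσα`, the divergence of
`σ • fluxOf σ W` is -(avg W - avg Wˢ) (`TwoPoint.integral_fderiv_fluxOf`, `TwoPoint.sourceOf_eq`).
So the antisymmetric part of a collisional source is a divergence, and only its symmetric part has
to be analysed.

Kinetic part. Testing the equation with 1 + ln f and passing to inverse collisions
(`weak_collision`) gives ∂_t⟨f ln f⟩ + div⟨ξ f ln f⟩ = (σ²/m) avg K, where K = `kinPair` carries f
f_* (ln f' - ln f). Its antisymmetric part is -div J^(k). In the symmetric part the logarithms
combine to f f_* ln(f' f'_* / (f f_*)), and a ln(b/a) ≤ b - a bounds it by the density `exchPair` of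
the exchange integral. The defect `prodPair` = `exchPair` - K - Kˢ is nonnegative.

Collisional part. Let j = ρv and let Φ be the primitive of S. Mass conservation gives ∂_t(ρΦ(R)) +
div(Φ(R) j) = S(R) (ρ ∂_t R + j·∇R). Both derivatives of R are sphere integrals by the divergence
theorem on the ball; for ∂_t R the impermeable boundary removes the contribution of ∂D
(`crowdRate_ae`). The result is -(σ²/m) avg W with W = `flowPair`. Again the antisymmetric part is a
divergence, now of the second term of J^(c). The symmetric part W + Wˢ equals `exchPair`: the
collision map turns the gain into ∫ f f_* V⁻, and V⁻ - V⁺ = -V leaves only moments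
(`integral_pair_exchange`, `exchPair_eq`). Hence the exchange integral enters with opposite signs
and cancels, and the total balance is -(σ²/2m) avg `prodPair`.

Regularity. Near ∂D the extended density jumps, so R is in general only Lipschitz and the fluxes
need not be differentiable. The flux identities are therefore proved weakly, with derivatives on the
test function or on Lipschitz functions. `div_eq_neg_of_weak` recovers the pointwise identity where
the flux is C¹ and the source is continuous; the latter holds if the sphere about `X` meets ∂D in a
null set of directions. If the 2σ-ball lies in `D`, the fluxes are shown to be C¹ directly
(`contDiffAt_fluxes`).

Equality. `prodPair` is nonnegative and continuous on `D × D`, so its mean vanishes only if it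
vanishes in every direction. Strictness of the logarithmic inequality gives detailed balance for V >
0, the inverse collision gives V < 0, and for V = 0 nothing happens. On open sets, continuity in `X`
at fixed `α` upgrades almost everywhere to everywhere. -/

noncomputable section

namespace Enskog

open Filter Topology

/-! ### Differentiation under the integral and weak divergences -/

section Tools

/-- An integrable weight on velocity space. -/
def wt (ξ : E3) : ℝ := ((1 + ‖ξ‖) ^ 4)⁻¹

lemma wt_pos (ξ : E3) : 0 < wt ξ := by unfold wt; positivity

lemma integrable_wt : Integrable wt (volume : Measure E3) := by
  have h := integrable_one_add_norm (E := E3) (μ := volume) (r := 4) (by simp; norm_num)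
  refine h.congr (ae_of_all _ fun x => ?_)
  simp only [wt]
  rw [Real.rpow_neg (by positivity)]
  norm_cast

/-- The derivative of a dominated parametric integral of `C¹` functions. -/
lemma hasFDerivAt_integral_of_contDiffOn {A V : Type*} [MeasurableSpace A] {μ : Measure A}
    [NormedAddCommGroup V] [NormedSpace ℝ V] {U : Set E3} (hU : IsOpen U)
    {F : E3 → A → V} {bound : A → ℝ}
    (hm : ∀ x ∈ U, AEStronglyMeasurable (F x) μ) (hb : Integrable bound μ)
    (hF : ∀ᵐ a ∂μ, ContDiffOn ℝ 1 (fun x => F x a) U)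
    (hF0 : ∀ᵐ a ∂μ, ∀ x ∈ U, ‖F x a‖ ≤ bound a)
    (hF1 : ∀ᵐ a ∂μ, ∀ x ∈ U, ‖fderiv ℝ (fun x => F x a) x‖ ≤ bound a) {x : E3} (hx : x ∈ U) :
    AEStronglyMeasurable (fun a => fderiv ℝ (fun x => F x a) x) μ ∧
    HasFDerivAt (fun x => ∫ a, F x a ∂μ) (∫ a, fderiv ℝ (fun x => F x a) x ∂μ) x := by
  have hdiff : ∀ᵐ a ∂μ, ∀ y ∈ U, HasFDerivAt (fun x => F x a) (fderiv ℝ (fun x => F x a) y) y := by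
    filter_upwards [hF] with a ha y hy
    exact ((ha.differentiableOn one_ne_zero).differentiableAt (hU.mem_nhds hy)).hasFDerivAt
  -- Only measurability in `a` at each fixed point is given. The derivative along each axis is a
  -- limit of difference quotients, whose base points lie in `U` from the index `n0` on.
  have hmeas : AEStronglyMeasurable (fun a => fderiv ℝ (fun x => F x a) x) μ := by
    have key : ∀ i : Fin 3, AEStronglyMeasurable
        (fun a => fderiv ℝ (fun x => F x a) x (EuclideanSpace.single i 1)) μ := by
      intro i
      have hlim : Tendsto (fun n : ℕ => x + ((n : ℝ))⁻¹ • EuclideanSpace.single i (1 : ℝ))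
          atTop (𝓝 x) := by
        have h0 : Tendsto (fun n : ℕ => ((n : ℝ))⁻¹) atTop (𝓝 0) :=
          tendsto_inv_atTop_zero.comp tendsto_natCast_atTop_atTop
        simpa using tendsto_const_nhds.add (h0.smul_const (EuclideanSpace.single i (1 : ℝ)))
      obtain ⟨n0, hn0⟩ := eventually_atTop.1 (hlim (hU.mem_nhds hx))
      refine aestronglyMeasurable_of_tendsto_ae (u := atTop)
        (f := fun (n : ℕ) a => ((n0 + n : ℕ) : ℝ) •
          (F (x + (((n0 + n : ℕ) : ℝ))⁻¹ • EuclideanSpace.single i (1 : ℝ)) a - F x a)) ?_ ?_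
      · intro n
        exact ((hm _ (hn0 _ (Nat.le_add_right _ _))).sub (hm x hx)).const_smul _
      · filter_upwards [hdiff] with a ha
        have h2 : Tendsto (fun n : ℕ => ((n0 + n : ℕ) : ℝ)) atTop atTop :=
          tendsto_natCast_atTop_atTop.comp (tendsto_atTop_mono (fun n => Nat.le_add_left n n0)
            tendsto_id)
        exact ((ha x hx).lim_real (EuclideanSpace.single i (1 : ℝ))).comp h2
    have hsum : (fun a => fderiv ℝ (fun x => F x a) x) = fun a => ∑ i : Fin 3,
        (EuclideanSpace.proj i : E3 →L[ℝ] ℝ).smulRight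
          (fderiv ℝ (fun x => F x a) x (EuclideanSpace.single i 1)) := by
      funext a
      ext v
      conv_lhs => rw [← (EuclideanSpace.basisFun (Fin 3) ℝ).sum_repr v]
      simp
    rw [hsum]
    refine Finset.aestronglyMeasurable_fun_sum _ fun i _ => ?_
    exact (ContinuousLinearMap.smulRightL ℝ E3 V (EuclideanSpace.proj i)).continuous.comp_aestronglyMeasurable
      (key i)
  refine ⟨hmeas, hasFDerivAt_integral_of_dominated_of_fderiv_le (s := U) (bound := bound)
    (F' := fun x a => fderiv ℝ (fun x => F x a) x) (hU.mem_nhds hx) ?_ ?_ hmeas hF1 hb hdiff⟩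
  · filter_upwards [hU.mem_nhds hx] with y hy using hm y hy
  · refine hb.mono' (hm x hx) ?_
    filter_upwards [hF0] with a ha using ha x hx

/-- A dominated parametric integral of `C¹` functions is `C¹`. -/
lemma contDiffOn_integral_of_contDiffOn {A V : Type*} [MeasurableSpace A] {μ : Measure A}
    [NormedAddCommGroup V] [NormedSpace ℝ V] {U : Set E3} (hU : IsOpen U)
    {F : E3 → A → V} {bound : A → ℝ}
    (hm : ∀ x ∈ U, AEStronglyMeasurable (F x) μ) (hb : Integrable bound μ)
    (hF : ∀ᵐ a ∂μ, ContDiffOn ℝ 1 (fun x => F x a) U)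
    (hF0 : ∀ᵐ a ∂μ, ∀ x ∈ U, ‖F x a‖ ≤ bound a)
    (hF1 : ∀ᵐ a ∂μ, ∀ x ∈ U, ‖fderiv ℝ (fun x => F x a) x‖ ≤ bound a) :
    ContDiffOn ℝ 1 (fun x => ∫ a, F x a ∂μ) U := by
  have h := fun x (hx : x ∈ U) => hasFDerivAt_integral_of_contDiffOn hU hm hb hF hF0 hF1 hx
  rw [show (1 : WithTop ℕ∞) = 0 + 1 by simp, contDiffOn_succ_iff_fderiv_of_isOpen hU]
  refine ⟨fun x hx => (h x hx).2.differentiableAt.differentiableWithinAt, by simp, ?_⟩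
  rw [contDiffOn_zero]
  have hc : ContinuousOn (fun x => ∫ a, fderiv ℝ (fun x => F x a) x ∂μ) U := by
    refine continuousOn_of_dominated (bound := bound) (fun x hx => (h x hx).1)
      (fun x hx => ?_) hb ?_
    · filter_upwards [hF1] with a ha using ha x hx
    · filter_upwards [hF] with a ha using ha.continuousOn_fderiv_of_isOpen hU le_rfl
  exact hc.congr fun x hx => (h x hx).2.fderiv

lemma sum_coord_smul_apply (L : E3 →L[ℝ] ℝ) (v : E3) :
    ∑ i : Fin 3, v i * L (EuclideanSpace.single i 1) = L v := by
  conv_rhs => rw [← (EuclideanSpace.basisFun (Fin 3) ℝ).sum_repr v]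
  simp

section TestField

variable {U : Set E3} {J : E3 → E3} {φ : E3 → ℝ}

/-- Off the support of `φ` the product vanishes near every point, so the behaviour of `J` outside
`U` does not matter. -/
lemma contDiff_mul_coord (hU : IsOpen U) (hJ : ContDiffOn ℝ 1 J U) (hφ : IsTest U φ) (i : Fin 3) :
    ContDiff ℝ 1 (fun X => φ X * J X i) := by
  obtain ⟨hs, hc, hsub⟩ := hφ
  have hs1 : ContDiff ℝ 1 φ := hs.of_le (by exact_mod_cast le_top)
  rw [contDiff_iff_contDiffAt]
  intro X
  by_cases hX : X ∈ tsupport φ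
  · exact hs1.contDiffAt.mul ((contDiffOn_euclidean.1 hJ i).contDiffAt (hU.mem_nhds (hsub hX)))
  · refine (contDiffAt_const (c := (0 : ℝ))).congr_of_eventuallyEq ?_
    filter_upwards [(isClosed_tsupport φ).isOpen_compl.mem_nhds hX] with Y hY
    simp [image_eq_zero_of_notMem_tsupport hY]

lemma sum_fderiv_mul_coord (hU : IsOpen U) (hJ : ContDiffOn ℝ 1 J U) (hφ : IsTest U φ) (X : E3) :
    ∑ i : Fin 3, fderiv ℝ (fun X => φ X * J X i) X (EuclideanSpace.single i 1)
      = fderiv ℝ φ X (J X) + φ X * div J X := by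
  obtain ⟨hs, hc, hsub⟩ := hφ
  have hs1 : ContDiff ℝ 1 φ := hs.of_le (by exact_mod_cast le_top)
  by_cases hX : X ∈ tsupport φ
  · have hd : ∀ i, DifferentiableAt ℝ (fun X => J X i) X := fun i =>
      ((contDiffOn_euclidean.1 hJ i).contDiffAt (hU.mem_nhds (hsub hX))).differentiableAt one_ne_zero
    have hdJ : DifferentiableAt ℝ J X :=
      (hJ.contDiffAt (hU.mem_nhds (hsub hX))).differentiableAt one_ne_zero
    have hco : ∀ i, fderiv ℝ (fun X => J X i) X (EuclideanSpace.single i 1)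
        = (fderiv ℝ J X (EuclideanSpace.single i 1)) i := fun i => by
      have := ((EuclideanSpace.proj i : E3 →L[ℝ] ℝ).hasFDerivAt.comp X hdJ.hasFDerivAt).fderiv
      have h2 : (fun X => J X i) = (EuclideanSpace.proj i : E3 →L[ℝ] ℝ) ∘ J := by
        ext; simp
      rw [h2, this]; simp
    have : ∀ i, fderiv ℝ (fun X => φ X * J X i) X (EuclideanSpace.single i 1)
        = φ X * (fderiv ℝ J X (EuclideanSpace.single i 1)) i
          + J X i * fderiv ℝ φ X (EuclideanSpace.single i 1) := fun i => by
      rw [fderiv_fun_mul ((hs1.differentiable one_ne_zero) X) (hd i)]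
      simp [hco i]
    simp_rw [this, Finset.sum_add_distrib, sum_coord_smul_apply, ← Finset.mul_sum]
    rw [div]; ring
  · have hz : ∀ i, (fun X => φ X * J X i) =ᶠ[𝓝 X] fun _ => 0 := fun i => by
      filter_upwards [(isClosed_tsupport φ).isOpen_compl.mem_nhds hX] with Y hY
      simp [image_eq_zero_of_notMem_tsupport hY]
    have hz2 : φ =ᶠ[𝓝 X] fun _ => 0 := by
      filter_upwards [(isClosed_tsupport φ).isOpen_compl.mem_nhds hX] with Y hY
      simp [image_eq_zero_of_notMem_tsupport hY]
    simp [(hz _).fderiv_eq, hz2.fderiv_eq, image_eq_zero_of_notMem_tsupport hX]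

/-- The divergence theorem for the product of a Lipschitz function, a test function and a vector
field that is `C¹` near the support of the test function. -/
lemma integral_lipschitz_div (hU : IsOpen U) (hJ : ContDiffOn ℝ 1 J U) (hφ : IsTest U φ)
    {u : E3 → ℝ} {K : NNReal} (hu : LipschitzWith K u) :
    Integrable (fun X => u X * (fderiv ℝ φ X (J X) + φ X * div J X)) ∧
    Integrable (fun X => φ X * fderiv ℝ u X (J X)) ∧
    ∫ X, u X * (fderiv ℝ φ X (J X) + φ X * div J X) = - ∫ X, φ X * fderiv ℝ u X (J X) := by
  have hw := contDiff_mul_coord hU hJ hφ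
  have hcw : ∀ i : Fin 3, HasCompactSupport (fun X => φ X * J X i) := fun i => hφ.2.1.mul_right
  have h1 : ∀ i : Fin 3, Integrable (fun X =>
      u X * fderiv ℝ (fun X => φ X * J X i) X (EuclideanSpace.single i 1)) := fun i =>
    (hu.continuous.mul (((hw i).continuous_fderiv one_ne_zero).clm_apply
      continuous_const)).integrable_of_hasCompactSupport ((hcw i).fderiv_apply (𝕜 := ℝ) _).mul_left
  have h2 : ∀ i : Fin 3, Integrable (fun X =>
      (φ X * J X i) * lineDeriv ℝ u X (EuclideanSpace.single i 1)) := fun i =>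
    (hu.locallyIntegrable_lineDeriv (μ := volume) _).integrable_smul_left_of_hasCompactSupport
      (hw i).continuous (hcw i)
  have h3 : ∀ i : Fin 3, ∫ X, u X * fderiv ℝ (fun X => φ X * J X i) X (EuclideanSpace.single i 1)
      = - ∫ X, (φ X * J X i) * lineDeriv ℝ u X (EuclideanSpace.single i 1) := fun i => by
    -- `φ J_i` is Lipschitz with compact support, so integration by parts for two Lipschitz
    -- functions applies in each coordinate.
    obtain ⟨C, hC⟩ := (hw i).lipschitzWith_of_hasCompactSupport (hcw i) one_ne_zero
    have h4 := hu.integral_lineDeriv_mul_eq (μ := volume) hC (hcw i) (EuclideanSpace.single i 1)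
    simp only [mul_comm (φ _ * _)]
    rw [h4, ← integral_neg]
    refine integral_congr_ae (ae_of_all _ fun X => ?_)
    simp only []
    rw [((hw i).differentiable one_ne_zero X).lineDeriv_eq_fderiv, map_neg]
    ring
  -- By Rademacher's theorem the line derivatives of `u` assemble almost everywhere into its total
  -- derivative.
  have hae : (fun X => φ X * fderiv ℝ u X (J X)) =ᵐ[volume] fun X =>
      ∑ i : Fin 3, (φ X * J X i) * lineDeriv ℝ u X (EuclideanSpace.single i 1) := by
    filter_upwards [hu.ae_differentiableAt] with X hX
    rw [← sum_coord_smul_apply, Finset.mul_sum]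
    exact Finset.sum_congr rfl fun i _ => by rw [hX.lineDeriv_eq_fderiv]; ring
  have hpt : (fun X => u X * (fderiv ℝ φ X (J X) + φ X * div J X)) = fun X =>
      ∑ i : Fin 3, u X * fderiv ℝ (fun X => φ X * J X i) X (EuclideanSpace.single i 1) := by
    funext X
    rw [← Finset.mul_sum, sum_fderiv_mul_coord hU hJ hφ]
  refine ⟨?_, (integrable_finsetSum _ fun i _ => h2 i).congr hae.symm, ?_⟩
  · rw [hpt]; exact integrable_finsetSum _ fun i _ => h1 i
  · rw [hpt, integral_congr_ae hae, integral_finsetSum _ fun i _ => h1 i,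
      integral_finsetSum _ fun i _ => h2 i, ← Finset.sum_neg_distrib]
    exact Finset.sum_congr rfl fun i _ => h3 i

lemma integrable_fderiv_apply (hφ : ContDiff ℝ 1 φ) (hc : HasCompactSupport φ)
    (hJ : LocallyIntegrable J) : Integrable fun X => fderiv ℝ φ X (J X) := by
  have h1 : ∀ i : Fin 3, Integrable fun X =>
      fderiv ℝ φ X (EuclideanSpace.single i 1) * J X i := fun i => by
    have h2 : LocallyIntegrable fun X => J X i := fun X => by
      obtain ⟨s, hs, hi⟩ := hJ X
      exact ⟨s, hs, (EuclideanSpace.proj i : E3 →L[ℝ] ℝ).integrable_comp hi⟩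
    exact h2.integrable_smul_left_of_hasCompactSupport
      ((hφ.continuous_fderiv one_ne_zero).clm_apply continuous_const) (hc.fderiv_apply (𝕜 := ℝ) _)
  refine (integrable_finsetSum Finset.univ fun i _ => h1 i).congr (ae_of_all _ fun X => ?_)
  simp only []
  rw [← sum_coord_smul_apply (fderiv ℝ φ X)]
  exact Finset.sum_congr rfl fun i _ => mul_comm _ _

/-- The divergence theorem for a test function times a vector field that is `C¹` near its
support. -/
lemma integral_div_eq (hU : IsOpen U) (hJ : ContDiffOn ℝ 1 J U) (hφ : IsTest U φ) :
    ∫ X, fderiv ℝ φ X (J X) = - ∫ X, φ X * div J X := by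
  obtain ⟨hA, -, hsum⟩ := integral_lipschitz_div hU hJ hφ
    (LipschitzWith.const (1 : ℝ) : LipschitzWith 0 fun _ : E3 => (1 : ℝ))
  simp only [one_mul, fderiv_fun_const, Pi.zero_apply, zero_apply, mul_zero, integral_zero,
    neg_zero] at hA hsum
  obtain ⟨hs, hc, hsub⟩ := hφ
  -- The case u = 1 says that the two terms have total integral zero. Integrability of each one is
  -- what allows splitting the sum.
  have hB : Integrable (fun X => φ X * div J X) := by
    have hcont : Continuous (fun X => φ X * div J X) := by
      rw [continuous_iff_continuousAt]
      intro X
      by_cases hX : X ∈ tsupport φ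
      · have h3 : ContinuousAt (div J) X := by
          have := (hJ.continuousOn_fderiv_of_isOpen hU le_rfl).continuousAt
            (hU.mem_nhds (hsub hX))
          unfold div
          exact tendsto_finsetSum _ fun i _ =>
            ((EuclideanSpace.proj i : E3 →L[ℝ] ℝ).continuous.continuousAt.comp
              (this.clm_apply continuousAt_const))
        exact hs.continuous.continuousAt.mul h3
      · refine (continuousAt_const (y := (0 : ℝ))).congr ?_
        filter_upwards [(isClosed_tsupport φ).isOpen_compl.mem_nhds hX] with Y hY
        simp [image_eq_zero_of_notMem_tsupport hY]
    exact hcont.integrable_of_hasCompactSupport hc.mul_right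
  have hC : Integrable (fun X => fderiv ℝ φ X (J X)) := by
    refine (hA.sub hB).congr (ae_of_all _ fun X => ?_)
    simp
  rw [integral_add hC hB] at hsum
  linarith

end TestField

/-- A distributional divergence that is continuous at a point where the field is `C¹` is the
pointwise divergence there. -/
lemma div_eq_neg_of_weak {D : Set E3} (hD : IsOpen D) {J : E3 → E3} {h : E3 → ℝ} {X : E3}
    (hX : X ∈ D) (hJ : ContDiffAt ℝ 1 J X) (hh : ContinuousAt h X) (hl : LocallyIntegrableOn h D)
    (hw : ∀ φ, IsTest D φ → ∫ Y, fderiv ℝ φ Y (J Y) = ∫ Y, φ Y * h Y) :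
    div J X = - h X := by
  obtain ⟨U, hU, hJU⟩ := hJ.contDiffOn' le_rfl (by simp)
  simp only [mem_univ, insert_eq_of_mem, univ_inter] at hJU
  obtain ⟨hXU, hJU⟩ := hJU
  set V := U ∩ D with hV
  have hVo : IsOpen V := hU.inter hD
  have hJV : ContDiffOn ℝ 1 J V := hJU.mono inter_subset_left
  have hdc : ContinuousOn (div J) V := by
    have := hJV.continuousOn_fderiv_of_isOpen hVo le_rfl
    unfold div
    exact continuousOn_finsetSum _ fun i _ =>
      ((EuclideanSpace.proj i : E3 →L[ℝ] ℝ).continuous.comp_continuousOn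
        (this.clm_apply continuousOn_const))
  have hhV : LocallyIntegrableOn h V := hl.mono_set inter_subset_right
  have hdV : LocallyIntegrableOn (div J) V := hdc.locallyIntegrableOn hVo.measurableSet
  -- On `V` the field is C¹, so its weak divergence is the classical one, and the fundamental lemma
  -- of the calculus of variations applies.
  have hae : ∀ᵐ Y, Y ∈ V → div J Y + h Y = 0 := by
    refine hVo.ae_eq_zero_of_integral_contDiff_smul_eq_zero (hdV.add hhV) ?_
    intro φ h1 h2 h3
    have hφV : IsTest V φ := ⟨h1, h2, h3⟩
    have e1 := integral_div_eq hVo hJV hφV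
    have e2 := hw φ ⟨h1, h2, h3.trans inter_subset_right⟩
    have key : ∀ k : E3 → ℝ, LocallyIntegrableOn k V → Integrable (fun Y => φ Y * k Y) := by
      intro k hk
      have := (hk.integrableOn_compact_subset h3 h2).continuousOn_mul
        h1.continuous.continuousOn h2
      rwa [integrableOn_iff_integrable_of_support_subset] at this
      intro Y hY
      by_contra hn
      simp [image_eq_zero_of_notMem_tsupport hn] at hY
    simp only [smul_eq_mul, mul_add]
    rw [integral_add (key _ hdV) (key _ hhV)]
    linarith
  -- Both terms are continuous at `X`; a nonzero value there would persist on a neighbourhood, which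
  -- has positive measure.
  by_contra hne
  have hcont : ContinuousAt (fun Y => div J Y + h Y) X :=
    (hdc.continuousAt (hVo.mem_nhds ⟨hXU, hX⟩)).add hh
  have hev : ∀ᶠ Y in 𝓝 X, div J Y + h Y ≠ 0 ∧ Y ∈ V :=
    (hcont.eventually_ne (by intro h0; apply hne; linarith)).and (hVo.mem_nhds ⟨hXU, hX⟩)
  have := (Measure.measure_pos_of_mem_nhds (volume : Measure E3) hev).ne'
  apply this
  refine measure_mono_null (fun Y hY => ?_) hae
  simp only [mem_ofPred_eq, compl_ofPred] at hY ⊢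
  intro hcon
  exact hY.1 (hcon hY.2)

end Tools

/-! ### Directions, the collision involution and polar coordinates -/

section Sphere

-- The measure of a set of directions is a multiple of the volume of the cone over it, and negation
-- maps cones to cones preserving volume.
open scoped Pointwise in
lemma measurePreserving_neg_solidAngle :
    MeasurePreserving (fun α : S2 => -α) solidAngle solidAngle := by
  have hm : Measurable (fun α : S2 => -α) := continuous_neg.measurable
  refine ⟨hm, ?_⟩
  ext s hs
  rw [Measure.map_apply hm hs, Measure.toSphere_apply' _ (hm hs), Measure.toSphere_apply' _ hs]
  congr 1
  have : Ioo (0 : ℝ) 1 • ((↑) '' ((fun α : S2 => -α) ⁻¹' s) : Set E3)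
      = -(Ioo (0 : ℝ) 1 • ((↑) '' s : Set E3)) := by
    ext x
    simp only [Set.mem_neg, Set.mem_smul, mem_image, mem_preimage]
    constructor
    · rintro ⟨r, hr, _, ⟨a, ha, rfl⟩, rfl⟩
      exact ⟨r, hr, _, ⟨-a, ha, rfl⟩, by simp⟩
    · rintro ⟨r, hr, _, ⟨a, ha, rfl⟩, h⟩
      refine ⟨r, hr, _, ⟨-a, by simpa using ha, rfl⟩, ?_⟩
      rw [← neg_neg x, ← h]; simp
  rw [this, Measure.measure_neg]

lemma integral_neg_solidAngle {V : Type*} [NormedAddCommGroup V] [NormedSpace ℝ V] (h : S2 → V) :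
    ∫ α, h (-α) ∂solidAngle = ∫ α, h α ∂solidAngle :=
  measurePreserving_neg_solidAngle.integral_comp
    (Homeomorph.neg S2).measurableEmbedding h

lemma norm_dir (α : S2) : ‖(α : E3)‖ = 1 := by simp

lemma inner_dir_self (α : S2) : inner ℝ (α : E3) (α : E3) = 1 := by
  rw [real_inner_self_eq_norm_sq, norm_dir]; norm_num

/-- A collision reverses the component of the relative velocity along `α`. This uses `‖α‖ = 1` and
makes the collision map an involution. -/
lemma relVel_coll (α : S2) (ξ ξs : E3) :
    relVel α (post α ξ ξs) (postStar α ξ ξs) = - relVel α ξ ξs := by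
  simp only [relVel, post, postStar]
  have h := inner_dir_self α
  simp only [inner_sub_left, inner_add_left, inner_smul_left, h]
  simp

lemma post_coll (α : S2) (ξ ξs : E3) :
    post α (post α ξ ξs) (postStar α ξ ξs) = ξ := by
  rw [post, relVel_coll, post]; simp

lemma postStar_coll (α : S2) (ξ ξs : E3) :
    postStar α (post α ξ ξs) (postStar α ξ ξs) = ξs := by
  rw [postStar, relVel_coll, postStar]; simp

lemma relVel_neg (α ξ ξs : E3) : relVel (-α) ξ ξs = - relVel α ξ ξs := by simp [relVel]

lemma post_neg (α ξ ξs : E3) : post (-α) ξ ξs = post α ξ ξs := by simp [post, relVel_neg]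

lemma postStar_neg (α ξ ξs : E3) : postStar (-α) ξ ξs = postStar α ξ ξs := by
  simp [postStar, relVel_neg]

lemma relVel_swap (α ξ ξs : E3) : relVel α ξs ξ = - relVel α ξ ξs := by
  simp [relVel, inner_sub_left]

lemma post_swap (α ξ ξs : E3) : post α ξs ξ = postStar α ξ ξs := by
  simp [post, postStar, relVel_swap α ξ ξs, sub_eq_add_neg]

/-- The collision map on pairs of velocities. -/
def coll (α : E3) : E3 × E3 →ₗ[ℝ] E3 × E3 where
  toFun p := (post α p.1 p.2, postStar α p.1 p.2)
  map_add' p q := by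
    ext1 <;> simp [post, postStar, relVel, inner_sub_left, inner_add_left] <;> module
  map_smul' c p := by
    ext1 <;> simp [post, postStar, relVel, inner_sub_left, inner_smul_left] <;> module

lemma coll_apply (α : E3) (p : E3 × E3) : coll α p = (post α p.1 p.2, postStar α p.1 p.2) := rfl

lemma coll_coll (α : S2) (p : E3 × E3) : coll α (coll α p) = p := by
  simp [coll_apply, post_coll, postStar_coll]

/-- A linear involution has determinant of square one, hence preserves Lebesgue measure. -/
lemma map_coll (α : S2) : Measure.map (coll α) (volume : Measure (E3 × E3)) = volume := by
  have h2 : coll α ∘ₗ coll α = LinearMap.id := by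
    ext1 <;> ext p <;> simp [coll_coll]
  have h3 : LinearMap.det (coll (α : E3)) * LinearMap.det (coll (α : E3)) = 1 := by
    rw [← LinearMap.det_comp, h2, LinearMap.det_id]
  have h4 : |LinearMap.det (coll (α : E3))| = 1 := by
    rcases mul_self_eq_one_iff.1 h3 with h | h <;> simp [h]
  have : (volume : Measure (E3 × E3)).IsAddHaarMeasure :=
    inferInstanceAs ((volume : Measure E3).prod (volume : Measure E3)).IsAddHaarMeasure
  rw [Measure.map_linearMap_addHaar_eq_smul_addHaar _ (by intro h; simp [h] at h3), abs_inv, h4]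
  simp

/-- The measure on directions and pairs of velocities. -/
abbrev collMeasure : Measure (S2 × (E3 × E3)) := solidAngle.prod volume

lemma continuous_coll_uncurry :
    Continuous (Function.uncurry fun (α : S2) (p : E3 × E3) => coll α p) := by
  simp only [Function.uncurry_def, coll_apply, post, postStar, relVel]
  fun_prop

/-- The involution exchanging direct and inverse collisions. -/
def collInv : S2 × (E3 × E3) ≃ᵐ S2 × (E3 × E3) :=
  MeasurableEquiv.ofInvolutive (fun q => (-q.1, coll q.1 q.2))
    (fun q => by
      have : coll (-(q.1 : E3)) = coll (q.1 : E3) := by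
        ext1 <;> ext1 p <;> simp [coll_apply, post_neg, postStar_neg]
      simp [this, coll_coll])
    ((continuous_neg.comp continuous_fst).prodMk
      (continuous_coll_uncurry)).measurable

lemma collInv_apply (q : S2 × (E3 × E3)) :
    collInv q = (-q.1, post q.1 q.2.1 q.2.2, postStar q.1 q.2.1 q.2.2) := rfl

/-- The direction is reversed along with the collision so that the value of `V` is kept, and with it
the cutoff θ(V); at the same time `X + σα` becomes `X - σα`. Measure is preserved fibrewise over the
directions. -/
lemma measurePreserving_collInv : MeasurePreserving collInv collMeasure collMeasure :=
  measurePreserving_neg_solidAngle.skew_product continuous_coll_uncurry.measurable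
    (ae_of_all _ fun α => map_coll α)

/-- Fubini's theorem for integrals over a velocity, a direction and a second velocity. -/
lemma integral_velocity_swap {V : Type*} [NormedAddCommGroup V] [NormedSpace ℝ V]
    {k : S2 → E3 → E3 → V}
    (hk : Integrable (fun q : S2 × (E3 × E3) => k q.1 q.2.1 q.2.2) collMeasure) :
    Integrable (fun ξ => ∫ α, (∫ ξs, k α ξ ξs) ∂solidAngle) ∧
      ∫ ξ, (∫ α, (∫ ξs, k α ξ ξs) ∂solidAngle)
        = ∫ q : S2 × (E3 × E3), k q.1 q.2.1 q.2.2 ∂collMeasure := by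
  have h1 : Integrable (fun q : (S2 × E3) × E3 => k q.1.1 q.1.2 q.2)
      ((solidAngle.prod volume).prod volume) := by
    have := (measurePreserving_prodAssoc solidAngle (volume : Measure E3)
      (volume : Measure E3)).integrable_comp_of_integrable (g := fun q : S2 × (E3 × E3) =>
        k q.1 q.2.1 q.2.2) hk
    exact this
  have h2 := h1.integral_prod_left
  refine ⟨h2.integral_prod_right, ?_⟩
  rw [← integral_integral_swap (f := fun α ξ => ∫ ξs, k α ξ ξs) h2, integral_prod _ hk]
  refine integral_congr_ae ?_
  filter_upwards [hk.prod_right_ae] with α hα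
  exact (integral_prod (fun p : E3 × E3 => k α p.1 p.2) hα).symm

/-- Integration in polar coordinates. -/
lemma integral_polar {g : E3 → ℝ} (hg : Integrable g) :
    ∫ x, g x = ∫ r in Ioi (0 : ℝ), r ^ 2 * ∫ α : S2, g (r • (α : E3)) ∂solidAngle := by
  have hfin : Module.finrank ℝ E3 = 3 := by simp
  have hmp := (volume : Measure E3).measurePreserving_homeomorphUnitSphereProd
  rw [hfin] at hmp
  have hemb := (homeomorphUnitSphereProd E3).measurableEmbedding
  have h0 : ∫ x, g x = ∫ x : ({(0)}ᶜ : Set E3), g x.1 ∂((volume : Measure E3).comap (↑)) := by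
    rw [integral_subtype_comap (measurableSet_singleton _).compl fun x => g x,
      restrict_compl_singleton]
  have hco : ∀ x : ({(0)}ᶜ : Set E3), g x.1 =
      (fun q : S2 × Ioi (0 : ℝ) => g ((q.2 : ℝ) • (q.1 : E3))) (homeomorphUnitSphereProd E3 x) := by
    intro x
    have hx : ‖(x : E3)‖ ≠ 0 := norm_ne_zero_iff.2 x.2
    simp [homeomorphUnitSphereProd, smul_smul, hx]
  have hint : Integrable (fun q : S2 × Ioi (0 : ℝ) => g ((q.2 : ℝ) • (q.1 : E3)))
      (solidAngle.prod (Measure.volumeIoiPow 2)) := by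
    rw [← hmp.integrable_comp_emb hemb]
    have : Integrable (fun x : ({(0)}ᶜ : Set E3) => g x.1) ((volume : Measure E3).comap (↑)) := by
      have := (integrableOn_iff_comap_subtypeVal (μ := (volume : Measure E3)) (f := g)
        (measurableSet_singleton (0 : E3)).compl).1 hg.integrableOn
      exact this
    refine this.congr (ae_of_all _ fun x => ?_)
    exact hco x
  have h5 := hmp.integral_comp hemb (fun q : S2 × Ioi (0 : ℝ) => g ((q.2 : ℝ) • (q.1 : E3)))
  rw [h0, (integral_congr_ae (ae_of_all _ hco)).trans h5, integral_prod_symm _ hint, Measure.volumeIoiPow]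
  simp only [ENNReal.ofReal]
  rw [integral_withDensity_eq_integral_smul
      ((measurable_subtype_coe.pow_const _).real_toNNReal),
    integral_subtype_comap measurableSet_Ioi fun a : ℝ => Real.toNNReal (a ^ 2) •
      ∫ α : S2, g (a • (α : E3)) ∂solidAngle]
  refine setIntegral_congr_fun measurableSet_Ioi fun x hx => ?_
  simp only [NNReal.smul_def, smul_eq_mul]
  rw [Real.coe_toNNReal _ (by positivity)]

end Sphere

/-! ### The divergence theorem on a ball -/

section Ball

/-- A Lipschitz cutoff of the ball of radius `σ`. -/
def cutoff (σ ε : ℝ) (z : E3) : ℝ := max 0 (min 1 ((σ - ‖z‖) / ε))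

lemma lipschitzWith_cutoff (σ : ℝ) {ε : ℝ} (hε : 0 < ε) :
    LipschitzWith (Real.toNNReal ε⁻¹) (cutoff σ ε) := by
  have h1 : LipschitzWith (Real.toNNReal ε⁻¹) (fun z : E3 => (σ - ‖z‖) / ε) := by
    refine LipschitzWith.of_dist_le_mul fun x y => ?_
    rw [Real.dist_eq, ← sub_div, abs_div, abs_of_pos hε, dist_eq_norm, div_eq_inv_mul]
    rw [Real.coe_toNNReal _ (by positivity)]
    gcongr
    rw [sub_sub_sub_cancel_left, abs_sub_comm]
    exact abs_norm_sub_norm_le x y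
  exact (h1.const_min 1).const_max 0

lemma cutoff_nonneg (σ ε : ℝ) (z : E3) : 0 ≤ cutoff σ ε z := le_max_left _ _

lemma cutoff_le_one (σ ε : ℝ) (z : E3) : cutoff σ ε z ≤ 1 := by
  simp [cutoff]

/-- The cutoff is radial: constant inside and outside the shell, of slope `-1/ε` in it. The two
bounding spheres are null sets. -/
lemma lineDeriv_cutoff {σ ε : ℝ} (hε : 0 < ε) (hεσ : ε < σ) (e : E3) :
    ∀ᵐ z : E3, lineDeriv ℝ (cutoff σ ε) z e =
      -ε⁻¹ * (Ioo (σ - ε) σ).indicator (fun _ => (1 : ℝ)) ‖z‖ * (inner ℝ z e / ‖z‖) := by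
  have h1 : ∀ᵐ z : E3, z ∉ sphere (0 : E3) σ :=
    measure_eq_zero_iff_ae_notMem.1 (Measure.addHaar_sphere volume 0 σ)
  have h2 : ∀ᵐ z : E3, z ∉ sphere (0 : E3) (σ - ε) :=
    measure_eq_zero_iff_ae_notMem.1 (Measure.addHaar_sphere volume 0 (σ - ε))
  filter_upwards [h1, h2] with z hz1 hz2
  simp only [mem_sphere_iff_norm, sub_zero] at hz1 hz2
  rcases lt_or_gt_of_ne hz2 with hlt | hgt
  · have : cutoff σ ε =ᶠ[𝓝 z] fun _ => 1 := by
      filter_upwards [(continuous_norm.continuousAt (x := z)).eventually (gt_mem_nhds hlt)]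
        with y hy
      have : 1 ≤ (σ - ‖y‖) / ε := by rw [le_div_iff₀ hε]; linarith
      simp [cutoff, this]
    rw [this.lineDeriv_eq, indicator_of_notMem (by simp; intro h; linarith)]
    simp [lineDeriv]
  rcases lt_or_gt_of_ne hz1 with hlt' | hgt'
  · have : cutoff σ ε =ᶠ[𝓝 z] fun y => (σ - ‖y‖) / ε := by
      filter_upwards [(continuous_norm.continuousAt (x := z)).eventually (gt_mem_nhds hlt'),
        (continuous_norm.continuousAt (x := z)).eventually (lt_mem_nhds hgt)] with y hy hy'
      have h3 : (σ - ‖y‖) / ε ≤ 1 := by rw [div_le_iff₀ hε]; linarith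
      have h4 : 0 ≤ (σ - ‖y‖) / ε := div_nonneg (by linarith) hε.le
      simp [cutoff, h3, h4]
    have hz0 : z ≠ 0 := by
      rintro rfl; simp at hgt; linarith
    have hd : HasFDerivAt (fun y : E3 => ‖y‖) ((‖z‖⁻¹) • innerSL ℝ z) z := by
      have h := (hasStrictFDerivAt_norm_sq z).hasFDerivAt.sqrt
        (pow_ne_zero 2 (norm_ne_zero_iff.2 hz0))
      simp only [Real.sqrt_sq (norm_nonneg _)] at h
      have e1 : (1 / (2 * ‖z‖)) • (2 : ℕ) • innerSL ℝ z = ‖z‖⁻¹ • innerSL ℝ z := by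
        ext v
        have : ‖z‖ ≠ 0 := norm_ne_zero_iff.2 hz0
        simp; field_simp
      rw [← e1]; exact h
    have hd2 : HasFDerivAt (fun y : E3 => (σ - ‖y‖) / ε) (ε⁻¹ • (-((‖z‖⁻¹) • innerSL ℝ z))) z := by
      simpa only [div_eq_inv_mul] using (hd.const_sub σ).const_mul ε⁻¹
    rw [this.lineDeriv_eq, indicator_of_mem (show ‖z‖ ∈ Ioo (σ - ε) σ from ⟨hgt, hlt'⟩), hd2.differentiableAt.lineDeriv_eq_fderiv,
      hd2.fderiv]
    simp
    left; ring
  · have : cutoff σ ε =ᶠ[𝓝 z] fun _ => 0 := by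
      filter_upwards [(continuous_norm.continuousAt (x := z)).eventually (lt_mem_nhds hgt')]
        with y hy
      have : (σ - ‖y‖) / ε ≤ 0 := div_nonpos_of_nonpos_of_nonneg (by linarith) hε.le
      simp [cutoff, this]
    rw [this.lineDeriv_eq, indicator_of_notMem (by simp; intro h; linarith)]
    simp [lineDeriv]

/-- Continuity in the radius is what lets averages over thin shells converge to the sphere integral
at `r = σ`. -/
lemma continuous_sphere_integral {ψ : E3 → ℝ} (hψ : Continuous ψ) (e : E3) :
    Continuous fun r : ℝ => r ^ 2 * ∫ α : S2, ψ (r • (α : E3)) * inner ℝ (α : E3) e ∂solidAngle := by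
  refine (continuous_pow 2).mul ?_
  refine continuous_parametric_integral_of_continuous (μ := solidAngle)
    (f := fun (r : ℝ) (α : S2) => ψ (r • (α : E3)) * inner ℝ (α : E3) e) ?_ isCompact_univ |>.congr ?_
  · simp only [Function.uncurry_def]; fun_prop
  · intro r; simp

/-- The divergence theorem on a ball centred at the origin. -/
lemma integral_ball_fderiv {σ : ℝ} (hσ : 0 < σ) {ψ : E3 → ℝ} (hψ : ContDiff ℝ 1 ψ)
    (hc : HasCompactSupport ψ) (e : E3) :
    ∫ z in closedBall (0 : E3) σ, fderiv ℝ ψ z e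
      = σ ^ 2 * ∫ α : S2, ψ (σ • (α : E3)) * inner ℝ (α : E3) e ∂solidAngle := by
  set G : ℝ → ℝ := fun r =>
    r ^ 2 * ∫ α : S2, ψ (r • (α : E3)) * inner ℝ (α : E3) e ∂solidAngle with hG
  have hGc : Continuous G := continuous_sphere_integral hψ.continuous e
  have hψi : Integrable ψ := hψ.continuous.integrable_of_hasCompactSupport hc
  have hfi : Integrable fun z => fderiv ℝ ψ z e :=
    ((hψ.continuous_fderiv one_ne_zero).clm_apply continuous_const).integrable_of_hasCompactSupport
      (hc.fderiv_apply (𝕜 := ℝ) _)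
  obtain ⟨C, hC⟩ := hψ.lipschitzWith_of_hasCompactSupport hc one_ne_zero
  -- Integrating by parts against the cutoff puts the derivative on the shell of width `ε`, and
  -- polar coordinates turn the shell integral into the mean of `G` over the radii between `σ - ε`
  -- and `σ`.
  have key : ∀ ε, 0 < ε → ε < σ →
      ∫ z, cutoff σ ε z * fderiv ℝ ψ z e = ε⁻¹ * ∫ r in (σ - ε)..σ, G r := by
    intro ε hε hεσ
    have h := LipschitzWith.integral_lineDeriv_mul_eq (μ := (volume : Measure E3))
      (lipschitzWith_cutoff σ hε) hC hc e
    have hL : ∀ x, lineDeriv ℝ ψ x (-e) = - fderiv ℝ ψ x e := fun x => by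
      rw [((hψ.differentiable one_ne_zero) x).lineDeriv_eq_fderiv]; simp
    set g : E3 → ℝ := fun z => (Ioo (σ - ε) σ).indicator (fun _ => (1 : ℝ)) ‖z‖ *
      (ψ z * (inner ℝ z e / ‖z‖)) with hg
    have h1 : ∫ x, lineDeriv ℝ (cutoff σ ε) x e * ψ x = -ε⁻¹ * ∫ z, g z := by
      rw [← integral_const_mul]
      refine integral_congr_ae ?_
      filter_upwards [lineDeriv_cutoff hε hεσ e] with z hz
      rw [hz, hg]; ring
    have hgi : Integrable g := by
      refine (hψi.norm.mul_const ‖e‖).mono' ?_ (ae_of_all _ fun z => ?_)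
      · refine (Measurable.mul ?_ (Measurable.mul hψ.continuous.measurable ?_)).aestronglyMeasurable
        · exact (measurable_const.indicator measurableSet_Ioo).comp measurable_norm
        · exact Measurable.div (by fun_prop) measurable_norm
      · rw [hg]
        simp only [norm_mul, norm_div, norm_norm]
        have h2 : ‖(Ioo (σ - ε) σ).indicator (fun _ => (1 : ℝ)) ‖z‖‖ ≤ 1 := by
          by_cases hz : ‖z‖ ∈ Ioo (σ - ε) σ
          · rw [indicator_of_mem hz]; simp
          · rw [indicator_of_notMem hz]; simp
        have h3 : ‖inner ℝ z e‖ / ‖z‖ ≤ ‖e‖ := by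
          refine div_le_of_le_mul₀ (norm_nonneg _) (norm_nonneg _) ?_
          rw [mul_comm]; exact norm_inner_le_norm z e
        calc _ ≤ 1 * (‖ψ z‖ * ‖e‖) := by gcongr
          _ = _ := one_mul _
    have h2 : ∫ z, g z = ∫ r in (σ - ε)..σ, G r := by
      rw [integral_polar hgi, intervalIntegral.integral_of_le (by linarith), integral_Ioc_eq_integral_Ioo]
      have : ∀ r ∈ Ioi (0 : ℝ), r ^ 2 * ∫ α : S2, g (r • (α : E3)) ∂solidAngle
          = (Ioo (σ - ε) σ).indicator G r := by
        intro r hr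
        have hr' : (0 : ℝ) < r := hr
        have hn : ∀ α : S2, ‖r • (α : E3)‖ = r := fun α => by
          rw [norm_smul, norm_dir, mul_one, Real.norm_of_nonneg hr'.le]
        by_cases hrm : r ∈ Ioo (σ - ε) σ
        · rw [indicator_of_mem hrm, hG]
          simp only
          congr 1
          refine integral_congr_ae (ae_of_all _ fun α => ?_)
          simp only [hg, hn, indicator_of_mem hrm, inner_smul_left]
          rw [conj_trivial, mul_div_cancel_left₀ _ hr'.ne', one_mul]
        · rw [indicator_of_notMem hrm]
          simp [hg, hn, indicator_of_notMem hrm]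
      rw [setIntegral_congr_fun measurableSet_Ioi this, setIntegral_indicator measurableSet_Ioo]
      congr 2
      ext r
      simp only [mem_inter_iff, mem_Ioi, mem_Ioo]
      constructor
      · exact fun h => h.2
      · exact fun h => ⟨by linarith [h.1], h⟩
    rw [h1, h2] at h
    simp_rw [hL] at h
    have h4 : ∫ z, cutoff σ ε z * fderiv ℝ ψ z e = - ∫ x, -fderiv ℝ ψ x e * cutoff σ ε x := by
      rw [← integral_neg]; congr 1; ext x; ring
    rw [h4, ← h]; ring
  have hlim1 : Tendsto (fun ε : ℝ => ∫ z, cutoff σ ε z * fderiv ℝ ψ z e) (𝓝[>] 0)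
      (𝓝 (∫ z in closedBall (0 : E3) σ, fderiv ℝ ψ z e)) := by
    rw [← integral_indicator isClosed_closedBall.measurableSet]
    refine tendsto_integral_filter_of_dominated_convergence (fun z => ‖fderiv ℝ ψ z e‖) ?_ ?_
      hfi.norm ?_
    · filter_upwards [self_mem_nhdsWithin] with ε hε
      exact (lipschitzWith_cutoff σ hε).continuous.aestronglyMeasurable.mul hfi.1
    · filter_upwards with ε
      refine ae_of_all _ fun z => ?_
      rw [norm_mul, Real.norm_of_nonneg (cutoff_nonneg _ _ _)]
      exact mul_le_of_le_one_left (norm_nonneg _) (cutoff_le_one _ _ _)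
    · have h1 : ∀ᵐ z : E3, z ∉ sphere (0 : E3) σ :=
        measure_eq_zero_iff_ae_notMem.1 (Measure.addHaar_sphere volume 0 σ)
      filter_upwards [h1] with z hz
      simp only [mem_sphere_iff_norm, sub_zero] at hz
      refine tendsto_const_nhds.congr' ?_
      rcases lt_or_gt_of_ne hz with hlt | hgt
      · filter_upwards [Ioo_mem_nhdsGT (sub_pos.2 hlt)] with ε hε
        have : 1 ≤ (σ - ‖z‖) / ε := by rw [le_div_iff₀ hε.1]; linarith [hε.2]
        rw [indicator_of_mem (by simpa using hlt.le)]
        simp [cutoff, this]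
      · filter_upwards [self_mem_nhdsWithin] with ε hε
        have : (σ - ‖z‖) / ε ≤ 0 :=
          div_nonpos_of_nonpos_of_nonneg (by linarith) (le_of_lt hε)
        rw [indicator_of_notMem (by simpa using hgt)]
        simp [cutoff, this]
  -- The shell mean is the left difference quotient at `σ` of the primitive of `G`.
  have hlim2 : Tendsto (fun ε : ℝ => ε⁻¹ * ∫ r in (σ - ε)..σ, G r) (𝓝[>] 0) (𝓝 (G σ)) := by
    have hd : HasDerivAt (fun x => ∫ r in (0 : ℝ)..x, G r) (G σ) σ := hGc.integral_hasStrictDerivAt 0 σ |>.hasDerivAt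
    have h1 := hd.tendsto_slope_zero_left
    have h2 : Tendsto (fun ε : ℝ => -ε) (𝓝[>] 0) (𝓝[<] 0) := by
      simpa using tendsto_neg_nhdsGT (a := (0 : ℝ))
    refine (h1.comp h2).congr fun ε => ?_
    simp only [Function.comp, smul_eq_mul]
    rw [← sub_eq_add_neg, inv_neg, intervalIntegral.integral_interval_sub_left
      (hGc.intervalIntegrable _ _) (hGc.intervalIntegrable _ _),
      intervalIntegral.integral_symm (σ - ε) σ]
    ring
  refine tendsto_nhds_unique hlim1 (hlim2.congr' ?_)
  filter_upwards [Ioo_mem_nhdsGT hσ] with ε hε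
  exact (key ε hε.1 hε.2).symm

/-- The divergence theorem on a ball. -/
lemma integral_translate_ball_fderiv {σ : ℝ} (hσ : 0 < σ) {ψ : E3 → ℝ} (hψ : ContDiff ℝ 1 ψ)
    (hc : HasCompactSupport ψ) (Y e : E3) :
    ∫ z in closedBall (0 : E3) σ, fderiv ℝ ψ (Y + z) e
      = σ ^ 2 * ∫ α : S2, ψ (Y + σ • (α : E3)) * inner ℝ (α : E3) e ∂solidAngle := by
  have h := integral_ball_fderiv hσ (ψ := fun z => ψ (Y + z)) (hψ.comp (contDiff_const.add contDiff_id))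
    (hc.comp_homeomorph (Homeomorph.addLeft Y)) e
  simpa [fderiv_comp_add_left] using h

end Ball

/-! ### Fluxes of two-point quantities and their weak divergence -/

section Flux

lemma continuous_dir : Continuous fun α : S2 => (α : E3) := continuous_subtype_val

/-- The flux `∫ α ∫₀¹ W(α, X + τσα, X + (τ-1)σα) dτ dΩ` transporting a two-point quantity. -/
def fluxOf (σ : ℝ) (W : S2 → E3 → E3 → ℝ) (X : E3) : E3 :=
  ∫ α : S2, (∫ τ in (0 : ℝ)..1, W α (X + (τ * σ) • (α : E3)) (X + ((τ - 1) * σ) • (α : E3)))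
    • (α : E3) ∂solidAngle

/-- The density of minus the divergence of the flux `σ • fluxOf σ W`. -/
def sourceOf (σ : ℝ) (W : S2 → E3 → E3 → ℝ) (X : E3) : ℝ :=
  ∫ α : S2, (W α X (X - σ • (α : E3)) - W α (X + σ • (α : E3)) X) ∂solidAngle

/-- Measurability and local boundedness of a two-point quantity. -/
structure TwoPoint (W : S2 → E3 → E3 → ℝ) : Prop where
  meas : Measurable fun q : S2 × E3 × E3 => W q.1 q.2.1 q.2.2
  bdd : ∀ r : ℝ, ∃ C : ℝ, ∀ α Y Z, ‖Y‖ ≤ r → ‖Z‖ ≤ r → |W α Y Z| ≤ C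

lemma norm_add_smul_dir_le (X : E3) (c : ℝ) (α : S2) : ‖X + c • (α : E3)‖ ≤ ‖X‖ + |c| := by
  refine (norm_add_le _ _).trans ?_
  rw [norm_smul, norm_dir, mul_one, Real.norm_eq_abs]

lemma norm_sub_smul_dir_le (X : E3) (c : ℝ) (α : S2) : ‖X - c • (α : E3)‖ ≤ ‖X‖ + |c| := by
  refine (norm_sub_le _ _).trans ?_
  rw [norm_smul, norm_dir, mul_one, Real.norm_eq_abs]

/-- The interval average inside the flux. -/
lemma TwoPoint.inner_bdd {W : S2 → E3 → E3 → ℝ} (hW : TwoPoint W) (σ r : ℝ) :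
    ∃ C : ℝ, ∀ α X, ∀ τ ∈ Icc (0 : ℝ) 1, ‖X‖ ≤ r →
      |W α (X + (τ * σ) • (α : E3)) (X + ((τ - 1) * σ) • (α : E3))| ≤ C := by
  obtain ⟨C, hC⟩ := hW.bdd (r + |σ|)
  refine ⟨C, fun α X τ hτ hX => hC _ _ _ ?_ ?_⟩
  · refine (norm_add_smul_dir_le _ _ _).trans (add_le_add hX ?_)
    rw [abs_mul, abs_of_nonneg hτ.1]
    exact mul_le_of_le_one_left (abs_nonneg _) hτ.2
  · refine (norm_add_smul_dir_le _ _ _).trans (add_le_add hX ?_)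
    rw [abs_mul, abs_sub_comm, abs_of_nonneg (sub_nonneg.2 hτ.2)]
    exact mul_le_of_le_one_left (abs_nonneg _) (by linarith [hτ.1])

lemma TwoPoint.meas_inner {W : S2 → E3 → E3 → ℝ} (hW : TwoPoint W) (σ : ℝ) :
    Measurable fun q : E3 × S2 × ℝ =>
      W q.2.1 (q.1 + (q.2.2 * σ) • (q.2.1 : E3)) (q.1 + ((q.2.2 - 1) * σ) • (q.2.1 : E3)) := by
  have hf : Measurable fun q : E3 × S2 × ℝ => (q.2.1, q.1 + (q.2.2 * σ) • (q.2.1 : E3),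
      q.1 + ((q.2.2 - 1) * σ) • (q.2.1 : E3)) := by
    apply Continuous.measurable
    have := continuous_dir
    fun_prop
  exact hW.meas.comp hf

/-- The inner average of the flux as a measurable function. -/
lemma TwoPoint.stronglyMeasurable_avg {W : S2 → E3 → E3 → ℝ} (hW : TwoPoint W) (σ : ℝ) :
    StronglyMeasurable fun q : E3 × S2 =>
      ∫ τ in (0 : ℝ)..1, W q.2 (q.1 + (τ * σ) • (q.2 : E3)) (q.1 + ((τ - 1) * σ) • (q.2 : E3)) := by
  simp_rw [intervalIntegral.integral_of_le zero_le_one]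
  have h := (hW.meas_inner σ).stronglyMeasurable
  have h2 : StronglyMeasurable (Function.uncurry fun (q : E3 × S2) (τ : ℝ) =>
      W q.2 (q.1 + (τ * σ) • (q.2 : E3)) (q.1 + ((τ - 1) * σ) • (q.2 : E3))) :=
    h.comp_measurable (g := fun p : (E3 × S2) × ℝ => (p.1.1, p.1.2, p.2)) (by fun_prop)
  exact h2.integral_prod_right

lemma TwoPoint.avg_bdd {W : S2 → E3 → E3 → ℝ} (hW : TwoPoint W) (σ r : ℝ) :
    ∃ C : ℝ, ∀ α X, ‖X‖ ≤ r →
      |∫ τ in (0 : ℝ)..1, W α (X + (τ * σ) • (α : E3)) (X + ((τ - 1) * σ) • (α : E3))| ≤ C := by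
  obtain ⟨C, hC⟩ := hW.inner_bdd σ r
  refine ⟨C, fun α X hX => ?_⟩
  have := intervalIntegral.norm_integral_le_of_norm_le_const (a := (0 : ℝ)) (b := 1) (C := C)
    (f := fun τ => W α (X + (τ * σ) • (α : E3)) (X + ((τ - 1) * σ) • (α : E3))) (fun τ hτ => by
      rw [uIoc_of_le zero_le_one] at hτ
      exact hC α X τ ⟨hτ.1.le, hτ.2⟩ hX)
  simpa using this

lemma TwoPoint.stronglyMeasurable_fluxOf {W : S2 → E3 → E3 → ℝ} (hW : TwoPoint W) (σ : ℝ) :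
    StronglyMeasurable (fluxOf σ W) := by
  have h : StronglyMeasurable (Function.uncurry fun (X : E3) (α : S2) => (∫ τ in (0 : ℝ)..1,
      W α (X + (τ * σ) • (α : E3)) (X + ((τ - 1) * σ) • (α : E3))) • (α : E3)) :=
    (hW.stronglyMeasurable_avg σ).smul
      (continuous_dir.comp continuous_snd).stronglyMeasurable
  exact h.integral_prod_right

lemma TwoPoint.integrable_flux {W : S2 → E3 → E3 → ℝ} (hW : TwoPoint W) (σ : ℝ) (X : E3) :
    Integrable (fun α : S2 => (∫ τ in (0 : ℝ)..1,
      W α (X + (τ * σ) • (α : E3)) (X + ((τ - 1) * σ) • (α : E3))) • (α : E3)) solidAngle := by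
  obtain ⟨C, hC⟩ := hW.avg_bdd σ ‖X‖
  refine Integrable.of_bound (C := C) ?_ (ae_of_all _ fun α => ?_)
  · exact (((hW.stronglyMeasurable_avg σ).comp_measurable (measurable_prodMk_left (x := X))).smul
      continuous_dir.stronglyMeasurable).aestronglyMeasurable
  · rw [norm_smul, norm_dir, mul_one]
    exact hC α X le_rfl

lemma TwoPoint.fluxOf_bdd {W : S2 → E3 → E3 → ℝ} (hW : TwoPoint W) (σ r : ℝ) :
    ∃ C : ℝ, ∀ X, ‖X‖ ≤ r → ‖fluxOf σ W X‖ ≤ C := by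
  obtain ⟨C, hC⟩ := hW.avg_bdd σ r
  refine ⟨C * solidAngle.real univ, fun X hX => ?_⟩
  refine norm_integral_le_of_norm_le_const (ae_of_all _ fun α => ?_)
  rw [norm_smul, norm_dir, mul_one]
  exact hC α X hX

/-- Integrability of bounded functions with compact support in space. -/
lemma integrable_of_bdd_support {A : Type*} [MeasurableSpace A] {ν : Measure A} [IsFiniteMeasure ν]
    {k : A × E3 → ℝ} (hk : AEStronglyMeasurable k (ν.prod volume)) {C r : ℝ}
    (hb : ∀ᵐ q ∂(ν.prod (volume : Measure E3)), |k q| ≤ C)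
    (hs : ∀ᵐ q ∂(ν.prod (volume : Measure E3)), r < ‖q.2‖ → k q = 0) :
    Integrable k (ν.prod volume) := by
  have h1 : Integrable (fun q : A × E3 => (1 : ℝ) * (closedBall (0 : E3) r).indicator
      (fun _ => |C|) q.2) (ν.prod volume) :=
    (integrable_const (1 : ℝ)).mul_prod ((integrable_indicator_iff
      isClosed_closedBall.measurableSet).2 (integrableOn_const measure_closedBall_lt_top.ne))
  refine h1.mono' hk ?_
  filter_upwards [hb, hs] with q hq hs
  by_cases h : ‖q.2‖ ≤ r
  · rw [indicator_of_mem (by simpa using h), one_mul]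
    exact hq.trans (le_abs_self C)
  · rw [hs (not_le.1 h)]
    simp [indicator_nonneg]

lemma exists_norm_bound_of_hasCompactSupport {φ : E3 → ℝ} (hc : HasCompactSupport φ) :
    ∃ r : ℝ, ∀ X, r < ‖X‖ → φ X = 0 ∧ fderiv ℝ φ X = 0 := by
  obtain ⟨r, hr⟩ := hc.isCompact.isBounded.subset_closedBall 0
  refine ⟨r, fun X hX => ?_⟩
  have hn : X ∉ tsupport φ := fun h => by
    have := hr h; simp at this; linarith
  exact ⟨image_eq_zero_of_notMem_tsupport hn,
    image_eq_zero_of_notMem_tsupport fun h => hn (tsupport_fderiv_subset ℝ h)⟩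

/-- Weak form of the divergence of a two-point flux. -/
lemma TwoPoint.integral_fderiv_fluxOf {W : S2 → E3 → E3 → ℝ} (hW : TwoPoint W) {σ : ℝ}
    {φ : E3 → ℝ} (hφ : ContDiff ℝ 1 φ) (hc : HasCompactSupport φ) :
    σ * ∫ X, fderiv ℝ φ X (fluxOf σ W X) = ∫ X, φ X * sourceOf σ W X := by
  obtain ⟨r, hr⟩ := exists_norm_bound_of_hasCompactSupport hc
  have hφ' := hφ.continuous_fderiv one_ne_zero
  obtain ⟨B, hB⟩ := hφ'.bounded_above_of_compact_support (hc.fderiv (𝕜 := ℝ))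
  obtain ⟨B0, hB0⟩ := hφ.continuous.bounded_above_of_compact_support hc
  set ν : Measure ℝ := volume.restrict (Ioc 0 1) with hν
  obtain ⟨C, hC⟩ := hW.inner_bdd σ r
  obtain ⟨C', hC'⟩ := hW.bdd (r + |σ|)
  obtain ⟨C2, hC2⟩ := hW.bdd (r + |σ| + |σ|)
  have hφ0 : ∀ (X : E3) (α : S2), |fderiv ℝ φ X α| ≤ |B| := fun X α => by
    refine ((fderiv ℝ φ X).le_opNorm _).trans ?_
    rw [norm_dir, mul_one]
    exact (hB _).trans (le_abs_self _)
  have hmul : ∀ {a b c d : ℝ}, |a| ≤ c → |b| ≤ |d| → |a * b| ≤ |c| * |d| := by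
    intro a b c d h1 h2
    rw [abs_mul]
    exact mul_le_mul (h1.trans (le_abs_self _)) h2 (abs_nonneg _) (abs_nonneg _)
  have hintM : Measurable fun q : (S2 × ℝ) × E3 =>
      W q.1.1 (q.2 + (q.1.2 * σ) • (q.1.1 : E3)) (q.2 + ((q.1.2 - 1) * σ) • (q.1.1 : E3))
        * fderiv ℝ φ q.2 q.1.1 := by
    refine ((hW.meas_inner σ).comp (g := fun q : E3 × S2 × ℝ => _)
      (f := fun q : (S2 × ℝ) × E3 => (q.2, q.1.1, q.1.2)) (by fun_prop)).mul ?_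
    exact ((hφ'.comp continuous_snd).clm_apply
      (continuous_dir.comp (continuous_fst.comp continuous_fst))).measurable
  have haeτ : ∀ᵐ q : (S2 × ℝ) × E3 ∂((solidAngle.prod ν).prod volume), q.1.2 ∈ Ioc (0 : ℝ) 1 := by
    have h1 : ∀ᵐ τ ∂ν, τ ∈ Ioc (0 : ℝ) 1 := ae_restrict_mem measurableSet_Ioc
    have h2 := (Measure.quasiMeasurePreserving_snd (μ := solidAngle) (ν := ν)).ae h1
    exact (Measure.quasiMeasurePreserving_fst (μ := solidAngle.prod ν)
      (ν := (volume : Measure E3))).ae h2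
  have hint1 : Integrable (Function.uncurry fun (p : S2 × ℝ) (X : E3) =>
      W p.1 (X + (p.2 * σ) • (p.1 : E3)) (X + ((p.2 - 1) * σ) • (p.1 : E3))
        * fderiv ℝ φ X p.1) ((solidAngle.prod ν).prod volume) := by
    refine integrable_of_bdd_support hintM.aestronglyMeasurable (C := |C| * |B|) (r := r) ?_ ?_
    · filter_upwards [haeτ] with q hq
      by_cases hX : ‖q.2‖ ≤ r
      · exact hmul (hC _ _ _ ⟨hq.1.le, hq.2⟩ hX) (hφ0 _ _)
      · simp only [Function.uncurry]
        rw [(hr _ (not_le.1 hX)).2]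
        simp; positivity
    · refine ae_of_all _ fun q hq => ?_
      simp only [Function.uncurry]
      rw [(hr _ hq).2]; simp
  -- No regularity of `W` is available, so every derivative stays on `φ`. Fubini brings the integral
  -- over space to the inside.
  have e2 : ∫ X, fderiv ℝ φ X (fluxOf σ W X) = ∫ p : S2 × ℝ, (∫ X : E3,
      W p.1 (X + (p.2 * σ) • (p.1 : E3)) (X + ((p.2 - 1) * σ) • (p.1 : E3))
        * fderiv ℝ φ X p.1) ∂(solidAngle.prod ν) := by
    rw [integral_integral_swap hint1]
    refine integral_congr_ae ?_
    filter_upwards [hint1.prod_left_ae] with X hX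
    rw [fluxOf, ← ContinuousLinearMap.integral_comp_comm _ (hW.integrable_flux σ X)]
    refine Eq.trans ?_ (integral_prod _ hX).symm
    refine integral_congr_ae (ae_of_all _ fun α => ?_)
    simp only [map_smul, smul_eq_mul]
    rw [intervalIntegral.integral_of_le zero_le_one, ← integral_mul_const]
    rfl
  -- The substitution Y = X + τσα frees `W` of `τ`: its second point becomes `Y - σα`, and only the
  -- test function still depends on `τ`.
  have e3 : ∀ p : S2 × ℝ, ∫ X : E3, W p.1 (X + (p.2 * σ) • (p.1 : E3))
      (X + ((p.2 - 1) * σ) • (p.1 : E3)) * fderiv ℝ φ X p.1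
      = ∫ Y : E3, W p.1 Y (Y - σ • (p.1 : E3)) * fderiv ℝ φ (Y - (p.2 * σ) • (p.1 : E3)) p.1 := by
    intro p
    rw [← integral_add_right_eq_self (fun Y : E3 => W p.1 Y (Y - σ • (p.1 : E3)) *
      fderiv ℝ φ (Y - (p.2 * σ) • (p.1 : E3)) p.1) ((p.2 * σ) • (p.1 : E3))]
    congr 1; ext X
    rw [add_sub_cancel_right]
    congr 2
    rw [sub_mul, one_mul, sub_smul]; abel
  have hfar : ∀ (α : S2) (c : ℝ) (Y : E3), |c| ≤ |σ| → r + |σ| < ‖Y‖ →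
      r < ‖Y - c • (α : E3)‖ := by
    intro α c Y hcσ hY
    have := norm_add_smul_dir_le (Y - c • (α : E3)) c α
    rw [sub_add_cancel] at this
    linarith
  have hint2 : Integrable (fun q : S2 × (ℝ × E3) => W q.1 q.2.2 (q.2.2 - σ • (q.1 : E3)) *
      fderiv ℝ φ (q.2.2 - (q.2.1 * σ) • (q.1 : E3)) q.1) (solidAngle.prod (ν.prod volume)) := by
    have hm : Measurable fun q : (S2 × ℝ) × E3 => W q.1.1 q.2 (q.2 - σ • (q.1.1 : E3)) *
        fderiv ℝ φ (q.2 - (q.1.2 * σ) • (q.1.1 : E3)) q.1.1 := by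
      have hcd := continuous_dir
      refine (hW.meas.comp (g := fun q : S2 × E3 × E3 => _)
        (f := fun q : (S2 × ℝ) × E3 => (q.1.1, q.2, q.2 - σ • (q.1.1 : E3)))
        (Continuous.measurable (by fun_prop))).mul ?_
      exact ((hφ'.comp (by fun_prop)).clm_apply
        (continuous_dir.comp (continuous_fst.comp continuous_fst))).measurable
    have h : Integrable (fun q : (S2 × ℝ) × E3 => W q.1.1 q.2 (q.2 - σ • (q.1.1 : E3)) *
        fderiv ℝ φ (q.2 - (q.1.2 * σ) • (q.1.1 : E3)) q.1.1)
        ((solidAngle.prod ν).prod volume) := by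
      have hz : ∀ᵐ q : (S2 × ℝ) × E3 ∂((solidAngle.prod ν).prod volume), r + |σ| < ‖q.2‖ →
          fderiv ℝ φ (q.2 - (q.1.2 * σ) • (q.1.1 : E3)) = 0 := by
        filter_upwards [haeτ] with q hq hX
        refine (hr _ (hfar q.1.1 (q.1.2 * σ) q.2 ?_ hX)).2
        rw [abs_mul, abs_of_pos hq.1]
        exact mul_le_of_le_one_left (abs_nonneg _) hq.2
      refine integrable_of_bdd_support hm.aestronglyMeasurable (C := |C2| * |B|)
        (r := r + |σ|) ?_ ?_
      · filter_upwards [hz] with q hq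
        by_cases hX : ‖q.2‖ ≤ r + |σ|
        · refine hmul (hC2 _ _ _ (by linarith [abs_nonneg σ])
            ((norm_sub_smul_dir_le _ _ _).trans (by linarith))) (hφ0 _ _)
        · rw [hq (not_le.1 hX)]; simp; positivity
      · filter_upwards [hz] with q hq hX
        rw [hq hX]; simp
    have h5 := (measurePreserving_prodAssoc solidAngle ν (volume : Measure E3)).integrable_comp_emb
      MeasurableEquiv.prodAssoc.measurableEmbedding (g := fun q : S2 × (ℝ × E3) =>
        W q.1 q.2.2 (q.2.2 - σ • (q.1 : E3)) *
        fderiv ℝ φ (q.2.2 - (q.2.1 * σ) • (q.1 : E3)) q.1)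
    exact h5.1 h
  -- The integrand is minus the `τ`-derivative of `φ (Y - τσα)`, up to the factor `σ`.
  have hft : ∀ (α : S2) (Y : E3), σ * ∫ τ, fderiv ℝ φ (Y - (τ * σ) • (α : E3)) α ∂ν
      = φ Y - φ (Y - σ • (α : E3)) := by
    intro α Y
    have hd : ∀ τ : ℝ, HasDerivAt (fun τ => φ (Y - (τ * σ) • (α : E3)))
        (-(σ * fderiv ℝ φ (Y - (τ * σ) • (α : E3)) α)) τ := by
      intro τ
      have h1 : HasDerivAt (fun τ : ℝ => Y - (τ * σ) • (α : E3)) (-(σ • (α : E3))) τ := by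
        have := (((hasDerivAt_id τ).mul_const σ).smul_const (α : E3)).const_sub Y
        simpa using this
      have := ((hφ.differentiable one_ne_zero) (Y - (τ * σ) • (α : E3))).hasFDerivAt.comp_hasDerivAt
        τ h1
      simpa [Function.comp_def] using this
    have hcont : Continuous fun τ : ℝ => -(σ * fderiv ℝ φ (Y - (τ * σ) • (α : E3)) α) := by
      have : Continuous fun τ : ℝ => fderiv ℝ φ (Y - (τ * σ) • (α : E3)) α :=
        (hφ'.comp (by fun_prop)).clm_apply continuous_const
      fun_prop
    have h := intervalIntegral.integral_eq_sub_of_hasDerivAt (a := 0) (b := 1)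
      (fun τ _ => hd τ) (hcont.intervalIntegrable _ _)
    rw [intervalIntegral.integral_neg, intervalIntegral.integral_const_mul,
      intervalIntegral.integral_of_le zero_le_one] at h
    simp only [one_mul, zero_mul, zero_smul, sub_zero] at h
    linarith
  have hint3 : Integrable (Function.uncurry fun (α : S2) (Y : E3) =>
      φ Y * W α Y (Y - σ • (α : E3))) (solidAngle.prod volume) := by
    refine integrable_of_bdd_support (C := |C'| * |B0|) (r := r) ?_ (ae_of_all _ fun q => ?_)
      (ae_of_all _ fun q hq => by simp [Function.uncurry, (hr _ hq).1])
    · have hcd := continuous_dir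
      refine Measurable.aestronglyMeasurable (Measurable.mul (hφ.continuous.measurable.comp measurable_snd) ?_)
      exact hW.meas.comp (g := fun q : S2 × E3 × E3 => _)
        (f := fun q : S2 × E3 => (q.1, q.2, q.2 - σ • (q.1 : E3)))
        (Continuous.measurable (by fun_prop))
    · by_cases hX : ‖q.2‖ ≤ r
      · rw [Function.uncurry, mul_comm]
        exact hmul (hC' _ _ _ (by linarith [abs_nonneg σ])
          ((norm_sub_smul_dir_le _ _ _).trans (by linarith))) ((hB0 _).trans (le_abs_self _))
      · rw [Function.uncurry, (hr _ (not_le.1 hX)).1]; simp; positivity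
  have hint4 : Integrable (Function.uncurry fun (α : S2) (Y : E3) =>
      φ Y * W α (Y + σ • (α : E3)) Y) (solidAngle.prod volume) := by
    refine integrable_of_bdd_support (C := |C'| * |B0|) (r := r) ?_ (ae_of_all _ fun q => ?_)
      (ae_of_all _ fun q hq => by simp [Function.uncurry, (hr _ hq).1])
    · have hcd := continuous_dir
      refine Measurable.aestronglyMeasurable (Measurable.mul (hφ.continuous.measurable.comp measurable_snd) ?_)
      exact hW.meas.comp (g := fun q : S2 × E3 × E3 => _)
        (f := fun q : S2 × E3 => (q.1, q.2 + σ • (q.1 : E3), q.2))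
        (Continuous.measurable (by fun_prop))
    · by_cases hX : ‖q.2‖ ≤ r
      · rw [Function.uncurry, mul_comm]
        exact hmul (hC' _ _ _ ((norm_add_smul_dir_le _ _ _).trans (by linarith))
          (by linarith [abs_nonneg σ])) ((hB0 _).trans (le_abs_self _))
      · rw [Function.uncurry, (hr _ (not_le.1 hX)).1]; simp; positivity
  have hint5 : Integrable (Function.uncurry fun (α : S2) (Y : E3) =>
      φ Y * (W α Y (Y - σ • (α : E3)) - W α (Y + σ • (α : E3)) Y)) (solidAngle.prod volume) := by
    refine (hint3.sub hint4).congr (ae_of_all _ fun q => ?_)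
    simp only [Pi.sub_apply, Function.uncurry, mul_sub]
  -- Of the two boundary terms in `τ`, the one with `φ (Y - σα)` is translated back by `σα`, which
  -- produces `W α (Y + σα) Y`.
  have e4 : ∀ᵐ α : S2 ∂solidAngle, σ * ∫ τ, (∫ Y : E3, W α Y (Y - σ • (α : E3)) *
      fderiv ℝ φ (Y - (τ * σ) • (α : E3)) α) ∂ν
      = ∫ Y, φ Y * (W α Y (Y - σ • (α : E3)) - W α (Y + σ • (α : E3)) Y) := by
    filter_upwards [hint2.prod_right_ae, hint3.prod_right_ae, hint4.prod_right_ae]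
      with α hα h3 h4
    simp only [Function.uncurry] at h3 h4
    rw [integral_integral_swap (f := fun τ Y => W α Y (Y - σ • (α : E3)) *
      fderiv ℝ φ (Y - (τ * σ) • (α : E3)) α) hα, ← integral_const_mul]
    have e5 : ∀ Y : E3, σ * ∫ τ, W α Y (Y - σ • (α : E3)) *
        fderiv ℝ φ (Y - (τ * σ) • (α : E3)) α ∂ν
        = φ Y * W α Y (Y - σ • (α : E3))
          - φ (Y - σ • (α : E3)) * W α Y (Y - σ • (α : E3)) := by
      intro Y
      rw [integral_const_mul, mul_left_comm, hft]; ring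
    have hs : Integrable fun Y : E3 => φ (Y - σ • (α : E3)) * W α Y (Y - σ • (α : E3)) := by
      have := Integrable.comp_sub_right h4 (σ • (α : E3))
      simpa using this
    have e6 : ∫ Y : E3, φ (Y - σ • (α : E3)) * W α Y (Y - σ • (α : E3))
        = ∫ Y, φ Y * W α (Y + σ • (α : E3)) Y := by
      rw [← integral_add_right_eq_self (fun Y : E3 => φ (Y - σ • (α : E3)) *
        W α Y (Y - σ • (α : E3))) (σ • (α : E3))]
      simp
    simp_rw [e5, mul_sub]
    rw [integral_sub h3 hs, integral_sub h3 h4, e6]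
  have hint2' := (measurePreserving_prodAssoc solidAngle ν
    (volume : Measure E3)).integrable_comp_of_integrable hint2
  have e7 : ∫ p : S2 × ℝ, (∫ Y : E3, W p.1 Y (Y - σ • (p.1 : E3)) *
      fderiv ℝ φ (Y - (p.2 * σ) • (p.1 : E3)) p.1) ∂(solidAngle.prod ν)
      = ∫ α : S2, (∫ τ, (∫ Y : E3, W α Y (Y - σ • (α : E3)) *
      fderiv ℝ φ (Y - (τ * σ) • (α : E3)) α) ∂ν) ∂solidAngle :=
    integral_prod _ hint2'.integral_prod_left
  simp_rw [e2, e3]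
  rw [e7, ← integral_const_mul, integral_congr_ae e4, integral_integral_swap hint5]
  simp_rw [integral_const_mul]
  rfl

end Flux

/-! ### Integrals over balls of fixed radius -/

section BallAverage

/-- Measurable, locally bounded functions. -/
structure LocBdd {V : Type*} [NormedAddCommGroup V] [MeasurableSpace V] (u : E3 → V) : Prop where
  meas : Measurable u
  bdd : ∀ r : ℝ, ∃ C : ℝ, ∀ Y, ‖Y‖ ≤ r → ‖u Y‖ ≤ C

/-- The integral of `u` over the ball of radius `σ` about `X`. -/
def ballInt (σ : ℝ) (u : E3 → ℝ) (X : E3) : ℝ := ∫ Y, u Y * heaviside (σ - ‖Y - X‖)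

lemma measurable_heaviside : Measurable heaviside :=
  Measurable.ite measurableSet_Ici measurable_const measurable_const

lemma heaviside_nonneg (x : ℝ) : 0 ≤ heaviside x := by unfold heaviside; split_ifs <;> norm_num

lemma heaviside_le_one (x : ℝ) : heaviside x ≤ 1 := by unfold heaviside; split_ifs <;> norm_num

lemma heaviside_eq_indicator (σ : ℝ) (X Y : E3) :
    heaviside (σ - ‖Y - X‖) = (closedBall X σ).indicator (fun _ => (1 : ℝ)) Y := by
  unfold heaviside
  by_cases h : Y ∈ closedBall X σ
  · rw [indicator_of_mem h, if_pos]
    rw [mem_closedBall_iff_norm] at h; linarith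
  · rw [indicator_of_notMem h, if_neg]
    rw [mem_closedBall_iff_norm] at h; linarith

lemma ballInt_eq (σ : ℝ) (u : E3 → ℝ) (X : E3) :
    ballInt σ u X = ∫ z in closedBall (0 : E3) σ, u (X + z) := by
  rw [ballInt, ← integral_indicator isClosed_closedBall.measurableSet,
    ← integral_add_left_eq_self (fun Y => u Y * heaviside (σ - ‖Y - X‖)) X]
  congr 1; ext z
  rw [heaviside_eq_indicator]
  by_cases h : z ∈ closedBall (0 : E3) σ
  · rw [indicator_of_mem h, indicator_of_mem (by simpa using h), mul_one]
  · rw [indicator_of_notMem h, indicator_of_notMem (by simpa using h), mul_zero]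

lemma LocBdd.integrable_ball {u : E3 → ℝ} (hu : LocBdd u) (σ : ℝ) (X : E3) :
    Integrable fun Y => u Y * heaviside (σ - ‖Y - X‖) := by
  obtain ⟨C, hC⟩ := hu.bdd (‖X‖ + σ)
  have h : Integrable ((closedBall X σ).indicator fun _ => C) :=
    (integrable_indicator_iff isClosed_closedBall.measurableSet).2
      (integrableOn_const measure_closedBall_lt_top.ne)
  refine h.mono' (hu.meas.mul (measurable_heaviside.comp (by fun_prop))).aestronglyMeasurable
    (ae_of_all _ fun Y => ?_)
  rw [heaviside_eq_indicator]
  by_cases h : Y ∈ closedBall X σ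
  · rw [indicator_of_mem h, indicator_of_mem h, mul_one]
    refine hC Y ?_
    rw [mem_closedBall_iff_norm] at h
    linarith [norm_le_norm_add_norm_sub' Y X]
  · rw [indicator_of_notMem h, indicator_of_notMem h, mul_zero, norm_zero]

lemma volume_real_ball (X : E3) {r : ℝ} (hr : 0 ≤ r) :
    (volume : Measure E3).real (closedBall X r) = r ^ 3 * (volume : Measure E3).real (ball 0 1) := by
  rw [Measure.real, Measure.addHaar_closedBall _ _ hr, ENNReal.toReal_mul,
    ENNReal.toReal_ofReal (by positivity)]
  simp [Measure.real]

/-- Averages of bounded functions over balls of a fixed radius are Lipschitz. -/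
lemma exists_lipschitzWith_ballInt {σ : ℝ} (hσ : 0 < σ) {u : E3 → ℝ} (hu : Measurable u) {C : ℝ}
    (hC : ∀ Y, |u Y| ≤ C) : ∃ K, LipschitzWith K (ballInt σ u) := by
  have hC0 : 0 ≤ C := (abs_nonneg _).trans (hC 0)
  have huL : LocBdd u := ⟨hu, fun r => ⟨C, fun Y _ => hC Y⟩⟩
  set c := (volume : Measure E3).real (ball 0 1) with hc
  have hc0 : 0 ≤ c := measureReal_nonneg
  have hbd : ∀ X, |ballInt σ u X| ≤ C * (σ ^ 3 * c) := by
    intro X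
    rw [ballInt_eq, ← volume_real_ball 0 hσ.le, ← Real.norm_eq_abs]
    exact norm_setIntegral_le_of_norm_le_const measure_closedBall_lt_top fun z _ => hC _
  -- The indicators of the two balls agree outside the shell about `X` with radii σ ∓ d, where d =
  -- ‖X - X'‖.
  have hloc : ∀ X X' : E3, ‖X - X'‖ < σ → |ballInt σ u X - ballInt σ u X'|
      ≤ C * (c * ((σ + ‖X - X'‖) ^ 3 - (σ - ‖X - X'‖) ^ 3)) := by
    intro X X' hd
    set d := ‖X - X'‖ with hdd
    have hd0 : 0 ≤ d := norm_nonneg _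
    rw [ballInt, ballInt, ← integral_sub (huL.integrable_ball σ X) (huL.integrable_ball σ X')]
    set A := closedBall X (σ + d) \ closedBall X (σ - d) with hA
    have hAm : MeasurableSet A :=
      measurableSet_closedBall.diff measurableSet_closedBall
    have hAv : (volume : Measure E3).real A = c * ((σ + d) ^ 3 - (σ - d) ^ 3) := by
      rw [hA, measureReal_sdiff (closedBall_subset_closedBall (by linarith))
        isClosed_closedBall.measurableSet (by exact measure_closedBall_lt_top.ne),
        volume_real_ball _ (by linarith), volume_real_ball _ (by linarith)]
      ring
    have hAf : volume A < ⊤ := (measure_mono sdiff_subset).trans_lt measure_closedBall_lt_top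
    have h1 : ∀ Y, u Y * heaviside (σ - ‖Y - X‖) - u Y * heaviside (σ - ‖Y - X'‖)
        = A.indicator (fun Y => u Y * heaviside (σ - ‖Y - X‖) - u Y * heaviside (σ - ‖Y - X'‖)) Y := by
      intro Y
      by_cases h : Y ∈ A
      · rw [indicator_of_mem h]
      · rw [indicator_of_notMem h]
        have t1 : ‖Y - X'‖ ≤ ‖Y - X‖ + d := by
          have := norm_add_le (Y - X) (X - X'); simpa using this
        have t2 : ‖Y - X‖ ≤ ‖Y - X'‖ + d := by
          have := norm_sub_le (Y - X') (X - X'); simpa using this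
        rw [hA, Set.mem_sdiff, mem_closedBall_iff_norm, mem_closedBall_iff_norm] at h
        by_cases h2 : ‖Y - X‖ ≤ σ - d
        · simp [heaviside, show ‖Y - X‖ ≤ σ by linarith, show ‖Y - X'‖ ≤ σ by linarith]
        · have h3 : ¬ ‖Y - X‖ ≤ σ + d := fun h3 => h ⟨h3, h2⟩
          push Not at h3
          simp [heaviside, show ¬ ‖Y - X‖ ≤ σ by linarith, show ¬ ‖Y - X'‖ ≤ σ by linarith]
    rw [integral_congr_ae (ae_of_all _ h1), integral_indicator hAm, ← hAv,
      ← Real.norm_eq_abs]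
    refine norm_setIntegral_le_of_norm_le_const hAf fun Y _ => ?_
    rw [← mul_sub, norm_mul]
    refine (mul_le_of_le_one_right (norm_nonneg _) ?_).trans (hC Y)
    rw [Real.norm_eq_abs, abs_le]
    constructor <;> linarith [heaviside_nonneg (σ - ‖Y - X‖), heaviside_nonneg (σ - ‖Y - X'‖),
      heaviside_le_one (σ - ‖Y - X‖), heaviside_le_one (σ - ‖Y - X'‖)]
  -- For d < σ the shell factor is 6σ²d + 2d³ ≤ 8σ²d. For d ≥ σ the trivial bound 2Cσ³c is already
  -- below the constant times d.
  refine ⟨Real.toNNReal (8 * C * c * σ ^ 2), LipschitzWith.of_dist_le_mul fun X X' => ?_⟩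
  rw [Real.coe_toNNReal _ (by positivity), Real.dist_eq, dist_eq_norm]
  rcases lt_or_ge ‖X - X'‖ σ with hlt | hge
  · refine (hloc X X' hlt).trans ?_
    have h0 : 0 ≤ ‖X - X'‖ := norm_nonneg _
    have : (σ + ‖X - X'‖) ^ 3 - (σ - ‖X - X'‖) ^ 3 ≤ 8 * σ ^ 2 * ‖X - X'‖ := by
      nlinarith [mul_nonneg h0 (mul_nonneg (sub_nonneg.2 hlt.le) (add_nonneg hσ.le h0))]
    calc _ ≤ C * (c * (8 * σ ^ 2 * ‖X - X'‖)) := by gcongr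
      _ = _ := by ring
  · refine (abs_sub _ _).trans ((add_le_add (hbd X) (hbd X')).trans ?_)
    calc _ = 2 * C * c * σ ^ 2 * σ := by ring
      _ ≤ 8 * C * c * σ ^ 2 * ‖X - X'‖ := by gcongr; norm_num

/-- Averaging over balls is self-adjoint. -/
lemma LocBdd.integral_mul_ballInt {u : E3 → ℝ} (hu : LocBdd u) (σ : ℝ) {ψ : E3 → ℝ}
    (hψ : Continuous ψ) (hc : HasCompactSupport ψ) :
    ∫ X, ψ X * ballInt σ u X = ∫ Y, u Y * ballInt σ ψ Y := by
  obtain ⟨r, hr⟩ := hc.isCompact.isBounded.subset_closedBall 0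
  obtain ⟨B, hB⟩ := hψ.bounded_above_of_compact_support hc
  obtain ⟨C, hC⟩ := hu.bdd (r + σ)
  have hi : ∀ {ρ K : ℝ}, Integrable ((closedBall (0 : E3) ρ).indicator fun _ => K) := fun {ρ K} =>
    (integrable_indicator_iff isClosed_closedBall.measurableSet).2
      (integrableOn_const measure_closedBall_lt_top.ne)
  have hint : Integrable (Function.uncurry fun X Y : E3 =>
      ψ X * (u Y * heaviside (σ - ‖Y - X‖))) (volume.prod volume) := by
    refine ((hi (ρ := r) (K := |B|)).mul_prod (hi (ρ := r + σ) (K := |C|))).mono' ?_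
      (ae_of_all _ fun q => ?_)
    · refine Measurable.aestronglyMeasurable ?_
      exact (hψ.measurable.comp measurable_fst).mul ((hu.meas.comp measurable_snd).mul
        (measurable_heaviside.comp (by fun_prop)))
    · simp only [Function.uncurry]
      by_cases h1 : q.1 ∈ closedBall (0 : E3) r
      · rw [indicator_of_mem h1, norm_mul, norm_mul]
        refine mul_le_mul ((hB _).trans (le_abs_self _)) ?_ (by positivity) (abs_nonneg _)
        rw [heaviside_eq_indicator]
        by_cases h2 : q.2 ∈ closedBall q.1 σ
        · have h3 : ‖q.2‖ ≤ r + σ := by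
            rw [mem_closedBall_iff_norm] at h2
            rw [mem_closedBall_zero_iff] at h1
            linarith [norm_le_norm_add_norm_sub' q.2 q.1]
          rw [indicator_of_mem h2, indicator_of_mem (by simpa using h3), norm_one, mul_one]
          exact (hC _ h3).trans (le_abs_self _)
        · rw [indicator_of_notMem h2]
          simp [indicator_nonneg]
      · rw [image_eq_zero_of_notMem_tsupport fun h => h1 (hr h)]
        rw [zero_mul, norm_zero]
        exact mul_nonneg (indicator_nonneg (fun _ _ => abs_nonneg _) _)
          (indicator_nonneg (fun _ _ => abs_nonneg _) _)
  simp only [ballInt]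
  simp_rw [← integral_const_mul]
  rw [integral_integral_swap hint]
  congr 1; ext Y
  congr 1; ext X
  rw [norm_sub_rev]; ring

/-- Ball averaging is convolution with the indicator of a ball, so derivatives fall on `ψ`. The
result is again a test function, but on the whole space: even if `ψ` lives in `D`, its average may
reach across ∂D. -/
lemma contDiff_ballInt (σ : ℝ) {ψ : E3 → ℝ} (hψ : ContDiff ℝ ∞ ψ) (hc : HasCompactSupport ψ) :
    ContDiff ℝ ∞ (ballInt σ ψ) ∧ HasCompactSupport (ballInt σ ψ) ∧
      ∀ Y e, fderiv ℝ (ballInt σ ψ) Y e = ballInt σ (fun X => fderiv ℝ ψ X e) Y := by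
  have hf : LocallyIntegrable ((closedBall (0 : E3) σ).indicator fun _ => (1 : ℝ)) :=
    ((integrable_indicator_iff isClosed_closedBall.measurableSet).2
      (integrableOn_const measure_closedBall_lt_top.ne)).locallyIntegrable
  have hconv : ∀ g : E3 → ℝ, ballInt σ g = convolution
      ((closedBall (0 : E3) σ).indicator fun _ => (1 : ℝ)) g (ContinuousLinearMap.mul ℝ ℝ) volume := by
    intro g; ext X
    rw [convolution_def, ballInt, ← integral_sub_left_eq_self (fun Y => g Y * _) volume X]
    congr 1; ext z
    rw [heaviside_eq_indicator]
    simp only [ContinuousLinearMap.mul_apply']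
    by_cases h : z ∈ closedBall (0 : E3) σ
    · rw [indicator_of_mem h, indicator_of_mem (by simpa using h), mul_comm]
    · rw [indicator_of_notMem h, indicator_of_notMem (by simpa using h), mul_comm]
  have hψ1 : ContDiff ℝ 1 ψ := hψ.of_le (by exact_mod_cast le_top)
  refine ⟨?_, ?_, fun Y e => ?_⟩
  · rw [hconv]
    exact hc.contDiff_convolution_right _ hf hψ
  · obtain ⟨r, hr⟩ := hc.isCompact.isBounded.subset_closedBall 0
    refine HasCompactSupport.intro (isCompact_closedBall (0 : E3) (r + σ)) fun Y hY => ?_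
    rw [ballInt_eq]
    refine setIntegral_eq_zero_of_forall_eq_zero fun z hz => ?_
    refine image_eq_zero_of_notMem_tsupport fun h => hY ?_
    have h1 := hr h
    rw [mem_closedBall_zero_iff] at h1 hz ⊢
    have := norm_sub_le (Y + z) z
    simp at this; linarith
  · rw [hconv, (hc.hasFDerivAt_convolution_right _ hf hψ1 Y).fderiv, hconv]
    rw [convolution_precompR_apply _ hf (hc.fderiv ℝ) (hψ1.continuous_fderiv one_ne_zero)]

/-- Locally, ball averages agree with ball averages of bounded functions. -/
lemma LocBdd.exists_truncation {u : E3 → ℝ} (hu : LocBdd u) (σ r : ℝ) : ∃ w : E3 → ℝ,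
    Measurable w ∧ (∃ C, ∀ Y, |w Y| ≤ C) ∧ (∀ Y, ‖Y‖ ≤ r + σ → w Y = u Y) ∧
    ∀ X, ‖X‖ ≤ r → ballInt σ w X = ballInt σ u X := by
  obtain ⟨C, hC⟩ := hu.bdd (r + σ)
  refine ⟨(closedBall (0 : E3) (r + σ)).indicator u,
    hu.meas.indicator measurableSet_closedBall, ⟨|C|, fun Y => ?_⟩,
    fun Y hY => indicator_of_mem (by simpa using hY) _, fun X hX => ?_⟩
  · by_cases hY : Y ∈ closedBall (0 : E3) (r + σ)
    · rw [indicator_of_mem hY]; exact (hC Y (by simpa using hY)).trans (le_abs_self C)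
    · rw [indicator_of_notMem hY, abs_zero]; exact abs_nonneg C
  · unfold ballInt
    congr 1; ext Y
    by_cases hY : Y ∈ closedBall X σ
    · rw [indicator_of_mem]
      rw [mem_closedBall_iff_norm] at hY
      rw [mem_closedBall_zero_iff]
      linarith [norm_le_norm_add_norm_sub' Y X]
    · rw [heaviside_eq_indicator, indicator_of_notMem hY, mul_zero, mul_zero]

/-- Near a point only the values of `u` on a bounded set enter, and for bounded functions the
average is Lipschitz. -/
lemma LocBdd.continuous_ballInt {u : E3 → ℝ} (hu : LocBdd u) {σ : ℝ} (hσ : 0 < σ) :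
    Continuous (ballInt σ u) := by
  rw [continuous_iff_continuousAt]
  intro X
  obtain ⟨w, hw, ⟨C, hC⟩, -, hw2⟩ := hu.exists_truncation σ (‖X‖ + 1)
  obtain ⟨K, hK⟩ := exists_lipschitzWith_ballInt hσ hw hC
  refine hK.continuous.continuousAt.congr ?_
  filter_upwards [ball_mem_nhds X one_pos] with Y hY
  rw [mem_ball_iff_norm] at hY
  exact hw2 Y (by linarith [norm_le_norm_add_norm_sub' Y X])

/-- Translation by `σα` under an integral over directions. -/
lemma integral_shift_dir {w : S2 → E3 → ℝ} (hw : Measurable fun q : S2 × E3 => w q.1 q.2)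
    (hb : ∀ r : ℝ, ∃ C : ℝ, ∀ α Y, ‖Y‖ ≤ r → |w α Y| ≤ C) (σ : ℝ) {ψ : E3 → ℝ}
    (hψ : Continuous ψ) (hc : HasCompactSupport ψ) :
    ∫ Y, (∫ α : S2, ψ (Y + σ • (α : E3)) * w α Y ∂solidAngle)
      = ∫ X, ψ X * ∫ α : S2, w α (X - σ • (α : E3)) ∂solidAngle := by
  obtain ⟨r, hr⟩ := hc.isCompact.isBounded.subset_closedBall 0
  obtain ⟨B, hB⟩ := hψ.bounded_above_of_compact_support hc
  obtain ⟨C, hC⟩ := hb (r + |σ|)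
  have hcd := continuous_dir
  have hz : ∀ X : E3, r < ‖X‖ → ψ X = 0 := fun X hX =>
    image_eq_zero_of_notMem_tsupport fun h => by
      have := hr h; rw [mem_closedBall_zero_iff] at this; linarith
  have h1 : Integrable (Function.uncurry fun (α : S2) (Y : E3) => ψ (Y + σ • (α : E3)) * w α Y)
      (solidAngle.prod volume) := by
    have hz' : ∀ q : S2 × E3, r + |σ| < ‖q.2‖ → ψ (q.2 + σ • (q.1 : E3)) = 0 := fun q hq => by
      refine hz _ ?_
      have := norm_sub_smul_dir_le (q.2 + σ • (q.1 : E3)) σ q.1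
      rw [add_sub_cancel_right] at this; linarith
    refine integrable_of_bdd_support (C := |B| * |C|) (r := r + |σ|) ?_ (ae_of_all _ fun q => ?_)
      (ae_of_all _ fun q hq => by simp [Function.uncurry, hz' q hq])
    · exact (Measurable.mul (hψ.comp (by fun_prop)).measurable hw).aestronglyMeasurable
    · by_cases hX : ‖q.2‖ ≤ r + |σ|
      · rw [Function.uncurry, abs_mul]
        exact mul_le_mul ((hB _).trans (le_abs_self _)) ((hC _ _ hX).trans (le_abs_self _))
          (abs_nonneg _) (abs_nonneg _)
      · rw [Function.uncurry, hz' q (not_le.1 hX)]; simp; positivity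
  have h2 : Integrable (Function.uncurry fun (α : S2) (X : E3) => ψ X * w α (X - σ • (α : E3)))
      (solidAngle.prod volume) := by
    refine integrable_of_bdd_support (C := |B| * |C|) (r := r) ?_ (ae_of_all _ fun q => ?_)
      (ae_of_all _ fun q hq => by simp [Function.uncurry, hz _ hq])
    · refine (Measurable.mul (hψ.measurable.comp measurable_snd) ?_).aestronglyMeasurable
      exact hw.comp (g := fun q : S2 × E3 => _) (f := fun q : S2 × E3 => (q.1, q.2 - σ • (q.1 : E3)))
        (Continuous.measurable (by fun_prop))
    · by_cases hX : ‖q.2‖ ≤ r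
      · rw [Function.uncurry, abs_mul]
        exact mul_le_mul ((hB _).trans (le_abs_self _)) ((hC _ _
          ((norm_sub_smul_dir_le _ _ _).trans (by linarith))).trans (le_abs_self _))
          (abs_nonneg _) (abs_nonneg _)
      · rw [Function.uncurry, hz _ (not_le.1 hX)]; simp; positivity
  rw [← integral_integral_swap h1]
  simp_rw [← integral_const_mul]
  rw [← integral_integral_swap h2]
  congr 1; ext α
  rw [← integral_add_right_eq_self (fun X : E3 => ψ X * w α (X - σ • (α : E3))) (σ • (α : E3))]
  simp

end BallAverage

/-! ### Velocity moments of rapidly decaying functions -/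

section Moments

variable {ι V W : Type*} [NormedAddCommGroup V] [NormedAddCommGroup W]

/-- Decay in the velocity faster than every power, uniformly on `A`. -/
def Rapid (A : Set ι) (h : ι → E3 → V) : Prop :=
  ∀ n : ℕ, ∃ C : ℝ, ∀ x ∈ A, ∀ ξ, (1 + ‖ξ‖) ^ n * ‖h x ξ‖ ≤ C

/-- Polynomial growth in the velocity, uniformly on `A`. -/
def PolyB (A : Set ι) (h : ι → E3 → V) : Prop :=
  ∃ (C : ℝ) (n : ℕ), ∀ x ∈ A, ∀ ξ, ‖h x ξ‖ ≤ C * (1 + ‖ξ‖) ^ n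

lemma Rapid.mono {A B : Set ι} {h : ι → E3 → V} (hh : Rapid B h) (hAB : A ⊆ B) : Rapid A h :=
  fun n => (hh n).imp fun _ hC x hx => hC x (hAB hx)

lemma PolyB.mono {A B : Set ι} {h : ι → E3 → V} (hh : PolyB B h) (hAB : A ⊆ B) : PolyB A h := by
  obtain ⟨C, n, hC⟩ := hh
  exact ⟨C, n, fun x hx => hC x (hAB hx)⟩

/-- Decay beyond every power absorbs polynomial growth. The product enters only through a norm
bound, so that products of scalars, scalar multiples of vectors and rank-one operators are all
covered. -/
lemma Rapid.mul_poly {U : Type*} [NormedAddCommGroup U] {A : Set ι} {h : ι → E3 → V}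
    {g : ι → E3 → W} {k : ι → E3 → U} (hh : Rapid A h) (hg : PolyB A g)
    (hk : ∀ x ∈ A, ∀ ξ, ‖k x ξ‖ ≤ ‖h x ξ‖ * ‖g x ξ‖) : Rapid A k := by
  intro n
  obtain ⟨C, l, hC⟩ := hg
  obtain ⟨B, hB⟩ := hh (n + l)
  refine ⟨|C| * B, fun x hx ξ => ?_⟩
  have h1 : ‖g x ξ‖ ≤ |C| * (1 + ‖ξ‖) ^ l := (hC x hx ξ).trans (by gcongr; exact le_abs_self C)
  calc (1 + ‖ξ‖) ^ n * ‖k x ξ‖ ≤ (1 + ‖ξ‖) ^ n * (‖h x ξ‖ * (|C| * (1 + ‖ξ‖) ^ l)) := by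
        gcongr
        exact (hk x hx ξ).trans (by gcongr)
    _ = |C| * ((1 + ‖ξ‖) ^ (n + l) * ‖h x ξ‖) := by ring
    _ ≤ |C| * B := by gcongr; exact hB x hx ξ

lemma PolyB.add {A : Set ι} {h g : ι → E3 → V} (hh : PolyB A h) (hg : PolyB A g) :
    PolyB A (fun x ξ => h x ξ + g x ξ) := by
  obtain ⟨C, l, hC⟩ := hg
  obtain ⟨B, n, hB⟩ := hh
  refine ⟨|B| + |C|, n + l, fun x hx ξ => ?_⟩
  have h1 : (1 : ℝ) ≤ 1 + ‖ξ‖ := by linarith [norm_nonneg ξ]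
  calc ‖h x ξ + g x ξ‖ ≤ |B| * (1 + ‖ξ‖) ^ n + |C| * (1 + ‖ξ‖) ^ l := by
        refine (norm_add_le _ _).trans (add_le_add ?_ ?_)
        · exact (hB x hx ξ).trans (by gcongr; exact le_abs_self B)
        · exact (hC x hx ξ).trans (by gcongr; exact le_abs_self C)
    _ ≤ |B| * (1 + ‖ξ‖) ^ (n + l) + |C| * (1 + ‖ξ‖) ^ (n + l) := by
        gcongr <;> first | exact h1 | omega
    _ = _ := by ring

lemma polyB_const (A : Set ι) (c : V) : PolyB A (fun _ _ => c) :=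
  ⟨‖c‖, 0, fun _ _ _ => by simp⟩

lemma polyB_id (A : Set ι) : PolyB A (fun _ ξ => ξ) :=
  ⟨1, 1, fun _ _ ξ => by simp⟩

/-- Four is the first integer power above the dimension, so the majorant is integrable in the
velocity. -/
lemma Rapid.bound {A : Set ι} {h : ι → E3 → V} (hh : Rapid A h) :
    ∃ C : ℝ, 0 ≤ C ∧ ∀ x ∈ A, ∀ ξ, ‖h x ξ‖ ≤ C * wt ξ := by
  obtain ⟨C, hC⟩ := hh 4
  refine ⟨|C|, abs_nonneg _, fun x hx ξ => ?_⟩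
  rw [wt, ← div_eq_mul_inv, le_div_iff₀ (by positivity), mul_comm]
  exact (hC x hx ξ).trans (le_abs_self C)

variable {D : Set E3} {h : E3 → E3 → V}

lemma continuous_slice (hc : ContinuousOn (Function.uncurry h) (D ×ˢ univ)) {X : E3} (hX : X ∈ D) :
    Continuous (h X) := by
  rw [← continuousOn_univ]
  exact hc.comp (f := fun ξ : E3 => (X, ξ)) (by fun_prop) fun ξ _ => ⟨hX, mem_univ _⟩

lemma continuousOn_slice (hc : ContinuousOn (Function.uncurry h) (D ×ˢ univ)) (ξ : E3) :
    ContinuousOn (fun X => h X ξ) D :=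
  hc.comp (f := fun X : E3 => (X, ξ)) (by fun_prop) fun X hX => ⟨hX, mem_univ _⟩

lemma contDiffOn_slice [NormedSpace ℝ V] (hc : ContDiffOn ℝ 1 (Function.uncurry h) (D ×ˢ univ)) (ξ : E3) :
    ContDiffOn ℝ 1 (fun X => h X ξ) D :=
  hc.comp (f := fun X : E3 => (X, ξ)) (by fun_prop) fun X hX => ⟨hX, mem_univ _⟩

lemma mem_inter_ball {X : E3} (hX : X ∈ D) : X ∈ D ∩ ball (0 : E3) (‖X‖ + 1) :=
  ⟨hX, by simp⟩

lemma integrable_moment (hc : ContinuousOn (Function.uncurry h) (D ×ˢ univ))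
    (hr : ∀ r, Rapid (D ∩ ball (0 : E3) r) h) {X : E3} (hX : X ∈ D) : Integrable (h X) := by
  obtain ⟨C, -, hC⟩ := (hr (‖X‖ + 1)).bound
  exact (integrable_wt.const_mul C).mono' (continuous_slice hc hX).aestronglyMeasurable
    (ae_of_all _ fun ξ => hC X (mem_inter_ball hX) ξ)

variable [NormedSpace ℝ V]

lemma moment_bdd (hr : ∀ r, Rapid (D ∩ ball (0 : E3) r) h) (r : ℝ) :
    ∃ C : ℝ, ∀ X ∈ D, ‖X‖ ≤ r → ‖∫ ξ, h X ξ‖ ≤ C := by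
  obtain ⟨C, -, hC⟩ := (hr (r + 1)).bound
  refine ⟨∫ ξ, C * wt ξ, fun X hX hXr => ?_⟩
  exact norm_integral_le_of_norm_le (integrable_wt.const_mul C)
    (ae_of_all _ fun ξ => hC X ⟨hX, by simp; linarith⟩ ξ)

lemma continuousOn_moment (hD : IsOpen D) (hc : ContinuousOn (Function.uncurry h) (D ×ˢ univ))
    (hr : ∀ r, Rapid (D ∩ ball (0 : E3) r) h) : ContinuousOn (fun X => ∫ ξ, h X ξ) D := by
  intro X hX
  obtain ⟨C, -, hC⟩ := (hr (‖X‖ + 1)).bound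
  have hU : D ∩ ball (0 : E3) (‖X‖ + 1) ∈ 𝓝 X :=
    (hD.inter isOpen_ball).mem_nhds (mem_inter_ball hX)
  have : ContinuousOn (fun X => ∫ ξ, h X ξ) (D ∩ ball (0 : E3) (‖X‖ + 1)) :=
    continuousOn_of_dominated (bound := fun ξ => C * wt ξ)
      (fun Y hY => (continuous_slice hc hY.1).aestronglyMeasurable)
      (fun Y hY => ae_of_all _ fun ξ => hC Y hY ξ) (integrable_wt.const_mul C)
      (ae_of_all _ fun ξ => (continuousOn_slice hc ξ).mono inter_subset_left)
  exact (this.continuousAt hU).continuousWithinAt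

/-- The gradient is controlled only on compact subsets of `D`, so differentiation under the integral
is carried out on a small ball whose closure lies in `D`. -/
lemma moment_contDiffOn (hD : IsOpen D) (hc : ContDiffOn ℝ 1 (Function.uncurry h) (D ×ˢ univ))
    (hr : ∀ r, Rapid (D ∩ ball (0 : E3) r) h)
    (hg : ∀ L ⊆ D, IsCompact L → Rapid L fun X ξ => fderiv ℝ (fun Y => h Y ξ) X) :
    ContDiffOn ℝ 1 (fun X => ∫ ξ, h X ξ) D ∧
      ∀ X ∈ D, Integrable (fun ξ => fderiv ℝ (fun Y => h Y ξ) X) ∧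
        fderiv ℝ (fun X => ∫ ξ, h X ξ) X = ∫ ξ, fderiv ℝ (fun Y => h Y ξ) X := by
  have key : ∀ X ∈ D, ∃ U, IsOpen U ∧ X ∈ U ∧ ContDiffOn ℝ 1 (fun X => ∫ ξ, h X ξ) U ∧
      Integrable (fun ξ => fderiv ℝ (fun Y => h Y ξ) X) ∧
        fderiv ℝ (fun X => ∫ ξ, h X ξ) X = ∫ ξ, fderiv ℝ (fun Y => h Y ξ) X := by
    intro X hX
    obtain ⟨ε, hε, hεD⟩ := nhds_basis_closedBall.mem_iff.1 (hD.mem_nhds hX)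
    obtain ⟨C, hC0, hC⟩ := (hr (‖X‖ + ε + 1)).bound
    obtain ⟨C1, hC10, hC1⟩ := (hg _ hεD (isCompact_closedBall X ε)).bound
    have hsub : ball X ε ⊆ D := ball_subset_closedBall.trans hεD
    have hin : ∀ x ∈ ball X ε, x ∈ D ∩ ball (0 : E3) (‖X‖ + ε + 1) := fun x hx => by
      refine ⟨hsub hx, ?_⟩
      rw [mem_ball_iff_norm] at hx
      rw [mem_ball_zero_iff]
      linarith [norm_le_norm_add_norm_sub' x X]
    have hw : ∀ ξ, 0 ≤ wt ξ := fun ξ => (wt_pos ξ).le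
    have hm : ∀ x ∈ ball X ε, AEStronglyMeasurable (h x) volume := fun x hx =>
      (continuous_slice hc.continuousOn (hsub hx)).aestronglyMeasurable
    have hi : Integrable fun ξ => (C + C1) * wt ξ := integrable_wt.const_mul (C + C1)
    have hF : ∀ᵐ ξ, ContDiffOn ℝ 1 (fun x => h x ξ) (ball X ε) :=
      ae_of_all _ fun ξ => (contDiffOn_slice hc ξ).mono hsub
    have hF0 : ∀ᵐ ξ, ∀ x ∈ ball X ε, ‖h x ξ‖ ≤ (C + C1) * wt ξ :=
      ae_of_all _ fun ξ x hx => (hC x (hin x hx) ξ).trans (by nlinarith [hw ξ])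
    have hF1 : ∀ᵐ ξ, ∀ x ∈ ball X ε, ‖fderiv ℝ (fun x => h x ξ) x‖ ≤ (C + C1) * wt ξ :=
      ae_of_all _ fun ξ x hx => (hC1 x (ball_subset_closedBall hx) ξ).trans (by nlinarith [hw ξ])
    have h1 := hasFDerivAt_integral_of_contDiffOn isOpen_ball hm hi hF hF0 hF1 (mem_ball_self hε)
    refine ⟨ball X ε, isOpen_ball, mem_ball_self hε,
      contDiffOn_integral_of_contDiffOn isOpen_ball hm hi hF hF0 hF1, ?_, h1.2.fderiv⟩
    exact hi.mono' h1.1 (hF1.mono fun ξ hξ => hξ X (mem_ball_self hε))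
  refine ⟨fun X hX => ?_, fun X hX => ?_⟩
  · obtain ⟨U, hU, hXU, hUc, -⟩ := key X hX
    exact (hUc.contDiffAt (hU.mem_nhds hXU)).contDiffWithinAt
  · obtain ⟨U, hU, hXU, -, h⟩ := key X hX
    exact h

/-- The divergence of a velocity flux. -/
lemma div_moment {h : E3 → E3 → ℝ} (hD : IsOpen D)
    (hc : ContDiffOn ℝ 1 (Function.uncurry h) (D ×ˢ univ))
    (hr : ∀ r, Rapid (D ∩ ball (0 : E3) r) h)
    (hg : ∀ L ⊆ D, IsCompact L → Rapid L fun X ξ => fderiv ℝ (fun Y => h Y ξ) X) :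
    ContDiffOn ℝ 1 (fun X => ∫ ξ, h X ξ • ξ) D ∧
      ∀ X ∈ D, Integrable (fun ξ => fderiv ℝ (fun Y => h Y ξ) X ξ) ∧
        div (fun X => ∫ ξ, h X ξ • ξ) X = ∫ ξ, fderiv ℝ (fun Y => h Y ξ) X ξ := by
  have hfd : ∀ X ∈ D, ∀ ξ, fderiv ℝ (fun Y => h Y ξ • ξ) X
      = (fderiv ℝ (fun Y => h Y ξ) X).smulRight ξ := by
    intro X hX ξ
    have hd : DifferentiableAt ℝ (fun Y => h Y ξ) X :=
      ((contDiffOn_slice hc ξ).contDiffAt (hD.mem_nhds hX)).differentiableAt one_ne_zero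
    exact (hd.hasFDerivAt.smul_const ξ).fderiv
  have hM := moment_contDiffOn (h := fun X ξ => h X ξ • ξ) hD (hc.smul (by fun_prop))
    (fun r => (hr r).mul_poly (polyB_id _) fun X _ ξ => (norm_smul_le _ _))
    (fun L hL hLc => (hg L hL hLc).mul_poly (polyB_id _) fun X hX ξ => by
      rw [hfd X (hL hX) ξ, ContinuousLinearMap.norm_smulRight_apply])
  refine ⟨hM.1, fun X hX => ?_⟩
  obtain ⟨h1, h2⟩ := hM.2 X hX
  have hpt : ∀ ξ, ∑ i : Fin 3, (fderiv ℝ (fun Y => h Y ξ • ξ) X (EuclideanSpace.single i 1)) i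
      = fderiv ℝ (fun Y => h Y ξ) X ξ := by
    intro ξ
    rw [hfd X hX ξ, ← sum_coord_smul_apply (fderiv ℝ (fun Y => h Y ξ) X) ξ]
    simp [mul_comm]
  have h3 : ∀ i : Fin 3, Integrable fun ξ =>
      (fderiv ℝ (fun Y => h Y ξ • ξ) X (EuclideanSpace.single i 1)) i := fun i =>
    (EuclideanSpace.proj i : E3 →L[ℝ] ℝ).integrable_comp
      (h1.apply_continuousLinearMap (EuclideanSpace.single i 1))
  refine ⟨(integrable_finsetSum Finset.univ fun i _ => h3 i).congr (ae_of_all _ hpt), ?_⟩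
  rw [← integral_congr_ae (ae_of_all _ hpt), integral_finsetSum _ fun i _ => h3 i, div, h2]
  refine Finset.sum_congr rfl fun i _ => ?_
  rw [ContinuousLinearMap.integral_apply h1]
  exact ((EuclideanSpace.proj i : E3 →L[ℝ] ℝ).integral_comp_comm
    (h1.apply_continuousLinearMap (EuclideanSpace.single i 1))).symm

lemma locBdd_of_continuousOn {V : Type*} [NormedAddCommGroup V] [MeasurableSpace V] [BorelSpace V]
    (hD : IsOpen D) {u : E3 → V} (hc : ContinuousOn u D) (hz : ∀ X ∉ D, u X = 0)
    (hb : ∀ r : ℝ, ∃ C : ℝ, ∀ X ∈ D, ‖X‖ ≤ r → ‖u X‖ ≤ C) : LocBdd u := by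
  classical
  refine ⟨?_, fun r => ?_⟩
  · have h := hc.measurable_piecewise (g := fun _ => (0 : V)) continuousOn_const hD.measurableSet
    convert h using 1
    ext X
    by_cases hX : X ∈ D
    · simp [hX]
    · simp [hX, hz X hX]
  · obtain ⟨C, hC⟩ := hb r
    refine ⟨|C|, fun Y hY => ?_⟩
    by_cases hX : Y ∈ D
    · exact (hC Y hX hY).trans (le_abs_self C)
    · rw [hz Y hX, norm_zero]; exact abs_nonneg C

end Moments

/-! ### Fixed-time data: densities, momenta and the crowding function -/

/-- A regular solution of the Enskog equation and its time derivative at a fixed time, extended by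
zero outside `D`. -/
structure Slice (m σ : ℝ) (S : ℝ → ℝ) (b : EReal) (D : Set E3) (F G : E3 → E3 → ℝ) : Prop where
  hm : 0 < m
  hσ : 0 < σ
  hD : IsOpen D
  hS : ContDiffOn ℝ 1 S {x : ℝ | 0 ≤ x ∧ (x : EReal) < b}
  hS0 : ∀ x : ℝ, 0 ≤ x → (x : EReal) < b → 0 ≤ S x
  pos : ∀ X ∈ D, ∀ ξ, 0 < F X ξ
  zero : ∀ X ∉ D, ∀ ξ, F X ξ = 0
  smooth : ContDiffOn ℝ 1 (Function.uncurry F) (D ×ˢ univ)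
  rapid : ∀ r, Rapid (D ∩ ball (0 : E3) r) F
  log_poly : ∀ r, PolyB (D ∩ ball (0 : E3) r) fun X ξ => Real.log (F X ξ)
  grad_poly : ∀ L ⊆ D, IsCompact L →
    PolyB L fun X ξ => fderiv ℝ (fun Y => Real.log (F Y ξ)) X
  G_zero : ∀ X ∉ D, ∀ ξ, G X ξ = 0
  G_cont : ContinuousOn (Function.uncurry G) (D ×ˢ univ)
  G_rapid : ∀ r, Rapid (D ∩ ball (0 : E3) r) G
  eqn : ∀ X ∈ D, ∀ ξ, G X ξ + fderiv ℝ (fun Y => F Y ξ) X ξ = collision m σ S D F X ξ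
  crowd_lt : ∀ X ∈ closure D, (crowding m σ D F X : EReal) < b
  noflux : NoNormalFlux D fun X => density F X • flow F X

/-- The momentum `⟨ξ f⟩`. -/
def momentum (F : E3 → E3 → ℝ) (X : E3) : E3 := ∫ ξ, F X ξ • ξ

lemma exists_subset_ball {D L : Set E3} (hL : L ⊆ D) (hLc : IsCompact L) :
    ∃ r, L ⊆ D ∩ ball (0 : E3) r := by
  obtain ⟨r, hr⟩ := hLc.isBounded.subset_ball (0 : E3)
  exact ⟨r, fun X hX => ⟨hL hX, hr hX⟩⟩

section Factor

variable {m σ : ℝ} {S : ℝ → ℝ} {D : Set E3} {F : E3 → E3 → ℝ}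

/-- Outside the closure of `D` the crowding function may leave [0, b), where nothing is known about
`S`. This form involves `S` only through S(R) extended by zero, which is measurable and locally
bounded. -/
lemma cutFactor_eq (X Y : E3) : cutFactor m σ S D F X Y =
    D.indicator (fun X => S (crowding m σ D F X)) X * chi D Y
      + chi D X * D.indicator (fun X => S (crowding m σ D F X)) Y := by
  rw [cutFactor, enskogFactor, chi, chi]
  by_cases hX : X ∈ D <;> by_cases hY : Y ∈ D <;> simp [hX, hY]

lemma cutFactor_of_mem {X Y : E3} (hX : X ∈ D) (hY : Y ∈ D) : cutFactor m σ S D F X Y =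
    S (crowding m σ D F X) + S (crowding m σ D F Y) := by
  simp [cutFactor, enskogFactor, chi, hX, hY]

lemma cutFactor_of_notMem {X Y : E3} (hXY : X ∉ D ∨ Y ∉ D) : cutFactor m σ S D F X Y = 0 := by
  rcases hXY with hX | hX <;> simp [cutFactor, chi, hX]

end Factor

namespace Slice

variable {m σ : ℝ} {S : ℝ → ℝ} {b : EReal} {D : Set E3} {F G : E3 → E3 → ℝ}
  (h : Slice m σ S b D F G)

include h

lemma differentiableAt {X : E3} (hX : X ∈ D) (ξ : E3) :
    DifferentiableAt ℝ (fun Y => F Y ξ) X :=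
  ((contDiffOn_slice h.smooth ξ).contDiffAt (h.hD.mem_nhds hX)).differentiableAt one_ne_zero

lemma fderiv_eq {X : E3} (hX : X ∈ D) (ξ : E3) :
    fderiv ℝ (fun Y => F Y ξ) X = F X ξ • fderiv ℝ (fun Y => Real.log (F Y ξ)) X := by
  rw [((h.differentiableAt hX ξ).hasFDerivAt.log (h.pos X hX ξ).ne').fderiv, smul_smul,
    mul_inv_cancel₀ (h.pos X hX ξ).ne', one_smul]

/-- Since ∇f = f ∇ ln f, rapid decay of `f` and a polynomial bound for the logarithmic gradient
control the gradient itself. -/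
lemma rapid_fderiv {L : Set E3} (hL : L ⊆ D) (hLc : IsCompact L) :
    Rapid L fun X ξ => fderiv ℝ (fun Y => F Y ξ) X := by
  obtain ⟨r, hr⟩ := exists_subset_ball hL hLc
  refine ((h.rapid r).mono hr).mul_poly (h.grad_poly L hL hLc) fun X hX ξ => ?_
  rw [h.fderiv_eq (hL hX), norm_smul]

lemma smooth_entropy :
    ContDiffOn ℝ 1 (Function.uncurry fun X ξ => F X ξ * Real.log (F X ξ)) (D ×ˢ univ) :=
  h.smooth.mul (h.smooth.log fun q hq => (h.pos q.1 hq.1 q.2).ne')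

lemma log_cont :
    ContinuousOn (Function.uncurry fun X ξ => Real.log (F X ξ)) (D ×ˢ univ) :=
  h.smooth.continuousOn.log fun q hq => (h.pos q.1 hq.1 q.2).ne'

lemma rapid_entropy (r : ℝ) :
    Rapid (D ∩ ball (0 : E3) r) fun X ξ => F X ξ * Real.log (F X ξ) :=
  (h.rapid r).mul_poly (h.log_poly r) fun _ _ _ => (norm_mul_le _ _)

lemma fderiv_entropy {X : E3} (hX : X ∈ D) (ξ : E3) :
    fderiv ℝ (fun Y => F Y ξ * Real.log (F Y ξ)) X
      = (1 + Real.log (F X ξ)) • fderiv ℝ (fun Y => F Y ξ) X := by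
  have hd := (h.differentiableAt hX ξ).hasFDerivAt
  have hp := (h.pos X hX ξ).ne'
  have h1 : HasFDerivAt (fun Y => F Y ξ * Real.log (F Y ξ)) _ X := hd.mul (hd.log hp)
  rw [h1.fderiv, smul_smul, mul_inv_cancel₀ hp, ← add_smul]

lemma log1_poly (r : ℝ) :
    PolyB (D ∩ ball (0 : E3) r) fun X ξ => 1 + Real.log (F X ξ) :=
  (polyB_const _ (1 : ℝ)).add (h.log_poly r)

lemma rapid_fderiv_entropy {L : Set E3} (hL : L ⊆ D) (hLc : IsCompact L) :
    Rapid L fun X ξ => fderiv ℝ (fun Y => F Y ξ * Real.log (F Y ξ)) X := by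
  obtain ⟨r, hr⟩ := exists_subset_ball hL hLc
  refine (h.rapid_fderiv hL hLc).mul_poly ((h.log1_poly r).mono hr) fun X hX ξ => ?_
  rw [h.fderiv_entropy (hL hX), norm_smul, mul_comm]

lemma rapid_mom (r : ℝ) : Rapid (D ∩ ball (0 : E3) r) fun X ξ => F X ξ • ξ :=
  (h.rapid r).mul_poly (polyB_id _) fun _ _ _ => norm_smul_le _ _

lemma smooth_mom : ContDiffOn ℝ 1 (Function.uncurry fun X ξ => F X ξ • ξ) (D ×ˢ univ) :=
  h.smooth.smul (by fun_prop)

lemma integrable_F (X : E3) : Integrable (F X) := by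
  by_cases hX : X ∈ D
  · exact integrable_moment h.smooth.continuousOn h.rapid hX
  · rw [show F X = fun _ => 0 from funext fun ξ => h.zero X hX ξ]
    exact integrable_zero _ _ _

lemma integrable_mom (X : E3) : Integrable fun ξ => F X ξ • ξ := by
  by_cases hX : X ∈ D
  · exact integrable_moment h.smooth_mom.continuousOn h.rapid_mom hX
  · simp [h.zero X hX]

lemma density_zero {X : E3} (hX : X ∉ D) : density F X = 0 := by
  simp [density, h.zero X hX]

lemma density_pos {X : E3} (hX : X ∈ D) : 0 < density F X := by
  refine integral_pos_of_integrable_nonneg_nonzero (x := 0)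
    (continuous_slice h.smooth.continuousOn hX) (h.integrable_F X) (fun ξ => (h.pos X hX ξ).le)
    (h.pos X hX 0).ne'

lemma density_nonneg (X : E3) : 0 ≤ density F X := by
  by_cases hX : X ∈ D
  · exact (h.density_pos hX).le
  · exact (h.density_zero hX).ge

lemma momentum_zero {X : E3} (hX : X ∉ D) : momentum F X = 0 := by
  simp [momentum, h.zero X hX]

/-- This removes the division by ρ; outside `D` both sides vanish thanks to the zero extension. -/
lemma density_smul_flow (X : E3) : density F X • flow F X = momentum F X := by
  by_cases hX : X ∈ D
  · rw [flow, smul_inv_smul₀ (h.density_pos hX).ne', momentum]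
  · rw [h.density_zero hX, zero_smul, h.momentum_zero hX]

lemma density_contDiffOn : ContDiffOn ℝ 1 (density F) D :=
  (moment_contDiffOn h.hD h.smooth h.rapid fun _ hL hLc => h.rapid_fderiv hL hLc).1

lemma momentum_contDiffOn : ContDiffOn ℝ 1 (momentum F) D :=
  (div_moment h.hD h.smooth h.rapid fun _ hL hLc => h.rapid_fderiv hL hLc).1

lemma div_momentum {X : E3} (hX : X ∈ D) :
    Integrable (fun ξ => fderiv ℝ (fun Y => F Y ξ) X ξ) ∧
      div (momentum F) X = ∫ ξ, fderiv ℝ (fun Y => F Y ξ) X ξ :=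
  (div_moment h.hD h.smooth h.rapid fun _ hL hLc => h.rapid_fderiv hL hLc).2 X hX

lemma convectiveFlux_contDiffOn : ContDiffOn ℝ 1 (convectiveFlux F) D :=
  (div_moment h.hD h.smooth_entropy h.rapid_entropy fun _ hL hLc =>
    h.rapid_fderiv_entropy hL hLc).1

lemma div_convectiveFlux {X : E3} (hX : X ∈ D) :
    Integrable (fun ξ => (1 + Real.log (F X ξ)) * fderiv ℝ (fun Y => F Y ξ) X ξ) ∧
      div (convectiveFlux F) X
        = ∫ ξ, (1 + Real.log (F X ξ)) * fderiv ℝ (fun Y => F Y ξ) X ξ := by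
  have := (div_moment h.hD h.smooth_entropy h.rapid_entropy fun _ hL hLc =>
    h.rapid_fderiv_entropy hL hLc).2 X hX
  simp only [h.fderiv_entropy hX, _root_.smul_apply, smul_eq_mul] at this
  exact this

lemma density_locBdd : LocBdd (density F) :=
  locBdd_of_continuousOn h.hD h.density_contDiffOn.continuousOn (fun _ hX => h.density_zero hX)
    (moment_bdd h.rapid)

lemma momentum_locBdd : LocBdd (momentum F) :=
  locBdd_of_continuousOn h.hD h.momentum_contDiffOn.continuousOn (fun _ hX => h.momentum_zero hX)
    (moment_bdd h.rapid_mom)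

lemma rate_continuousOn : ContinuousOn (fun X => ∫ ξ, G X ξ) D :=
  continuousOn_moment h.hD h.G_cont h.G_rapid

lemma rate_locBdd : LocBdd fun X => ∫ ξ, G X ξ :=
  locBdd_of_continuousOn h.hD h.rate_continuousOn (fun X hX => by simp [h.G_zero X hX])
    (moment_bdd h.G_rapid)

lemma entropyRate_cont :
    ContinuousOn (Function.uncurry fun X ξ => (1 + Real.log (F X ξ)) * G X ξ) (D ×ˢ univ) :=
  (continuousOn_const.add h.log_cont).mul h.G_cont

lemma entropyRate_rapid (r : ℝ) :
    Rapid (D ∩ ball (0 : E3) r) fun X ξ => (1 + Real.log (F X ξ)) * G X ξ :=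
  (h.G_rapid r).mul_poly (h.log1_poly r) fun _ _ _ => by rw [norm_mul, mul_comm]

/-! ### The crowding function -/

lemma crowding_eq (X : E3) : crowding m σ D F X = (1 / m) * ballInt σ (density F) X := by
  rw [crowding, ballInt]
  congr 1
  refine setIntegral_eq_integral_of_forall_compl_eq_zero fun Y hY => ?_
  rw [h.density_zero hY, zero_mul]

lemma crowding_nonneg (X : E3) : 0 ≤ crowding m σ D F X := by
  rw [h.crowding_eq]
  have := h.hm
  refine mul_nonneg (by positivity) (integral_nonneg fun Y => ?_)
  exact mul_nonneg (h.density_nonneg Y) (heaviside_nonneg _)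

/-- Strict positivity places R in the open interval (0, b), where the primitive of `S` has a
two-sided derivative. -/
lemma crowding_pos {X : E3} (hX : X ∈ D) : 0 < crowding m σ D F X := by
  rw [h.crowding_eq]
  have hm := h.hm
  refine mul_pos (by positivity) ?_
  rw [ballInt, integral_pos_iff_support_of_nonneg
    (fun Y => mul_nonneg (h.density_nonneg Y) (heaviside_nonneg _)) (h.density_locBdd.integrable_ball σ X)]
  refine Measure.measure_pos_of_mem_nhds (volume : Measure E3) (x := X) ?_
  filter_upwards [h.hD.mem_nhds hX, closedBall_mem_nhds X h.hσ] with Y hY hYσ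
  rw [Function.mem_support, heaviside_eq_indicator, indicator_of_mem hYσ, mul_one]
  exact (h.density_pos hY).ne'

lemma continuous_crowding : Continuous (crowding m σ D F) := by
  have h1 : crowding m σ D F = fun X => (1 / m) * ballInt σ (density F) X :=
    funext h.crowding_eq
  rw [h1]
  exact continuous_const.mul (h.density_locBdd.continuous_ballInt h.hσ)

/-- The values of the crowding function stay away from `b`, locally up to the boundary. -/
lemma exists_crowding_bound {Y : E3} (hY : Y ∈ D) (r : ℝ) : ∃ c : ℝ, 0 < c ∧ (c : EReal) < b ∧
    ∀ X ∈ D, ‖X‖ ≤ r → crowding m σ D F X ≤ c := by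
  -- R is continuous and stays below `b` on the closure of `D`, so its maximum over a compact piece
  -- of the closure does too. The radius is enlarged to contain `Y`, which makes the piece nonempty
  -- and the maximum positive.
  obtain ⟨X0, hX0, hmax⟩ := ((isCompact_closedBall (0 : E3) (max r ‖Y‖)).inter_left
    isClosed_closure).exists_isMaxOn (s := closure D ∩ closedBall (0 : E3) (max r ‖Y‖))
    ⟨Y, subset_closure hY, by simp⟩ h.continuous_crowding.continuousOn
  refine ⟨_, (h.crowding_pos hY).trans_le (hmax ⟨subset_closure hY, by simp⟩), h.crowd_lt X0 hX0.1,
    fun X hX hXr => hmax ⟨subset_closure hX, ?_⟩⟩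
  simpa using Or.inl hXr

/-- The factor `S` agrees locally with a continuous function on the line. -/
lemma exists_extension {c : ℝ} (hc : 0 < c) (hcb : (c : EReal) < b) :
    ∃ s : ℝ → ℝ, Continuous s ∧ (∀ x, 0 ≤ x → x ≤ c → s x = S x) ∧ ∃ C, ∀ x, |s x| ≤ C := by
  have hco : ContinuousOn S (Icc 0 c) := h.hS.continuousOn.mono fun x hx =>
    ⟨hx.1, (EReal.coe_le_coe_iff.2 hx.2).trans_lt hcb⟩
  obtain ⟨C, hC⟩ := isCompact_Icc.exists_bound_of_continuousOn hco
  refine ⟨fun x => S (projIcc 0 c hc.le x), ?_, fun x h0 hx => ?_, C, fun x => hC _ (projIcc 0 c hc.le x).2⟩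
  · exact hco.comp_continuous (continuous_subtype_val.comp continuous_projIcc) fun x =>
      (projIcc 0 c hc.le x).2
  · simp only [projIcc_of_mem hc.le (show x ∈ Icc 0 c from ⟨h0, hx⟩)]

lemma factor_nonneg {X : E3} (hX : X ∈ D) : 0 ≤ S (crowding m σ D F X) :=
  h.hS0 _ (h.crowding_nonneg X) (h.crowd_lt X (subset_closure hX))

lemma factor_continuousOn : ContinuousOn (fun X => S (crowding m σ D F X)) D :=
  h.hS.continuousOn.comp h.continuous_crowding.continuousOn fun X hX =>
    ⟨h.crowding_nonneg X, h.crowd_lt X (subset_closure hX)⟩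

lemma factor_bdd (r : ℝ) : ∃ C, ∀ X ∈ D, ‖X‖ ≤ r → ‖S (crowding m σ D F X)‖ ≤ C := by
  by_cases hne : D.Nonempty
  · obtain ⟨Y, hY⟩ := hne
    obtain ⟨c, hc, hcb, hb⟩ := h.exists_crowding_bound hY r
    obtain ⟨s, -, hs, C, hC⟩ := h.exists_extension hc hcb
    refine ⟨C, fun X hX hXr => ?_⟩
    rw [← hs _ (h.crowding_nonneg X) (hb X hX hXr)]
    exact hC _
  · exact ⟨0, fun X hX => (hne ⟨X, hX⟩).elim⟩

lemma indicator_factor_locBdd : LocBdd (D.indicator fun X => S (crowding m σ D F X)) := by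
  refine locBdd_of_continuousOn h.hD (h.factor_continuousOn.congr fun X hX => indicator_of_mem hX _)
    (fun X hX => indicator_of_notMem hX _) fun r => ?_
  obtain ⟨C, hC⟩ := h.factor_bdd r
  exact ⟨C, fun X hX hXr => by rw [indicator_of_mem hX]; exact hC X hX hXr⟩

lemma measurable_chi : Measurable (chi D) := measurable_const.indicator h.hD.measurableSet

lemma cutFactor_nonneg (X Y : E3) : 0 ≤ cutFactor m σ S D F X Y := by
  by_cases hX : X ∈ D
  · by_cases hY : Y ∈ D
    · rw [cutFactor_of_mem hX hY]
      exact add_nonneg (h.factor_nonneg hX) (h.factor_nonneg hY)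
    · rw [cutFactor_of_notMem (Or.inr hY)]
  · rw [cutFactor_of_notMem (Or.inl hX)]

lemma measurable_cutFactor : Measurable fun q : E3 × E3 => cutFactor m σ S D F q.1 q.2 := by
  simp_rw [cutFactor_eq]
  have h1 := h.indicator_factor_locBdd.meas
  have h2 := h.measurable_chi
  fun_prop

lemma cutFactor_bdd (r : ℝ) : ∃ C, 0 ≤ C ∧ ∀ X Y, ‖X‖ ≤ r → ‖Y‖ ≤ r →
    |cutFactor m σ S D F X Y| ≤ C := by
  obtain ⟨C, hC⟩ := h.factor_bdd r
  refine ⟨|C| + |C|, by positivity, fun X Y hX hY => ?_⟩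
  by_cases hXD : X ∈ D
  · by_cases hYD : Y ∈ D
    · rw [cutFactor_of_mem hXD hYD]
      exact (abs_add_le _ _).trans (add_le_add ((hC X hXD hX).trans (le_abs_self _))
        ((hC Y hYD hY).trans (le_abs_self _)))
    · rw [cutFactor_of_notMem (Or.inr hYD), abs_zero]; positivity
  · rw [cutFactor_of_notMem (Or.inl hXD), abs_zero]; positivity

lemma measurable_uncurry : Measurable (Function.uncurry F) := by
  classical
  have h1 := h.smooth.continuousOn.measurable_piecewise (g := fun _ => (0 : ℝ)) continuousOn_const
    (h.hD.prod isOpen_univ).measurableSet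
  convert h1 using 1
  ext q
  by_cases hq : q.1 ∈ D
  · simp [Function.uncurry, hq]
  · simp [Function.uncurry, hq, h.zero q.1 hq]

end Slice

/-! ### Collision velocities and polynomial bounds -/

section Velocity

/-- The collision frequency factor `V θ(V)`. -/
def vplus (α ξ ξs : E3) : ℝ := relVel α ξ ξs * heaviside (relVel α ξ ξs)

lemma vplus_eq (α ξ ξs : E3) : vplus α ξ ξs = max (relVel α ξ ξs) 0 := by
  unfold vplus heaviside
  split_ifs with h
  · rw [mul_one, max_eq_left h]
  · rw [mul_zero, max_eq_right (not_le.1 h).le]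

lemma vplus_nonneg (α ξ ξs : E3) : 0 ≤ vplus α ξ ξs := by rw [vplus_eq]; exact le_max_right _ _

/-- V⁺ - V⁻ = V: this identity makes gain minus loss linear in the velocities, hence a combination
of moments. -/
lemma vplus_sub (α ξ ξs : E3) : vplus α ξ ξs - max (-relVel α ξ ξs) 0 = relVel α ξ ξs := by
  rw [vplus_eq]
  rcases le_total 0 (relVel α ξ ξs) with h | h
  · rw [max_eq_left h, max_eq_right (by linarith), sub_zero]
  · rw [max_eq_right h, max_eq_left (by linarith)]; ring

lemma abs_relVel_le (α : S2) (ξ ξs : E3) : |relVel α ξ ξs| ≤ ‖ξ‖ + ‖ξs‖ := by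
  refine (abs_real_inner_le_norm _ _).trans ?_
  rw [norm_dir, mul_one, add_comm]
  exact norm_sub_le _ _

lemma abs_relVel_le_mul (α : S2) (ξ ξs : E3) :
    |relVel α ξ ξs| ≤ (1 + ‖ξ‖) * (1 + ‖ξs‖) := by
  nlinarith [abs_relVel_le α ξ ξs, mul_nonneg (norm_nonneg ξ) (norm_nonneg ξs)]

lemma abs_vplus_le (α : S2) (ξ ξs : E3) : |vplus α ξ ξs| ≤ (1 + ‖ξ‖) * (1 + ‖ξs‖) := by
  refine le_trans ?_ (abs_relVel_le_mul α ξ ξs)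
  rw [abs_of_nonneg (vplus_nonneg _ _ _), vplus_eq]
  exact max_le (le_abs_self _) (abs_nonneg _)

lemma norm_post_le (α : S2) (ξ ξs : E3) :
    1 + ‖post α ξ ξs‖ ≤ 2 * ((1 + ‖ξ‖) * (1 + ‖ξs‖)) := by
  have h1 : ‖post α ξ ξs‖ ≤ ‖ξ‖ + |relVel α ξ ξs| := norm_add_smul_dir_le _ _ _
  nlinarith [abs_relVel_le α ξ ξs, mul_nonneg (norm_nonneg ξ) (norm_nonneg ξs), norm_nonneg ξ,
    norm_nonneg ξs]

lemma norm_postStar_le (α : S2) (ξ ξs : E3) :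
    1 + ‖postStar α ξ ξs‖ ≤ 2 * ((1 + ‖ξ‖) * (1 + ‖ξs‖)) := by
  rw [← post_swap, mul_comm (1 + ‖ξ‖)]
  exact norm_post_le α ξs ξ

lemma continuous_relVel : Continuous fun q : S2 × (E3 × E3) => relVel q.1 q.2.1 q.2.2 := by
  have := continuous_dir
  unfold relVel; fun_prop

lemma continuous_vplus : Continuous fun q : S2 × (E3 × E3) => vplus q.1 q.2.1 q.2.2 := by
  simp_rw [vplus_eq]
  exact continuous_relVel.max continuous_const

lemma continuous_post : Continuous fun q : S2 × (E3 × E3) => post q.1 q.2.1 q.2.2 := by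
  have := continuous_dir
  have := continuous_relVel
  unfold post; fun_prop

/-- The integrable weight on pairs of velocities. -/
lemma integrable_wt_pair : Integrable (fun p : E3 × E3 => wt p.1 * wt p.2) :=
  integrable_wt.mul_prod integrable_wt

lemma integrable_wt_coll : Integrable (fun q : S2 × (E3 × E3) => wt q.2.1 * wt q.2.2) collMeasure := by
  have := (integrable_const (1 : ℝ) (μ := solidAngle)).mul_prod integrable_wt_pair
  simpa using this

/-- Polynomial growth in a pair of velocities. -/
def PolyPair (Θ : S2 → E3 → E3 → ℝ) : Prop :=
  ∃ (C : ℝ) (n : ℕ), 0 ≤ C ∧ ∀ (α : S2) ξ ξs, |Θ α ξ ξs| ≤ C * ((1 + ‖ξ‖) * (1 + ‖ξs‖)) ^ n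

lemma one_le_pair (ξ ξs : E3) : 1 ≤ (1 + ‖ξ‖) * (1 + ‖ξs‖) := by
  nlinarith [norm_nonneg ξ, norm_nonneg ξs, mul_nonneg (norm_nonneg ξ) (norm_nonneg ξs)]

lemma PolyPair.sub {Θ Θ' : S2 → E3 → E3 → ℝ} (h : PolyPair Θ) (h' : PolyPair Θ') :
    PolyPair fun α ξ ξs => Θ α ξ ξs - Θ' α ξ ξs := by
  obtain ⟨C, n, hC0, hC⟩ := h
  obtain ⟨B, k, hB0, hB⟩ := h'
  refine ⟨C + B, n + k, by positivity, fun α ξ ξs => ?_⟩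
  have h1 := one_le_pair ξ ξs
  calc |Θ α ξ ξs - Θ' α ξ ξs| ≤ C * ((1 + ‖ξ‖) * (1 + ‖ξs‖)) ^ n
        + B * ((1 + ‖ξ‖) * (1 + ‖ξs‖)) ^ k :=
        (abs_sub _ _).trans (add_le_add (hC _ _ _) (hB _ _ _))
    _ ≤ C * ((1 + ‖ξ‖) * (1 + ‖ξs‖)) ^ (n + k) + B * ((1 + ‖ξ‖) * (1 + ‖ξs‖)) ^ (n + k) := by
        gcongr <;> first | exact h1 | omega
    _ = _ := by ring

lemma polyPair_fst {ψ : E3 → ℝ} {C : ℝ} {n : ℕ} (hψ : ∀ ξ, |ψ ξ| ≤ C * (1 + ‖ξ‖) ^ n) :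
    PolyPair fun _ ξ _ => ψ ξ := by
  refine ⟨|C|, n, abs_nonneg _, fun α ξ ξs => (hψ ξ).trans ?_⟩
  gcongr
  · exact le_abs_self C
  · nlinarith [norm_nonneg ξ, norm_nonneg ξs, mul_nonneg (norm_nonneg ξ) (norm_nonneg ξs)]

lemma polyPair_snd {ψ : E3 → ℝ} {C : ℝ} {n : ℕ} (hψ : ∀ ξ, |ψ ξ| ≤ C * (1 + ‖ξ‖) ^ n) :
    PolyPair fun _ _ ξs => ψ ξs := by
  refine ⟨|C|, n, abs_nonneg _, fun α ξ ξs => (hψ ξs).trans ?_⟩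
  gcongr
  · exact le_abs_self C
  · nlinarith [norm_nonneg ξ, norm_nonneg ξs, mul_nonneg (norm_nonneg ξ) (norm_nonneg ξs)]

/-- Post-collisional speeds are bounded by twice the product (1 + |ξ|)(1 + |ξ_*|); the factor 2 is
the source of `2 ^ n`. -/
lemma polyPair_post {ψ : E3 → ℝ} {C : ℝ} {n : ℕ} (hψ : ∀ ξ, |ψ ξ| ≤ C * (1 + ‖ξ‖) ^ n) :
    PolyPair fun α ξ ξs => ψ (post α ξ ξs) := by
  refine ⟨|C| * 2 ^ n, n, by positivity, fun α ξ ξs => (hψ _).trans ?_⟩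
  rw [mul_assoc, ← mul_pow]
  gcongr
  · exact le_abs_self C
  · exact norm_post_le α ξ ξs

lemma polyPair_postStar {ψ : E3 → ℝ} {C : ℝ} {n : ℕ} (hψ : ∀ ξ, |ψ ξ| ≤ C * (1 + ‖ξ‖) ^ n) :
    PolyPair fun α ξ ξs => ψ (postStar α ξ ξs) := by
  refine ⟨|C| * 2 ^ n, n, by positivity, fun α ξ ξs => (hψ _).trans ?_⟩
  rw [mul_assoc, ← mul_pow]
  gcongr
  · exact le_abs_self C
  · exact norm_postStar_le α ξ ξs

lemma PolyPair.mul_vplus {Θ : S2 → E3 → E3 → ℝ} (h : PolyPair Θ) :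
    PolyPair fun α ξ ξs => Θ α ξ ξs * vplus α ξ ξs := by
  obtain ⟨C, n, hC0, hC⟩ := h
  refine ⟨C, n + 1, hC0, fun α ξ ξs => ?_⟩
  rw [abs_mul, pow_succ, ← mul_assoc]
  exact mul_le_mul (hC _ _ _) (abs_vplus_le _ _ _) (abs_nonneg _) (by positivity)

/-- Rapid decay of a product of two distribution functions. -/
lemma Rapid.pair {A : Set E3} {F : E3 → E3 → ℝ} (hF : Rapid A F) (n : ℕ) :
    ∃ C : ℝ, 0 ≤ C ∧ ∀ X ∈ A, ∀ Y ∈ A, ∀ ξ ξs,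
      |F X ξ * F Y ξs| * ((1 + ‖ξ‖) * (1 + ‖ξs‖)) ^ n ≤ C * (wt ξ * wt ξs) := by
  -- Here `n` powers pay for the polynomial factor and four for the integrable weight.
  obtain ⟨C, hC⟩ := hF (n + 4)
  have key : ∀ X ∈ A, ∀ ξ, |F X ξ| * (1 + ‖ξ‖) ^ n ≤ |C| * wt ξ := fun X hX ξ => by
    rw [wt, ← div_eq_mul_inv, le_div_iff₀ (by positivity)]
    calc _ = (1 + ‖ξ‖) ^ (n + 4) * |F X ξ| := by ring
      _ ≤ C := hC X hX ξ
      _ ≤ _ := le_abs_self _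
  refine ⟨|C| * |C|, by positivity, fun X hX Y hY ξ ξs => ?_⟩
  calc _ = (|F X ξ| * (1 + ‖ξ‖) ^ n) * (|F Y ξs| * (1 + ‖ξs‖) ^ n) := by
        rw [abs_mul, mul_pow]; ring
    _ ≤ (|C| * wt ξ) * (|C| * wt ξs) :=
        mul_le_mul (key X hX ξ) (key Y hY ξs) (by positivity)
          (mul_nonneg (abs_nonneg _) (wt_pos _).le)
    _ = _ := by ring

lemma PolyPair.mul_pair {A : Set E3} {F : E3 → E3 → ℝ} (hF : Rapid A F) {Θ : S2 → E3 → E3 → ℝ}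
    (hΘ : PolyPair Θ) : ∃ C : ℝ, 0 ≤ C ∧ ∀ X ∈ A, ∀ Y ∈ A, ∀ (α : S2) (ξ ξs : E3),
      |F X ξ * F Y ξs * Θ α ξ ξs| ≤ C * (wt ξ * wt ξs) := by
  obtain ⟨C, n, hC0, hC⟩ := hΘ
  obtain ⟨B, hB0, hB⟩ := hF.pair n
  refine ⟨B * C, by positivity, fun X hX Y hY α ξ ξs => ?_⟩
  calc |F X ξ * F Y ξs * Θ α ξ ξs| ≤ |F X ξ * F Y ξs| * (C * ((1 + ‖ξ‖) * (1 + ‖ξs‖)) ^ n) := by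
        rw [abs_mul (F X ξ * F Y ξs)]
        exact mul_le_mul_of_nonneg_left (hC _ _ _) (abs_nonneg _)
    _ = (|F X ξ * F Y ξs| * ((1 + ‖ξ‖) * (1 + ‖ξs‖)) ^ n) * C := by ring
    _ ≤ (B * (wt ξ * wt ξs)) * C := by exact mul_le_mul_of_nonneg_right (hB X hX Y hY ξ ξs) hC0
    _ = _ := by ring

end Velocity

namespace Slice

variable {m σ : ℝ} {S : ℝ → ℝ} {b : EReal} {D : Set E3} {F G : E3 → E3 → ℝ}
  (h : Slice m σ S b D F G)

include h

/-- Integrability of collision integrands of polynomial growth relative to `f f_*`. -/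
lemma integrable_coll (c : ℝ) (X : E3) {Θ : S2 → E3 → E3 → ℝ}
    (hΘm : Measurable fun q : S2 × (E3 × E3) => Θ q.1 q.2.1 q.2.2) (hΘ : PolyPair Θ) :
    Integrable (fun q : S2 × (E3 × E3) => cutFactor m σ S D F X (X + c • (q.1 : E3)) *
      (F X q.2.1 * F (X + c • (q.1 : E3)) q.2.2 * Θ q.1 q.2.1 q.2.2)) collMeasure := by
  obtain ⟨C, hC0, hC⟩ := hΘ.mul_pair (h.rapid (‖X‖ + |c| + 1))
  obtain ⟨B, hB0, hB⟩ := h.cutFactor_bdd (‖X‖ + |c|)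
  have hcd := continuous_dir
  have hFm := h.measurable_uncurry
  refine (integrable_wt_coll.const_mul (B * C)).mono' ?_ (ae_of_all _ fun q => ?_)
  · refine Measurable.aestronglyMeasurable (Measurable.mul ?_ (Measurable.mul (Measurable.mul ?_ ?_) hΘm))
    · exact h.measurable_cutFactor.comp
        (f := fun q : S2 × (E3 × E3) => (X, X + c • (q.1 : E3))) (Continuous.measurable (by fun_prop))
    · exact hFm.comp (f := fun q : S2 × (E3 × E3) => (X, q.2.1)) (by fun_prop)
    · exact hFm.comp (f := fun q : S2 × (E3 × E3) => (X + c • (q.1 : E3), q.2.2))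
        (Continuous.measurable (by fun_prop))
  · have hn := norm_add_smul_dir_le X c q.1
    by_cases hX : X ∈ D ∧ X + c • (q.1 : E3) ∈ D
    · rw [norm_mul, mul_assoc B C]
      refine mul_le_mul (hB _ _ (by linarith [abs_nonneg c]) hn) (hC X ⟨hX.1, ?_⟩ _ ⟨hX.2, ?_⟩ _ _ _)
        (norm_nonneg _) hB0
      · rw [mem_ball_zero_iff]; linarith [abs_nonneg c]
      · rw [mem_ball_zero_iff]; linarith
    · rw [cutFactor_of_notMem (by tauto), zero_mul, norm_zero]
      have := wt_pos q.2.1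
      have := wt_pos q.2.2
      positivity

end Slice

lemma cutFactor_comm (m σ : ℝ) (S : ℝ → ℝ) (D : Set E3) (F : E3 → E3 → ℝ) (X Y : E3) :
    cutFactor m σ S D F X Y = cutFactor m σ S D F Y X := by
  simp only [cutFactor, enskogFactor]; ring

/-! ### Weak form of the collision operator -/

namespace Slice

variable {m σ : ℝ} {S : ℝ → ℝ} {b : EReal} {D : Set E3} {F G : E3 → E3 → ℝ}
  (h : Slice m σ S b D F G)

include h

lemma integrable_coll_sub (X : E3) {Θ : S2 → E3 → E3 → ℝ}
    (hΘm : Measurable fun q : S2 × (E3 × E3) => Θ q.1 q.2.1 q.2.2) (hΘ : PolyPair Θ) :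
    Integrable (fun q : S2 × (E3 × E3) => cutFactor m σ S D F X (X - σ • (q.1 : E3)) *
      (F X q.2.1 * F (X - σ • (q.1 : E3)) q.2.2 * Θ q.1 q.2.1 q.2.2)) collMeasure := by
  have := h.integrable_coll (-σ) X hΘm hΘ
  simpa only [neg_smul, ← sub_eq_add_neg] using this

/-- Weak form of the collision operator at a point. -/
lemma weak_collision {X : E3} {ψ : E3 → ℝ} (hψm : Measurable ψ) {C : ℝ} {n : ℕ}
    (hψ : ∀ ξ, |ψ ξ| ≤ C * (1 + ‖ξ‖) ^ n) :
    ∫ ξ, ψ ξ * collision m σ S D F X ξ = (σ ^ 2 / m) * ∫ q : S2 × (E3 × E3),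
      cutFactor m σ S D F X (X - σ • (q.1 : E3)) * (F X q.2.1 * F (X - σ • (q.1 : E3)) q.2.2 *
        ((ψ (post q.1 q.2.1 q.2.2) - ψ q.2.1) * vplus q.1 q.2.1 q.2.2)) ∂collMeasure := by
  have hvm := continuous_vplus.measurable
  have hI1 := h.integrable_coll_sub X (Θ := fun α ξ ξs => ψ (post α ξ ξs) * vplus α ξ ξs)
    ((hψm.comp continuous_post.measurable).mul hvm) (polyPair_post hψ).mul_vplus
  have hI2 := h.integrable_coll_sub X (Θ := fun α ξ ξs => ψ ξ * vplus α ξ ξs)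
    ((hψm.comp (by fun_prop)).mul hvm) (polyPair_fst hψ).mul_vplus
  -- the loss term
  set kl : S2 → E3 → E3 → ℝ := fun α ξ ξs => ψ ξ * (cutFactor m σ S D F (X - σ • (α : E3)) X
      * F (X - σ • (α : E3)) ξs * F X ξ * (relVel α ξ ξs * heaviside (relVel α ξ ξs))) with hkl
  have hl1 : ∀ q : S2 × (E3 × E3), kl q.1 q.2.1 q.2.2 = cutFactor m σ S D F X (X - σ • (q.1 : E3)) *
      (F X q.2.1 * F (X - σ • (q.1 : E3)) q.2.2 * (ψ q.2.1 * vplus q.1 q.2.1 q.2.2)) := fun q => by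
    simp only [hkl, cutFactor_comm m σ S D F _ X, vplus]; ring
  have hlI : Integrable (fun q : S2 × (E3 × E3) => kl q.1 q.2.1 q.2.2) collMeasure := by
    simp_rw [hl1]; exact hI2
  have hl := integral_velocity_swap hlI
  have hloss : ∀ ξ, ψ ξ * loss m σ S D F X ξ
      = (σ ^ 2 / m) * ∫ α : S2, (∫ ξs : E3, kl α ξ ξs) ∂solidAngle := fun ξ => by
    simp only [hkl, loss, integral_const_mul]; ring
  -- the gain term
  set kg : S2 → E3 → E3 → ℝ := fun α ξ ξs => ψ ξ * (cutFactor m σ S D F (X + σ • (α : E3)) X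
      * F (X + σ • (α : E3)) (postStar α ξ ξs) * F X (post α ξ ξs)
      * (relVel α ξ ξs * heaviside (relVel α ξ ξs))) with hkg
  -- Under the inverse collision the gain integrand becomes one with weight f(X) f_*(X - σα), and
  -- the prime moves onto the test function. Gain and loss then carry the same weight and differ
  -- only by ψ' - ψ.
  have hg1 : ∀ q : S2 × (E3 × E3), kg q.1 q.2.1 q.2.2 =
      (fun q : S2 × (E3 × E3) => cutFactor m σ S D F X (X - σ • (q.1 : E3)) *
      (F X q.2.1 * F (X - σ • (q.1 : E3)) q.2.2 *
        (ψ (post q.1 q.2.1 q.2.2) * vplus q.1 q.2.1 q.2.2))) (collInv q) := fun q => by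
    simp only [hkg, collInv_apply, cutFactor_comm m σ S D F _ X]
    rw [show ((-q.1 : S2) : E3) = -(q.1 : E3) from rfl, post_neg, post_coll, smul_neg, sub_neg_eq_add,
      show vplus (-(q.1 : E3)) (post q.1 q.2.1 q.2.2) (postStar q.1 q.2.1 q.2.2)
        = relVel q.1 q.2.1 q.2.2 * heaviside (relVel q.1 q.2.1 q.2.2) by
          rw [vplus, relVel_neg, relVel_coll, neg_neg]]
    ring
  have hgI : Integrable (fun q : S2 × (E3 × E3) => kg q.1 q.2.1 q.2.2) collMeasure := by
    simp_rw [hg1]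
    exact measurePreserving_collInv.integrable_comp_of_integrable hI1
  have hg := integral_velocity_swap hgI
  have hgain : ∀ ξ, ψ ξ * gain m σ S D F X ξ
      = (σ ^ 2 / m) * ∫ α : S2, (∫ ξs : E3, kg α ξ ξs) ∂solidAngle := fun ξ => by
    simp only [hkg, gain, integral_const_mul]; ring
  have hg2 : ∫ q : S2 × (E3 × E3), kg q.1 q.2.1 q.2.2 ∂collMeasure
      = ∫ q : S2 × (E3 × E3), cutFactor m σ S D F X (X - σ • (q.1 : E3)) *
      (F X q.2.1 * F (X - σ • (q.1 : E3)) q.2.2 *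
        (ψ (post q.1 q.2.1 q.2.2) * vplus q.1 q.2.1 q.2.2)) ∂collMeasure := by
    rw [integral_congr_ae (ae_of_all _ hg1)]
    exact measurePreserving_collInv.integral_comp' (fun q : S2 × (E3 × E3) =>
      cutFactor m σ S D F X (X - σ • (q.1 : E3)) * (F X q.2.1 * F (X - σ • (q.1 : E3)) q.2.2 *
        (ψ (post q.1 q.2.1 q.2.2) * vplus q.1 q.2.1 q.2.2)))
  simp_rw [collision, mul_sub, hloss, hgain]
  rw [integral_sub (hg.1.const_mul _) (hl.1.const_mul _), integral_const_mul, integral_const_mul,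
    hg.2, hl.2, hg2, integral_congr_ae (ae_of_all _ hl1), ← mul_sub, ← integral_sub hI1 hI2]
  congr 2; ext q; ring

/-- Conservation of mass. -/
lemma rate_eq_neg_div {X : E3} (hX : X ∈ D) : ∫ ξ, G X ξ = - div (momentum F) X := by
  have h1 := h.weak_collision (X := X) (ψ := fun _ => 1) measurable_const (C := 1) (n := 0) (by simp)
  simp only [sub_self, zero_mul, mul_zero, integral_zero, one_mul] at h1
  simp_rw [← h.eqn X hX] at h1
  rw [integral_add (integrable_moment h.G_cont h.G_rapid hX) (h.div_momentum hX).1] at h1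
  rw [(h.div_momentum hX).2]; linarith

/-- The kinetic entropy balance at a point. -/
lemma entropyRate_add_div {X : E3} (hX : X ∈ D) :
    (∫ ξ, (1 + Real.log (F X ξ)) * G X ξ) + div (convectiveFlux F) X
      = (σ ^ 2 / m) * ∫ q : S2 × (E3 × E3),
      cutFactor m σ S D F X (X - σ • (q.1 : E3)) * (F X q.2.1 * F (X - σ • (q.1 : E3)) q.2.2 *
        ((Real.log (F X (post q.1 q.2.1 q.2.2)) - Real.log (F X q.2.1))
          * vplus q.1 q.2.1 q.2.2)) ∂collMeasure := by
  obtain ⟨C, n, hC⟩ := h.log1_poly (‖X‖ + 1)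
  have h1 := h.weak_collision (X := X) (ψ := fun ξ => 1 + Real.log (F X ξ))
    (continuous_const.add (continuous_slice h.log_cont hX)).measurable
    (fun ξ => hC X (mem_inter_ball hX) ξ)
  simp_rw [← h.eqn X hX, mul_add, add_sub_add_left_eq_sub] at h1
  rw [← h1, integral_add (integrable_moment h.entropyRate_cont h.entropyRate_rapid hX)
    (h.div_convectiveFlux hX).1, (h.div_convectiveFlux hX).2]

end Slice

/-! ### Two-point quantities and their averages over directions -/

/-- Two-point quantities that are continuous on `D × D` and vanish outside. -/
structure PairFn (D : Set E3) (W : S2 → E3 → E3 → ℝ) : Prop extends TwoPoint W where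
  zero : ∀ α Y Z, Y ∉ D ∨ Z ∉ D → W α Y Z = 0
  cont : ContinuousOn (fun q : S2 × E3 × E3 => W q.1 q.2.1 q.2.2) (univ ×ˢ D ×ˢ D)

/-- The average of a two-point quantity over the collision directions. -/
def pairAvg (σ : ℝ) (W : S2 → E3 → E3 → ℝ) (X : E3) : ℝ :=
  ∫ α : S2, W α X (X - σ • (α : E3)) ∂solidAngle

/-- Exchange of the two points of a two-point quantity. -/
def pairSwap (W : S2 → E3 → E3 → ℝ) (α : S2) (Y Z : E3) : ℝ := W (-α) Z Y

namespace TwoPoint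

variable {W W' : S2 → E3 → E3 → ℝ} (h : TwoPoint W) (h' : TwoPoint W')

include h in
lemma swap : TwoPoint (pairSwap W) := by
  refine ⟨?_, fun r => ?_⟩
  · exact h.meas.comp (f := fun q : S2 × E3 × E3 => (-q.1, q.2.2, q.2.1))
      (Continuous.measurable (by fun_prop))
  · obtain ⟨C, hC⟩ := h.bdd r
    exact ⟨C, fun α Y Z hY hZ => hC _ _ _ hZ hY⟩

include h in
lemma measurable_avg (σ : ℝ) :
    Measurable fun q : E3 × S2 => W q.2 q.1 (q.1 - σ • (q.2 : E3)) := by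
  have := continuous_dir
  exact h.meas.comp (f := fun q : E3 × S2 => (q.2, q.1, q.1 - σ • (q.2 : E3)))
    (Continuous.measurable (by fun_prop))

include h in
lemma exists_avg_bound (σ r : ℝ) : ∃ C : ℝ, ∀ X, ‖X‖ ≤ r → ∀ α : S2,
    ‖W α X (X - σ • (α : E3))‖ ≤ C := by
  obtain ⟨C, hC⟩ := h.bdd (r + |σ|)
  exact ⟨C, fun X hX α => hC _ _ _ (by linarith [abs_nonneg σ])
    ((norm_sub_smul_dir_le _ _ _).trans (by linarith))⟩

include h in
lemma integrable_avg (σ : ℝ) (X : E3) :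
    Integrable (fun α : S2 => W α X (X - σ • (α : E3))) solidAngle := by
  obtain ⟨C, hC⟩ := h.exists_avg_bound σ ‖X‖
  exact Integrable.of_bound (C := C)
    ((h.measurable_avg σ).comp measurable_prodMk_left).aestronglyMeasurable
    (ae_of_all _ fun α => hC X le_rfl α)

include h in
lemma pairAvg_locBdd (σ : ℝ) : LocBdd (pairAvg σ W) := by
  refine ⟨?_, fun r => ?_⟩
  · have : StronglyMeasurable (Function.uncurry fun (X : E3) (α : S2) =>
      W α X (X - σ • (α : E3))) := (h.measurable_avg σ).stronglyMeasurable
    exact this.integral_prod_right.measurable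
  · obtain ⟨C, hC⟩ := h.exists_avg_bound σ r
    exact ⟨C * solidAngle.real univ, fun X hX =>
      norm_integral_le_of_norm_le_const (ae_of_all _ fun α => hC X hX α)⟩

include h in
lemma sourceOf_eq (σ : ℝ) (X : E3) :
    sourceOf σ W X = pairAvg σ W X - pairAvg σ (pairSwap W) X := by
  have h2 : (fun α : S2 => W α (X + σ • (α : E3)) X)
      = fun α => pairSwap W (-α) X (X - σ • ((-α : S2) : E3)) := by
    funext α
    simp [pairSwap]
  have h3 := h.swap.integrable_avg σ X
  have h4 : Integrable (fun α : S2 => W α (X + σ • (α : E3)) X) solidAngle := by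
    rw [h2]
    exact measurePreserving_neg_solidAngle.integrable_comp_of_integrable h3
  rw [sourceOf, integral_sub (h.integrable_avg σ X) h4, h2]
  congr 1
  exact integral_neg_solidAngle (fun α => pairSwap W α X (X - σ • (α : E3)))

include h h' in
lemma sub : TwoPoint fun α Y Z => W α Y Z - W' α Y Z := by
  refine ⟨h.meas.sub h'.meas, fun r => ?_⟩
  obtain ⟨C, hC⟩ := h.bdd r
  obtain ⟨C', hC'⟩ := h'.bdd r
  exact ⟨C + C', fun α Y Z hY hZ => (abs_sub _ _).trans
    (add_le_add (hC α Y Z hY hZ) (hC' α Y Z hY hZ))⟩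

end TwoPoint

namespace PairFn

variable {D : Set E3} {W W' : S2 → E3 → E3 → ℝ} (h : PairFn D W) (h' : PairFn D W')

include h in
lemma swap : PairFn D (pairSwap W) := by
  refine ⟨h.toTwoPoint.swap, fun α Y Z hYZ => h.zero _ _ _ hYZ.symm, ?_⟩
  exact h.cont.comp (f := fun q : S2 × E3 × E3 => (-q.1, q.2.2, q.2.1)) (by fun_prop)
    fun q hq => ⟨mem_univ _, hq.2.2, hq.2.1⟩

include h h' in
lemma sub : PairFn D fun α Y Z => W α Y Z - W' α Y Z :=
  ⟨h.toTwoPoint.sub h'.toTwoPoint, fun α Y Z hYZ => by rw [h.zero α Y Z hYZ, h'.zero α Y Z hYZ, sub_zero],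
    h.cont.sub h'.cont⟩

include h in
/-- Averages of two-point quantities are continuous at points seeing the boundary in a null set of
directions. -/
lemma continuousAt_pairAvg (hD : IsOpen D) {σ : ℝ} {X : E3} (hX : X ∈ D)
    (hnull : solidAngle {α : S2 | X + σ • (α : E3) ∈ frontier D} = 0) :
    ContinuousAt (pairAvg σ W) X := by
  obtain ⟨C, hC⟩ := h.exists_avg_bound σ (‖X‖ + 1)
  have hball : ∀ᶠ Y in 𝓝 X, ‖Y‖ ≤ ‖X‖ + 1 := by
    filter_upwards [ball_mem_nhds X one_pos] with Y hY
    rw [mem_ball_iff_norm] at hY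
    linarith [norm_le_norm_add_norm_sub' Y X]
  have hae : ∀ᵐ α : S2 ∂solidAngle, X - σ • (α : E3) ∉ frontier D := by
    have h1 : ∀ᵐ α : S2 ∂solidAngle, X + σ • (α : E3) ∉ frontier D :=
      measure_eq_zero_iff_ae_notMem.1 hnull
    have h2 := measurePreserving_neg_solidAngle.quasiMeasurePreserving.ae h1
    filter_upwards [h2] with α hα
    simpa [sub_eq_add_neg] using hα
  refine continuousAt_of_dominated (bound := fun _ => C) ?_ ?_ (integrable_const C) ?_
  · exact Eventually.of_forall fun Y => (h.integrable_avg σ Y).aestronglyMeasurable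
  · filter_upwards [hball] with Y hY using ae_of_all _ fun α => hC Y hY α
  · filter_upwards [hae] with α hα
    have hshift : ContinuousAt (fun Y : E3 => Y - σ • (α : E3)) X := by fun_prop
    -- Away from the null set of boundary directions, `X - σα` is either in `D`, where `W` is
    -- continuous, or off the closure of `D`, where `W` vanishes nearby.
    by_cases hin : X - σ • (α : E3) ∈ D
    · have h1 : ContinuousAt (fun q : S2 × E3 × E3 => W q.1 q.2.1 q.2.2)
          (α, X, X - σ • (α : E3)) := h.cont.continuousAt
        ((isOpen_univ.prod (hD.prod hD)).mem_nhds ⟨mem_univ _, hX, hin⟩)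
      exact h1.comp (f := fun Y : E3 => (α, Y, Y - σ • (α : E3))) (by fun_prop)
    · have hcl : X - σ • (α : E3) ∉ closure D := fun hc => hα ⟨hc, by rwa [hD.interior_eq]⟩
      refine (continuousAt_const (y := (0 : ℝ))).congr ?_
      filter_upwards [hshift.eventually (isClosed_closure.isOpen_compl.mem_nhds hcl)] with Y hY
      exact (h.zero _ _ _ (Or.inr fun hYD => hY (subset_closure hYD))).symm

include h in
/-- A nonnegative two-point quantity with vanishing average vanishes in all directions. -/
lemma eq_zero_of_pairAvg_eq_zero (hD : IsOpen D) (h0 : ∀ α Y Z, 0 ≤ W α Y Z) {σ : ℝ} {X : E3}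
    (hX : X ∈ D) (hav : pairAvg σ W X = 0) (α : S2) : W α X (X - σ • (α : E3)) = 0 := by
  by_cases hin : X - σ • (α : E3) ∈ D
  · by_contra hne
    have hae := (integral_eq_zero_iff_of_nonneg (fun α => h0 _ _ _) (h.integrable_avg σ X)).1 hav
    have hcd := continuous_dir
    have h1 : ContinuousAt (fun q : S2 × E3 × E3 => W q.1 q.2.1 q.2.2)
        (α, X, X - σ • (α : E3)) := h.cont.continuousAt
      ((isOpen_univ.prod (hD.prod hD)).mem_nhds ⟨mem_univ _, hX, hin⟩)
    have h2 : ContinuousAt (fun β : S2 => W β X (X - σ • (β : E3))) α :=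
      h1.comp (f := fun β : S2 => (β, X, X - σ • (β : E3)))
        (Continuous.continuousAt (by fun_prop))
    exact (Measure.measure_pos_of_mem_nhds solidAngle (h2.eventually_ne hne)).ne' hae
  · exact h.zero _ _ _ (Or.inr hin)

end PairFn

lemma continuousOn_integral_pair {Q : Type*} [TopologicalSpace Q] [FirstCountableTopology Q]
    {K : Q → E3 × E3 → ℝ} {A : Set Q} {bd : E3 × E3 → ℝ} (h1 : ∀ q ∈ A, Continuous (K q))
    (h2 : ∀ q ∈ A, ∀ p, ‖K q p‖ ≤ bd p) (hb : Integrable bd)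
    (h3 : ∀ p, ContinuousOn (fun q => K q p) A) : ContinuousOn (fun q => ∫ p, K q p) A :=
  continuousOn_of_dominated (fun q hq => (h1 q hq).aestronglyMeasurable)
    (fun q hq => ae_of_all _ (h2 q hq)) hb (ae_of_all _ h3)

/-- The collisional transfer of `⟨f ln f⟩` between two points. -/
def kinPair (m σ : ℝ) (S : ℝ → ℝ) (D : Set E3) (F : E3 → E3 → ℝ) (α : S2) (Y Z : E3) : ℝ :=
  cutFactor m σ S D F Y Z * ∫ p : E3 × E3, F Y p.1 * F Z p.2 *
    ((Real.log (F Y (post α p.1 p.2)) - Real.log (F Y p.1)) * vplus α p.1 p.2)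

/-- The flux density of the collisional entropy. -/
def flowPair (m σ : ℝ) (S : ℝ → ℝ) (D : Set E3) (F : E3 → E3 → ℝ) (α : S2) (Y Z : E3) : ℝ :=
  D.indicator (fun X => S (crowding m σ D F X)) Y *
    inner ℝ (density F Z • momentum F Y - density F Y • momentum F Z) (α : E3)

/-- The two-point form of the exchange term. -/
def exchPair (m σ : ℝ) (S : ℝ → ℝ) (D : Set E3) (F : E3 → E3 → ℝ) (α : S2) (Y Z : E3) : ℝ :=
  cutFactor m σ S D F Y Z * ∫ p : E3 × E3,
    (F Z (postStar α p.1 p.2) * F Y (post α p.1 p.2) - F Y p.1 * F Z p.2) * vplus α p.1 p.2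

/-- The two-point form of the entropy production. -/
def prodPair (m σ : ℝ) (S : ℝ → ℝ) (D : Set E3) (F : E3 → E3 → ℝ) (α : S2) (Y Z : E3) : ℝ :=
  exchPair m σ S D F α Y Z - kinPair m σ S D F α Y Z - pairSwap (kinPair m σ S D F) α Y Z

namespace Slice

variable {m σ : ℝ} {S : ℝ → ℝ} {b : EReal} {D : Set E3} {F G : E3 → E3 → ℝ}
  (h : Slice m σ S b D F G)

include h

lemma measurable_F {A : Type*} [MeasurableSpace A] {y x : A → E3} (hy : Measurable y)
    (hx : Measurable x) : Measurable fun a => F (y a) (x a) :=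
  h.measurable_uncurry.comp (hy.prodMk hx)

/-- The integrand of `kinPair` is dominated uniformly on bounded sets. -/
lemma kin_bound (r : ℝ) : ∃ C : ℝ, 0 ≤ C ∧ ∀ Y ∈ D ∩ ball (0 : E3) r, ∀ Z ∈ D ∩ ball (0 : E3) r,
    ∀ (α : S2) (p : E3 × E3), |F Y p.1 * F Z p.2 *
    ((Real.log (F Y (post α p.1 p.2)) - Real.log (F Y p.1)) * vplus α p.1 p.2)|
      ≤ C * (wt p.1 * wt p.2) := by
  obtain ⟨C, n, hC⟩ := h.log_poly r
  have hψ : ∀ ξ : E3, |(|C| * (1 + ‖ξ‖) ^ n)| ≤ |C| * (1 + ‖ξ‖) ^ n := fun ξ =>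
    (abs_of_nonneg (by positivity)).le
  -- The sign turns the bound for a difference into one for the sum of the two majorants of the
  -- logarithms.
  have hψ' : ∀ ξ : E3, |-(|C| * (1 + ‖ξ‖) ^ n)| ≤ |C| * (1 + ‖ξ‖) ^ n := fun ξ => by
    rw [abs_neg]; exact hψ ξ
  obtain ⟨B, hB0, hB⟩ := (((polyPair_post hψ).sub (polyPair_fst hψ')).mul_vplus).mul_pair (h.rapid r)
  refine ⟨B, hB0, fun Y hY Z hZ α p => le_trans ?_ (hB Y hY Z hZ α p.1 p.2)⟩
  have hl : ∀ ξ, |Real.log (F Y ξ)| ≤ |C| * (1 + ‖ξ‖) ^ n := fun ξ =>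
    (hC Y hY ξ).trans (by gcongr; exact le_abs_self C)
  rw [abs_mul, abs_mul (F Y p.1 * F Z p.2) (_ * _)]
  refine mul_le_mul_of_nonneg_left ?_ (abs_nonneg _)
  rw [abs_mul, abs_mul _ (vplus _ _ _)]
  refine mul_le_mul_of_nonneg_right ?_ (abs_nonneg _)
  refine (abs_sub _ _).trans ((add_le_add (hl _) (hl _)).trans ?_)
  rw [sub_neg_eq_add]
  exact le_abs_self _

lemma measurable_kin_comp {A : Type*} [MeasurableSpace A] {y z x xs xp : A → E3} {v : A → ℝ}
    (hy : Measurable y) (hz : Measurable z) (hx : Measurable x) (hxs : Measurable xs)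
    (hxp : Measurable xp) (hv : Measurable v) :
    Measurable fun a => F (y a) (x a) * F (z a) (xs a) *
      ((Real.log (F (y a) (xp a)) - Real.log (F (y a) (x a))) * v a) :=
  ((h.measurable_F hy hx).mul (h.measurable_F hz hxs)).mul
    (((h.measurable_F hy hxp).log.sub (h.measurable_F hy hx).log).mul hv)

lemma measurable_kin_integrand :
    Measurable fun w : (S2 × E3 × E3) × (E3 × E3) => F w.1.2.1 w.2.1 * F w.1.2.2 w.2.2 *
      ((Real.log (F w.1.2.1 (post w.1.1 w.2.1 w.2.2)) - Real.log (F w.1.2.1 w.2.1))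
        * vplus w.1.1 w.2.1 w.2.2) := by
  have hq : Measurable fun w : (S2 × E3 × E3) × (E3 × E3) => (w.1.1, w.2) :=
    (measurable_fst.comp measurable_fst).prodMk measurable_snd
  have hp := Measurable.comp continuous_post.measurable hq
  have hv := Measurable.comp continuous_vplus.measurable hq
  simp only [Function.comp_def] at hp hv
  exact h.measurable_kin_comp measurable_fst.snd.fst measurable_fst.snd.snd measurable_snd.fst
    measurable_snd.snd hp hv

lemma measurable_kinPair : Measurable fun q : S2 × E3 × E3 => kinPair m σ S D F q.1 q.2.1 q.2.2 := by
  have hcut : Measurable fun q : S2 × E3 × E3 => cutFactor m σ S D F q.2.1 q.2.2 :=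
    Measurable.comp h.measurable_cutFactor measurable_snd
  exact hcut.mul h.measurable_kin_integrand.stronglyMeasurable.integral_prod_right'.measurable

lemma kinPair_bdd (r : ℝ) :
    ∃ C : ℝ, ∀ α Y Z, ‖Y‖ ≤ r → ‖Z‖ ≤ r → |kinPair m σ S D F α Y Z| ≤ C := by
  obtain ⟨C, hC0, hC⟩ := h.kin_bound (r + 1)
  obtain ⟨B, hB0, hB⟩ := h.cutFactor_bdd r
  refine ⟨B * ∫ p : E3 × E3, C * (wt p.1 * wt p.2), fun α Y Z hY hZ => ?_⟩
  have hpos : 0 ≤ ∫ p : E3 × E3, C * (wt p.1 * wt p.2) := integral_nonneg fun p =>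
    mul_nonneg hC0 (mul_nonneg (wt_pos p.1).le (wt_pos p.2).le)
  by_cases hYZ : Y ∈ D ∧ Z ∈ D
  · rw [kinPair, abs_mul]
    refine mul_le_mul (hB Y Z hY hZ) ?_ (abs_nonneg _) hB0
    have hYb : Y ∈ D ∩ ball (0 : E3) (r + 1) := ⟨hYZ.1, by rw [mem_ball_zero_iff]; linarith⟩
    have hZb : Z ∈ D ∩ ball (0 : E3) (r + 1) := ⟨hYZ.2, by rw [mem_ball_zero_iff]; linarith⟩
    have hb := hC Y hYb Z hZb α
    simp only [← Real.norm_eq_abs] at hb ⊢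
    exact norm_integral_le_of_norm_le (integrable_wt_pair.const_mul C) (ae_of_all _ hb)
  · rw [kinPair, cutFactor_of_notMem (by tauto), zero_mul, abs_zero]
    positivity

lemma continuousOn_F {B : Type*} [TopologicalSpace B] {s : Set B} {y x : B → E3}
    (hy : ContinuousOn y s) (hx : ContinuousOn x s) (hin : ∀ a ∈ s, y a ∈ D) :
    ContinuousOn (fun a => F (y a) (x a)) s :=
  h.smooth.continuousOn.comp (hy.prodMk hx) fun a ha => ⟨hin a ha, mem_univ _⟩

lemma continuousOn_log {B : Type*} [TopologicalSpace B] {s : Set B} {y x : B → E3}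
    (hy : ContinuousOn y s) (hx : ContinuousOn x s) (hin : ∀ a ∈ s, y a ∈ D) :
    ContinuousOn (fun a => Real.log (F (y a) (x a))) s :=
  (h.continuousOn_F hy hx hin).log fun a ha => (h.pos _ (hin a ha) _).ne'

lemma continuousOn_cutFactor :
    ContinuousOn (fun q : S2 × E3 × E3 => cutFactor m σ S D F q.2.1 q.2.2)
      (univ ×ˢ D ×ˢ D) := by
  refine ContinuousOn.congr (f := fun q : S2 × E3 × E3 =>
    S (crowding m σ D F q.2.1) + S (crowding m σ D F q.2.2)) ?_
    fun q hq => cutFactor_of_mem hq.2.1 hq.2.2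
  exact (h.factor_continuousOn.comp (f := fun q : S2 × E3 × E3 => q.2.1)
    (continuous_snd.fst).continuousOn
    fun q hq => hq.2.1).add (h.factor_continuousOn.comp (f := fun q : S2 × E3 × E3 => q.2.2)
    (continuous_snd.snd).continuousOn fun q hq => hq.2.2)

lemma continuous_kin_integrand {Y Z : E3} (hY : Y ∈ D) (hZ : Z ∈ D) (α : S2) :
    Continuous fun p : E3 × E3 => F Y p.1 * F Z p.2 *
      ((Real.log (F Y (post α p.1 p.2)) - Real.log (F Y p.1)) * vplus α p.1 p.2) := by
  have hpostp : Continuous fun p : E3 × E3 => post α p.1 p.2 :=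
    continuous_post.comp (f := fun p : E3 × E3 => (α, p)) (by fun_prop)
  have hvp : Continuous fun p : E3 × E3 => vplus α p.1 p.2 :=
    continuous_vplus.comp (f := fun p : E3 × E3 => (α, p)) (by fun_prop)
  have hFY := continuous_slice h.smooth.continuousOn hY
  have hFZ := continuous_slice h.smooth.continuousOn hZ
  have hL := continuous_slice h.log_cont hY
  exact ((hFY.comp continuous_fst).mul (hFZ.comp continuous_snd)).mul
    (((hL.comp hpostp).sub (hL.comp continuous_fst)).mul hvp)

lemma continuousOn_kin_comp {A : Type*} [TopologicalSpace A] {s : Set A} {y z x xs xp : A → E3}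
    {v : A → ℝ} (hy : ContinuousOn y s) (hz : ContinuousOn z s) (hx : ContinuousOn x s)
    (hxs : ContinuousOn xs s) (hxp : ContinuousOn xp s) (hv : ContinuousOn v s)
    (hyD : ∀ a ∈ s, y a ∈ D) (hzD : ∀ a ∈ s, z a ∈ D) :
    ContinuousOn (fun a => F (y a) (x a) * F (z a) (xs a) *
      ((Real.log (F (y a) (xp a)) - Real.log (F (y a) (x a))) * v a)) s :=
  ((h.continuousOn_F hy hx hyD).mul (h.continuousOn_F hz hxs hzD)).mul
    (((h.continuousOn_log hy hxp hyD).sub (h.continuousOn_log hy hx hyD)).mul hv)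

lemma continuousOn_kin_param (p : E3 × E3) {A B : Set E3} (hA : A ⊆ D) (hB : B ⊆ D) :
    ContinuousOn (fun q : S2 × E3 × E3 => F q.2.1 p.1 * F q.2.2 p.2 *
        ((Real.log (F q.2.1 (post q.1 p.1 p.2)) - Real.log (F q.2.1 p.1)) * vplus q.1 p.1 p.2))
        (univ ×ˢ A ×ˢ B) := by
  have hpc : Continuous fun q : S2 × E3 × E3 => (q.1, p) := by fun_prop
  have hp := continuous_post.comp hpc
  have hv := continuous_vplus.comp hpc
  simp only [Function.comp_def] at hp hv
  have h1 : Continuous fun q : S2 × E3 × E3 => q.2.1 := continuous_snd.fst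
  have h2 : Continuous fun q : S2 × E3 × E3 => q.2.2 := continuous_snd.snd
  have h3 : Continuous fun _ : S2 × E3 × E3 => p.1 := continuous_const
  have h4 : Continuous fun _ : S2 × E3 × E3 => p.2 := continuous_const
  exact h.continuousOn_kin_comp h1.continuousOn h2.continuousOn h3.continuousOn h4.continuousOn
    hp.continuousOn hv.continuousOn (fun q hq => hA hq.2.1) (fun q hq => hB hq.2.2)

lemma continuousOn_kin_integral (r : ℝ) :
    ContinuousOn (fun q : S2 × E3 × E3 => ∫ p : E3 × E3, F q.2.1 p.1 * F q.2.2 p.2 *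
        ((Real.log (F q.2.1 (post q.1 p.1 p.2)) - Real.log (F q.2.1 p.1)) * vplus q.1 p.1 p.2))
        (univ ×ˢ (D ∩ ball (0 : E3) r) ×ˢ (D ∩ ball (0 : E3) r)) := by
  obtain ⟨C, hC0, hC⟩ := h.kin_bound r
  have h1 := fun (q : S2 × E3 × E3) (hq : q ∈ (univ : Set S2) ×ˢ (D ∩ ball (0 : E3) r) ×ˢ
    (D ∩ ball (0 : E3) r)) => h.continuous_kin_integrand hq.2.1.1 hq.2.2.1 q.1
  have h2 := fun (q : S2 × E3 × E3) (hq : q ∈ (univ : Set S2) ×ˢ (D ∩ ball (0 : E3) r) ×ˢ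
    (D ∩ ball (0 : E3) r)) => hC _ hq.2.1 _ hq.2.2 q.1
  exact continuousOn_integral_pair h1 h2 (integrable_wt_pair.const_mul C)
    (fun p => h.continuousOn_kin_param p inter_subset_left inter_subset_left)

/-- The velocity integral is dominated uniformly only on bounded sets, so continuity is obtained on
balls about the given pair of points. -/
lemma kinPair_pairFn : PairFn D (kinPair m σ S D F) := by
  refine ⟨⟨h.measurable_kinPair, h.kinPair_bdd⟩,
    fun α Y Z hYZ => by rw [kinPair, cutFactor_of_notMem hYZ, zero_mul],
    h.continuousOn_cutFactor.mul fun q hq => ?_⟩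
  have hqA : q ∈ (univ : Set S2) ×ˢ (D ∩ ball (0 : E3) (max ‖q.2.1‖ ‖q.2.2‖ + 1)) ×ˢ
      (D ∩ ball (0 : E3) (max ‖q.2.1‖ ‖q.2.2‖ + 1)) := by
    refine ⟨mem_univ _, ⟨hq.2.1, ?_⟩, ⟨hq.2.2, ?_⟩⟩
    · rw [mem_ball_zero_iff]; linarith [le_max_left ‖q.2.1‖ ‖q.2.2‖]
    · rw [mem_ball_zero_iff]; linarith [le_max_right ‖q.2.1‖ ‖q.2.2‖]
  have hAo : IsOpen (D ∩ ball (0 : E3) (max ‖q.2.1‖ ‖q.2.2‖ + 1)) := h.hD.inter isOpen_ball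
  exact ((h.continuousOn_kin_integral _).continuousAt
    ((isOpen_univ.prod (hAo.prod hAo)).mem_nhds hqA)).continuousWithinAt

lemma flowPair_pairFn : PairFn D (flowPair m σ S D F) := by
  have hcd := continuous_dir
  refine ⟨⟨?_, fun r => ?_⟩, fun α Y Z hYZ => ?_, ?_⟩
  · have h1 := h.indicator_factor_locBdd.meas
    have h2 := h.density_locBdd.meas
    have h3 := h.momentum_locBdd.meas
    have h4 := hcd.measurable
    unfold flowPair
    refine (h1.comp (by fun_prop)).mul (Measurable.inner ?_ (by fun_prop))
    fun_prop
  · obtain ⟨A, hA⟩ := h.indicator_factor_locBdd.bdd r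
    obtain ⟨B, hB⟩ := h.density_locBdd.bdd r
    obtain ⟨C, hC⟩ := h.momentum_locBdd.bdd r
    refine ⟨A * (B * C + B * C), fun α Y Z hY hZ => ?_⟩
    have hA0 := (norm_nonneg _).trans (hA Y hY)
    have hB0 := (norm_nonneg _).trans (hB Y hY)
    rw [flowPair, abs_mul]
    refine mul_le_mul (hA Y hY) ?_ (abs_nonneg _) hA0
    refine (abs_real_inner_le_norm _ _).trans ?_
    rw [norm_dir, mul_one]
    refine (norm_sub_le _ _).trans (add_le_add ?_ ?_) <;> rw [norm_smul]
    · exact mul_le_mul (hB Z hZ) (hC Y hY) (norm_nonneg _) hB0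
    · exact mul_le_mul (hB Y hY) (hC Z hZ) (norm_nonneg _) hB0
  · rcases hYZ with hY | hY <;> simp [flowPair, h.density_zero hY, h.momentum_zero hY]
  · have c1 : ContinuousOn (fun q : S2 × E3 × E3 => q.2.1) (univ ×ˢ D ×ˢ D) :=
      continuous_snd.fst.continuousOn
    have c2 : ContinuousOn (fun q : S2 × E3 × E3 => q.2.2) (univ ×ˢ D ×ˢ D) :=
      continuous_snd.snd.continuousOn
    have m1 : MapsTo (fun q : S2 × E3 × E3 => q.2.1) (univ ×ˢ D ×ˢ D) D := fun q hq => hq.2.1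
    have m2 : MapsTo (fun q : S2 × E3 × E3 => q.2.2) (univ ×ˢ D ×ˢ D) D := fun q hq => hq.2.2
    have hf : ContinuousOn (D.indicator fun X => S (crowding m σ D F X)) D :=
      h.factor_continuousOn.congr fun X hX => indicator_of_mem hX _
    have hd := h.density_contDiffOn.continuousOn
    have hj := h.momentum_contDiffOn.continuousOn
    exact (hf.comp c1 m1).mul ((((hd.comp c2 m2).smul (hj.comp c1 m1)).sub
      ((hd.comp c1 m1).smul (hj.comp c2 m2))).inner (hcd.comp continuous_fst).continuousOn)

end Slice

/-! ### The exchange term and the entropy inequality -/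

section Velocity

lemma continuous_post_pair (α : S2) : Continuous fun p : E3 × E3 => post α p.1 p.2 := by
  unfold post relVel; fun_prop

lemma continuous_postStar_pair (α : S2) : Continuous fun p : E3 × E3 => postStar α p.1 p.2 := by
  unfold postStar relVel; fun_prop

lemma continuous_relVel_pair (α : S2) : Continuous fun p : E3 × E3 => relVel α p.1 p.2 := by
  unfold relVel; fun_prop

lemma continuous_vplus_pair (α : S2) : Continuous fun p : E3 × E3 => vplus α p.1 p.2 := by
  simp only [vplus_eq]
  exact (continuous_relVel_pair α).max continuous_const

/-- The collision map as a measurable equivalence. -/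
def collEquiv (α : S2) : E3 × E3 ≃ᵐ E3 × E3 :=
  MeasurableEquiv.ofInvolutive (coll α) (coll_coll α)
    ((continuous_post_pair α).prodMk (continuous_postStar_pair α)).measurable

lemma measurePreserving_collEquiv (α : S2) : MeasurePreserving (collEquiv α) volume volume :=
  ⟨(collEquiv α).measurable, map_coll α⟩

lemma collEquiv_apply (α : S2) (p : E3 × E3) :
    collEquiv α p = (post α p.1 p.2, postStar α p.1 p.2) := rfl

lemma vplus_coll (α : S2) (ξ ξs : E3) :
    vplus α (post α ξ ξs) (postStar α ξ ξs) = max (-relVel α ξ ξs) 0 := by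
  rw [vplus_eq, relVel_coll]

lemma vplus_neg_swap (α ξ ξs : E3) : vplus (-α) ξs ξ = vplus α ξ ξs := by
  simp only [vplus, relVel_neg, relVel_swap α ξ ξs, neg_neg]

lemma polyPair_relVel : PolyPair fun α ξ ξs => relVel α ξ ξs :=
  ⟨1, 1, zero_le_one, fun α ξ ξs => by rw [pow_one, one_mul]; exact abs_relVel_le_mul α ξ ξs⟩

/-- At fixed `α` the collision map exchanges V⁺ and V⁻, so the gain is f f_* V⁻ in post-collisional
variables; V⁻ is written as V⁺ - V. -/
lemma pair_gain_eq (F : E3 → E3 → ℝ) (Y Z : E3) (α : S2) : (fun p : E3 × E3 =>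
    F Z (postStar α p.1 p.2) * F Y (post α p.1 p.2) * vplus α p.1 p.2)
      = (fun p : E3 × E3 => F Y p.1 * F Z p.2 * vplus α p.1 p.2
        - F Y p.1 * F Z p.2 * relVel α p.1 p.2) ∘ collEquiv α := by
  funext p
  have h1 := vplus_sub α p.1 p.2
  simp only [Function.comp, collEquiv_apply, vplus_coll, relVel_coll]
  linear_combination (F Z (postStar α p.1 p.2) * F Y (post α p.1 p.2)) * h1

/-- The elementary entropy inequality. -/
lemma sub_sub_mul_log_nonneg {a b : ℝ} (ha : 0 < a) (hb : 0 < b) :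
    0 ≤ b - a - a * (Real.log b - Real.log a) := by
  have h := Real.log_le_sub_one_of_pos (div_pos hb ha)
  rw [Real.log_div hb.ne' ha.ne'] at h
  have h2 := mul_le_mul_of_nonneg_left h ha.le
  have h3 : a * (b / a - 1) = b - a := by field_simp
  linarith

/-- The inequality ln x ≤ x - 1 is strict except at x = 1, here with x = b / a. -/
lemma eq_of_sub_sub_mul_log_eq_zero {a b : ℝ} (ha : 0 < a) (hb : 0 < b)
    (h0 : b - a - a * (Real.log b - Real.log a) = 0) : b = a := by
  by_contra hne
  have hba : b / a ≠ 1 := fun hc => hne (by rwa [div_eq_one_iff_eq ha.ne'] at hc)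
  have h := Real.log_lt_sub_one_of_pos (div_pos hb ha) hba
  rw [Real.log_div hb.ne' ha.ne'] at h
  have h2 := mul_lt_mul_of_pos_left h ha
  have h3 : a * (b / a - 1) = b - a := by field_simp
  linarith

end Velocity

/-- Relabelling the two molecules and reversing `α` leaves `V` unchanged and exchanges ξ' with ξ_*'.
The swapped transfer is the same collision seen from the second molecule, so that in K + Kˢ the
logarithms combine. -/
lemma pairSwap_kinPair (m σ : ℝ) (S : ℝ → ℝ) (D : Set E3) (F : E3 → E3 → ℝ) (Y Z : E3) (α : S2) : pairSwap (kinPair m σ S D F) α Y Z =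
    cutFactor m σ S D F Y Z * ∫ p : E3 × E3, F Y p.1 * F Z p.2 *
      ((Real.log (F Z (postStar α p.1 p.2)) - Real.log (F Z p.2)) * vplus α p.1 p.2) := by
  rw [pairSwap, kinPair, cutFactor_comm]
  congr 1
  have hs := (Measure.measurePreserving_swap (μ := (volume : Measure E3))
    (ν := (volume : Measure E3))).integral_comp
    (MeasurableEquiv.prodComm (α := E3) (β := E3)).measurableEmbedding
    (fun p : E3 × E3 => F Z p.1 * F Y p.2 *
      ((Real.log (F Z (post (-α : S2) p.1 p.2)) - Real.log (F Z p.1)) * vplus (-α : S2) p.1 p.2))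
  refine Eq.trans hs.symm (integral_congr_ae (ae_of_all _ fun p => ?_))
  simp only [Prod.fst_swap, Prod.snd_swap]
  rw [show ((-α : S2) : E3) = -(α : E3) from rfl, post_neg, post_swap, vplus_neg_swap]
  ring

namespace Slice

variable {m σ : ℝ} {S : ℝ → ℝ} {b : EReal} {D : Set E3} {F G : E3 → E3 → ℝ}
  (h : Slice m σ S b D F G)

include h

lemma continuous_slice_F {Y : E3} (hY : Y ∈ D) : Continuous (F Y) :=
  continuous_slice h.smooth.continuousOn hY

lemma integrable_pair {Y Z : E3} (hY : Y ∈ D) (hZ : Z ∈ D) (α : S2) {Θ : S2 → E3 → E3 → ℝ}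
    (hΘc : Continuous fun p : E3 × E3 => Θ α p.1 p.2) (hΘ : PolyPair Θ) :
    Integrable fun p : E3 × E3 => F Y p.1 * F Z p.2 * Θ α p.1 p.2 := by
  obtain ⟨C, hC0, hC⟩ := hΘ.mul_pair (h.rapid (max ‖Y‖ ‖Z‖ + 1))
  simp only [← Real.norm_eq_abs] at hC
  have hYb : Y ∈ D ∩ ball (0 : E3) (max ‖Y‖ ‖Z‖ + 1) :=
    ⟨hY, by rw [mem_ball_zero_iff]; linarith [le_max_left ‖Y‖ ‖Z‖]⟩
  have hZb : Z ∈ D ∩ ball (0 : E3) (max ‖Y‖ ‖Z‖ + 1) :=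
    ⟨hZ, by rw [mem_ball_zero_iff]; linarith [le_max_right ‖Y‖ ‖Z‖]⟩
  have hb := fun p : E3 × E3 => hC Y hYb Z hZb α p.1 p.2
  refine (integrable_wt_pair.const_mul C).mono' ?_ (ae_of_all _ hb)
  exact ((((h.continuous_slice_F hY).comp continuous_fst).mul
    ((h.continuous_slice_F hZ).comp continuous_snd)).mul hΘc).aestronglyMeasurable

lemma integrable_pair_vplus {Y Z : E3} (hY : Y ∈ D) (hZ : Z ∈ D) (α : S2) :
    Integrable fun p : E3 × E3 => F Y p.1 * F Z p.2 * vplus α p.1 p.2 := by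
  refine h.integrable_pair hY hZ α (Θ := fun α ξ ξs => vplus α ξ ξs) (continuous_vplus_pair α) ?_
  simpa using (polyPair_fst (ψ := fun _ => 1) (C := 1) (n := 0) (by simp)).mul_vplus

lemma integrable_pair_relVel {Y Z : E3} (hY : Y ∈ D) (hZ : Z ∈ D) (α : S2) :
    Integrable fun p : E3 × E3 => F Y p.1 * F Z p.2 * relVel α p.1 p.2 :=
  h.integrable_pair hY hZ α (Θ := fun α ξ ξs => relVel α ξ ξs) (continuous_relVel_pair α)
    polyPair_relVel

lemma integrable_pair_gain {Y Z : E3} (hY : Y ∈ D) (hZ : Z ∈ D) (α : S2) :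
    Integrable fun p : E3 × E3 =>
      F Z (postStar α p.1 p.2) * F Y (post α p.1 p.2) * vplus α p.1 p.2 := by
  rw [pair_gain_eq]
  exact (measurePreserving_collEquiv α).integrable_comp_of_integrable
    ((h.integrable_pair_vplus hY hZ α).sub (h.integrable_pair_relVel hY hZ α))

/-- `V` is linear in ξ_* - ξ, so the integral factorises into densities and momenta. -/
lemma integral_pair_relVel (Y Z : E3) (α : S2) :
    ∫ p : E3 × E3, F Y p.1 * F Z p.2 * relVel α p.1 p.2
      = inner ℝ (density F Y • momentum F Z - density F Z • momentum F Y) (α : E3) := by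
  have hm : ∀ W : E3, Integrable fun ξ => F W ξ * inner ℝ ξ (α : E3) := fun W => by
    have := (h.integrable_mom W).inner_const (𝕜 := ℝ) (α : E3)
    simpa [inner_smul_left] using this
  have hi : ∀ W : E3, ∫ ξ, F W ξ * inner ℝ ξ (α : E3) = inner ℝ (momentum F W) (α : E3) :=
    fun W => by
      have h1 := integral_inner (𝕜 := ℝ) (h.integrable_mom W) (α : E3)
      rw [real_inner_comm, momentum, ← h1]
      refine integral_congr_ae (ae_of_all _ fun ξ => ?_)
      simp [inner_smul_right, real_inner_comm]
  have i1 : Integrable fun p : E3 × E3 => F Y p.1 * (F Z p.2 * inner ℝ p.2 (α : E3)) :=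
    (h.integrable_F Y).mul_prod (hm Z)
  have i2 : Integrable fun p : E3 × E3 => (F Y p.1 * inner ℝ p.1 (α : E3)) * F Z p.2 :=
    (hm Y).mul_prod (h.integrable_F Z)
  have e1 : ∫ p : E3 × E3, F Y p.1 * (F Z p.2 * inner ℝ p.2 (α : E3))
      = density F Y * inner ℝ (momentum F Z) (α : E3) := by
    rw [← hi Z, density]
    exact integral_prod_mul (μ := volume) (ν := volume) (F Y) fun ξ => F Z ξ * inner ℝ ξ (α : E3)
  have e2 : ∫ p : E3 × E3, (F Y p.1 * inner ℝ p.1 (α : E3)) * F Z p.2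
      = inner ℝ (momentum F Y) (α : E3) * density F Z := by
    rw [← hi Y, density]
    exact integral_prod_mul (μ := volume) (ν := volume) (fun ξ => F Y ξ * inner ℝ ξ (α : E3)) (F Z)
  rw [inner_sub_left, inner_smul_left, inner_smul_left]
  simp only [conj_trivial]
  rw [← e1, mul_comm (density F Z), ← e2, ← integral_sub i1 i2]
  refine integral_congr_ae (ae_of_all _ fun p => ?_)
  simp only [relVel, inner_sub_left]; ring

/-- The collision change of variables turns gain minus loss into ∫ f f_* (V⁻ - V⁺) = -∫ f f_* V.
Only moments are left, which is why the kinetic exchange integral can match the balance of the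
collisional entropy. -/
lemma integral_pair_exchange {Y Z : E3} (hY : Y ∈ D) (hZ : Z ∈ D) (α : S2) :
    Integrable (fun p : E3 × E3 => (F Z (postStar α p.1 p.2) * F Y (post α p.1 p.2)
      - F Y p.1 * F Z p.2) * vplus α p.1 p.2) ∧
    ∫ p : E3 × E3, (F Z (postStar α p.1 p.2) * F Y (post α p.1 p.2)
      - F Y p.1 * F Z p.2) * vplus α p.1 p.2
      = inner ℝ (density F Z • momentum F Y - density F Y • momentum F Z) (α : E3) := by
  have hv := h.integrable_pair_vplus hY hZ α
  have hr := h.integrable_pair_relVel hY hZ α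
  have hg := h.integrable_pair_gain hY hZ α
  have he : ∫ p : E3 × E3, F Z (postStar α p.1 p.2) * F Y (post α p.1 p.2) * vplus α p.1 p.2
      = ∫ p : E3 × E3, (F Y p.1 * F Z p.2 * vplus α p.1 p.2
        - F Y p.1 * F Z p.2 * relVel α p.1 p.2) := by
    rw [pair_gain_eq]
    exact (measurePreserving_collEquiv α).integral_comp' (fun p : E3 × E3 =>
      F Y p.1 * F Z p.2 * vplus α p.1 p.2 - F Y p.1 * F Z p.2 * relVel α p.1 p.2)
  simp only [sub_mul]
  refine ⟨hg.sub hv, ?_⟩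
  rw [integral_sub hg hv, he, integral_sub hv hr, h.integral_pair_relVel]
  rw [← neg_sub (density F Y • momentum F Z), inner_neg_left]
  ring

/-- The moment expression is unchanged when the points are exchanged and `α` is reversed, while the
Enskog factor is a sum of one term per point. The additive structure of the factor is what makes the
two halves mirror images. -/
lemma exchPair_eq (α : S2) (Y Z : E3) : exchPair m σ S D F α Y Z
    = flowPair m σ S D F α Y Z + pairSwap (flowPair m σ S D F) α Y Z := by
  by_cases hYZ : Y ∈ D ∧ Z ∈ D
  · obtain ⟨hY, hZ⟩ := hYZ
    rw [exchPair, (h.integral_pair_exchange hY hZ α).2, cutFactor_of_mem hY hZ, flowPair, pairSwap,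
      flowPair, indicator_of_mem hY, indicator_of_mem hZ,
      show ((-α : S2) : E3) = -(α : E3) from rfl, inner_neg_right, ← inner_neg_left, neg_sub]
    ring
  · rw [exchPair, cutFactor_of_notMem (by tauto), zero_mul, pairSwap,
      h.flowPair_pairFn.zero _ _ _ (by tauto), h.flowPair_pairFn.zero _ _ _ (by tauto), add_zero]

lemma exchPair_pairFn : PairFn D (exchPair m σ S D F) := by
  -- The class is known to be stable under differences and swaps, so the sum a + b is written as a -
  -- (a - a - b).
  have h1 := h.flowPair_pairFn.sub
    ((h.flowPair_pairFn.sub h.flowPair_pairFn).sub h.flowPair_pairFn.swap)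
  have : (exchPair m σ S D F) = fun α Y Z => flowPair m σ S D F α Y Z -
      (flowPair m σ S D F α Y Z - flowPair m σ S D F α Y Z
        - pairSwap (flowPair m σ S D F) α Y Z) := by
    funext α Y Z
    rw [h.exchPair_eq]; ring
  rw [this]; exact h1

lemma prodPair_pairFn : PairFn D (prodPair m σ S D F) :=
  (h.exchPair_pairFn.sub h.kinPair_pairFn).sub h.kinPair_pairFn.swap

lemma exchange_eq {X : E3} : exchange m σ S D F X
    = σ ^ 2 / (2 * m) * pairAvg σ (exchPair m σ S D F) X := by
  rw [exchange, pairAvg]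
  congr 1
  refine integral_congr_ae (ae_of_all _ fun α => ?_)
  by_cases hYZ : X ∈ D ∧ X - σ • (α : E3) ∈ D
  · have hi := (h.integral_pair_exchange hYZ.1 hYZ.2 α).1
    have hp := integral_prod (μ := volume) (ν := volume) _ hi
    refine Eq.trans ?_ (congrArg (cutFactor m σ S D F X (X - σ • (α : E3)) * ·) hp.symm)
    simp only [mul_assoc, integral_const_mul]
    rfl
  · simp only [exchPair]
    rw [cutFactor_of_notMem (by tauto)]
    simp

lemma entropyRate_add_div_eq {X : E3} (hX : X ∈ D) :
    (∫ ξ, (1 + Real.log (F X ξ)) * G X ξ) + div (convectiveFlux F) X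
      = σ ^ 2 / m * pairAvg σ (kinPair m σ S D F) X := by
  obtain ⟨C, n, hC⟩ := h.log_poly (‖X‖ + 1)
  have hC' := hC X (mem_inter_ball hX)
  have hl := continuous_slice h.log_cont hX
  have hC'' : ∀ ξ, |-Real.log (F X ξ)| ≤ C * (1 + ‖ξ‖) ^ n := fun ξ => by
    rw [abs_neg]; exact hC' ξ
  have hI := h.integrable_coll_sub X (Θ := fun α ξ ξs =>
    (Real.log (F X (post α ξ ξs)) - Real.log (F X ξ)) * vplus α ξ ξs)
    (((hl.measurable.comp continuous_post.measurable).sub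
      (hl.measurable.comp (measurable_snd.fst))).mul continuous_vplus.measurable)
    ((polyPair_post hC').sub (polyPair_fst hC')).mul_vplus
  rw [h.entropyRate_add_div hX, integral_prod _ hI, pairAvg]
  simp only [kinPair, integral_const_mul]

/-- Adding K and its swap merges the logarithms into those of f' f'_* and f f_*, which gives the
form b - a - a ln(b/a) weighted by V⁺. -/
lemma prodPair_eq {Y Z : E3} (hY : Y ∈ D) (hZ : Z ∈ D) (α : S2) :
    Integrable (fun p : E3 × E3 =>
      (F Z (postStar α p.1 p.2) * F Y (post α p.1 p.2) - F Y p.1 * F Z p.2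
        - F Y p.1 * F Z p.2 * (Real.log (F Z (postStar α p.1 p.2) * F Y (post α p.1 p.2))
          - Real.log (F Y p.1 * F Z p.2))) * vplus α p.1 p.2) ∧
    prodPair m σ S D F α Y Z = cutFactor m σ S D F Y Z * ∫ p : E3 × E3,
      (F Z (postStar α p.1 p.2) * F Y (post α p.1 p.2) - F Y p.1 * F Z p.2
        - F Y p.1 * F Z p.2 * (Real.log (F Z (postStar α p.1 p.2) * F Y (post α p.1 p.2))
          - Real.log (F Y p.1 * F Z p.2))) * vplus α p.1 p.2 := by
  obtain ⟨C, n, hC⟩ := h.log_poly (‖Y‖ + 1)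
  have hCY := hC Y (mem_inter_ball hY)
  obtain ⟨B, k, hB⟩ := h.log_poly (‖Z‖ + 1)
  have hBZ := hB Z (mem_inter_ball hZ)
  have hlY := continuous_slice h.log_cont hY
  have hlZ := continuous_slice h.log_cont hZ
  have h1 := h.integrable_pair hY hZ α (Θ := fun α ξ ξs =>
    (Real.log (F Y (post α ξ ξs)) - Real.log (F Y ξ)) * vplus α ξ ξs)
    (((hlY.comp (continuous_post_pair α)).sub (hlY.comp continuous_fst)).mul
      (continuous_vplus_pair α)) ((polyPair_post hCY).sub (polyPair_fst hCY)).mul_vplus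
  have h2 := h.integrable_pair hY hZ α (Θ := fun α ξ ξs =>
    (Real.log (F Z (postStar α ξ ξs)) - Real.log (F Z ξs)) * vplus α ξ ξs)
    (((hlZ.comp (continuous_postStar_pair α)).sub (hlZ.comp continuous_snd)).mul
      (continuous_vplus_pair α)) ((polyPair_postStar hBZ).sub (polyPair_snd hBZ)).mul_vplus
  have h0 := (h.integral_pair_exchange hY hZ α).1
  have hpt : ∀ p : E3 × E3, (F Z (postStar α p.1 p.2) * F Y (post α p.1 p.2)
      - F Y p.1 * F Z p.2) * vplus α p.1 p.2
      - F Y p.1 * F Z p.2 * ((Real.log (F Y (post α p.1 p.2)) - Real.log (F Y p.1))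
        * vplus α p.1 p.2)
      - F Y p.1 * F Z p.2 * ((Real.log (F Z (postStar α p.1 p.2)) - Real.log (F Z p.2))
        * vplus α p.1 p.2) =
      (F Z (postStar α p.1 p.2) * F Y (post α p.1 p.2) - F Y p.1 * F Z p.2
        - F Y p.1 * F Z p.2 * (Real.log (F Z (postStar α p.1 p.2) * F Y (post α p.1 p.2))
          - Real.log (F Y p.1 * F Z p.2))) * vplus α p.1 p.2 := fun p => by
    rw [Real.log_mul (h.pos Z hZ _).ne' (h.pos Y hY _).ne',
      Real.log_mul (h.pos Y hY _).ne' (h.pos Z hZ _).ne']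
    ring
  refine ⟨((h0.sub h1).sub h2).congr (ae_of_all _ hpt), ?_⟩
  rw [prodPair, pairSwap_kinPair, exchPair, kinPair, ← mul_sub, ← mul_sub]
  congr 1
  have he := integral_sub (h0.sub h1) h2
  simp only [Pi.sub_apply] at he
  rw [integral_sub h0 h1] at he
  exact he.symm.trans (integral_congr_ae (ae_of_all _ hpt))

lemma prod_integrand_nonneg {Y Z : E3} (hY : Y ∈ D) (hZ : Z ∈ D) (α : S2) (p : E3 × E3) :
    0 ≤ (F Z (postStar α p.1 p.2) * F Y (post α p.1 p.2) - F Y p.1 * F Z p.2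
        - F Y p.1 * F Z p.2 * (Real.log (F Z (postStar α p.1 p.2) * F Y (post α p.1 p.2))
          - Real.log (F Y p.1 * F Z p.2))) * vplus α p.1 p.2 :=
  mul_nonneg (sub_sub_mul_log_nonneg (mul_pos (h.pos Y hY _) (h.pos Z hZ _))
    (mul_pos (h.pos Z hZ _) (h.pos Y hY _))) (vplus_nonneg _ _ _)

lemma prodPair_nonneg (α : S2) (Y Z : E3) : 0 ≤ prodPair m σ S D F α Y Z := by
  by_cases hYZ : Y ∈ D ∧ Z ∈ D
  · rw [(h.prodPair_eq hYZ.1 hYZ.2 α).2]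
    exact mul_nonneg (h.cutFactor_nonneg Y Z)
      (integral_nonneg fun p => h.prod_integrand_nonneg hYZ.1 hYZ.2 α p)
  · rw [h.prodPair_pairFn.zero _ _ _ (by tauto)]

/-- Vanishing of the entropy production between two points is detailed balance. -/
lemma prodPair_eq_zero_iff {Y Z : E3} (hY : Y ∈ D) (hZ : Z ∈ D) (α : S2)
    (hc : 0 < cutFactor m σ S D F Y Z) : prodPair m σ S D F α Y Z = 0 ↔
      ∀ ξ ξs : E3, F Z (postStar α ξ ξs) * F Y (post α ξ ξs) = F Y ξ * F Z ξs := by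
  rw [(h.prodPair_eq hY hZ α).2]
  constructor
  · intro h0 
    have h1 := (mul_eq_zero.1 h0).resolve_left hc.ne'
    have hFY := h.continuous_slice_F hY
    have hFZ := h.continuous_slice_F hZ
    have hp := continuous_post_pair α
    have hps := continuous_postStar_pair α
    have hb : Continuous fun p : E3 × E3 => F Z (postStar α p.1 p.2) * F Y (post α p.1 p.2) :=
      (hFZ.comp hps).mul (hFY.comp hp)
    have ha : Continuous fun p : E3 × E3 => F Y p.1 * F Z p.2 :=
      (hFY.comp continuous_fst).mul (hFZ.comp continuous_snd)
    have ha0 : ∀ p : E3 × E3, F Y p.1 * F Z p.2 ≠ 0 := fun p =>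
      (mul_pos (h.pos Y hY _) (h.pos Z hZ _)).ne'
    have hb0 : ∀ p : E3 × E3, F Z (postStar α p.1 p.2) * F Y (post α p.1 p.2) ≠ 0 := fun p =>
      (mul_pos (h.pos Z hZ _) (h.pos Y hY _)).ne'
    have hcont := (((hb.sub ha).sub (ha.mul ((hb.log hb0).sub (ha.log ha0)))).mul
      (continuous_vplus_pair α))
    have h2 := (integral_eq_zero_iff_of_nonneg (fun p => h.prod_integrand_nonneg hY hZ α p)
      (h.prodPair_eq hY hZ α |>.1)).1 h1
    have : (volume : Measure (E3 × E3)).IsOpenPosMeasure :=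
      inferInstanceAs ((volume : Measure E3).prod (volume : Measure E3)).IsOpenPosMeasure
    have h3 := Continuous.ae_eq_iff_eq (volume : Measure (E3 × E3)) hcont continuous_const |>.1 h2
    -- A continuous nonnegative integrand with zero integral vanishes identically, but the weight V⁺
    -- can be divided out only where V > 0.
    have h4 : ∀ ξ ξs : E3, 0 < relVel α ξ ξs →
        F Z (postStar α ξ ξs) * F Y (post α ξ ξs) = F Y ξ * F Z ξs := fun ξ ξs hV => by
      have h5 := congrFun h3 (ξ, ξs)
      have h6 : vplus α ξ ξs ≠ 0 := by rw [vplus_eq, max_eq_left hV.le]; exact hV.ne'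
      exact eq_of_sub_sub_mul_log_eq_zero (mul_pos (h.pos Y hY _) (h.pos Z hZ _))
        (mul_pos (h.pos Z hZ _) (h.pos Y hY _)) ((mul_eq_zero.1 h5).resolve_right h6)
    intro ξ ξs
    -- For V < 0 the inverse collision has V > 0 and yields the same identity read backwards; for V
    -- = 0 velocities do not change.
    rcases lt_trichotomy (relVel α ξ ξs) 0 with hV | hV | hV
    · have h7 := h4 (post α ξ ξs) (postStar α ξ ξs) (by rw [relVel_coll]; linarith)
      rw [post_coll, postStar_coll] at h7
      linarith
    · simp [post, postStar, hV, mul_comm]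
    · exact h4 ξ ξs hV
  · intro hdb
    simp [hdb]

/-- Where the cut-off factor vanishes, both sides hold trivially: detailed balance asks nothing and
the production carries the factor. -/
lemma detailedBalance_iff {X : E3} (hX : X ∈ D) : DetailedBalance m σ S D F X ↔
    ∀ α : S2, prodPair m σ S D F α X (X - σ • (α : E3)) = 0 := by
  refine forall_congr' fun α => ?_
  by_cases hY : X - σ • (α : E3) ∈ D
  · rcases (h.cutFactor_nonneg X (X - σ • (α : E3))).eq_or_lt with h0 | h0
    · simp only [← h0, lt_irrefl, IsEmpty.forall_iff, true_iff]
      rw [(h.prodPair_eq hX hY α).2, ← h0, zero_mul]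
    · simp only [h0, true_imp_iff]
      exact (h.prodPair_eq_zero_iff hX hY α h0).symm
  · have h1 := h.prodPair_pairFn.zero α X _ (Or.inr hY)
    have h2 : cutFactor m σ S D F X (X - σ • (α : E3)) = 0 := cutFactor_of_notMem (Or.inr hY)
    simp [h1, h2]

/-- Vanishing of the entropy production is detailed balance. -/
lemma pairAvg_prodPair_eq_zero_iff {X : E3} (hX : X ∈ D) :
    pairAvg σ (prodPair m σ S D F) X = 0 ↔ DetailedBalance m σ S D F X := by
  rw [h.detailedBalance_iff hX]
  refine ⟨fun h0 α => h.prodPair_pairFn.eq_zero_of_pairAvg_eq_zero h.hD h.prodPair_nonneg hX h0 α,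
    fun h0 => ?_⟩
  rw [pairAvg]
  simp [h0]

lemma pairAvg_prodPair_nonneg (X : E3) : 0 ≤ pairAvg σ (prodPair m σ S D F) X :=
  integral_nonneg fun _ => h.prodPair_nonneg _ _ _

/-- Detailed balance almost everywhere on an open set is detailed balance everywhere. -/
lemma detailedBalance_of_ae {U : Set E3} (hU : IsOpen U) (hUD : U ⊆ D)
    (hae : ∀ᵐ X ∂(volume.restrict U), pairAvg σ (prodPair m σ S D F) X = 0) :
    ∀ X ∈ U, DetailedBalance m σ S D F X := by
  intro X hX
  rw [h.detailedBalance_iff (hUD hX)]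
  intro α
  by_cases hY : X - σ • (α : E3) ∈ D
  · by_contra hne
    -- The averaged production need not be continuous in `X`, but the production in a fixed
    -- direction is. If it is nonzero at `X`, it is nonzero nearby, and then the average is nonzero
    -- on a set of positive measure.
    have h1 : ContinuousAt (fun q : S2 × E3 × E3 => prodPair m σ S D F q.1 q.2.1 q.2.2)
        (α, X, X - σ • (α : E3)) := h.prodPair_pairFn.cont.continuousAt
      ((isOpen_univ.prod (h.hD.prod h.hD)).mem_nhds ⟨mem_univ _, hUD hX, hY⟩)
    have h2 : ContinuousAt (fun Y : E3 => prodPair m σ S D F α Y (Y - σ • (α : E3))) X :=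
      h1.comp (f := fun Y : E3 => (α, Y, Y - σ • (α : E3))) (by fun_prop)
    have h3 : {Y : E3 | prodPair m σ S D F α Y (Y - σ • (α : E3)) ≠ 0} ∩ U ∈ 𝓝 X :=
      inter_mem (h2.eventually_ne hne) (hU.mem_nhds hX)
    have h4 := Measure.measure_pos_of_mem_nhds (volume : Measure E3) h3
    have h5 := (ae_restrict_iff' hU.measurableSet).1 hae
    refine h4.ne' (measure_mono_null (fun Y hYm => ?_) h5)
    simp only [mem_compl_iff, mem_ofPred_eq, not_forall]
    refine ⟨hYm.2, fun h0 => hYm.1 ?_⟩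
    exact h.prodPair_pairFn.eq_zero_of_pairAvg_eq_zero h.hD h.prodPair_nonneg (hUD hYm.2) h0 α
  · exact h.prodPair_pairFn.zero _ _ _ (Or.inr hY)

end Slice

lemma integral_pair_interval {k : E3 × E3 → ℝ → ℝ} (hk : Measurable (Function.uncurry k))
    {bd : E3 × E3 → ℝ} (hbd : Integrable bd) (hb : ∀ p, ∀ τ ∈ Ioc (0 : ℝ) 1, ‖k p τ‖ ≤ bd p) :
    ∫ ξ, ∫ ξs, ∫ τ in (0 : ℝ)..1, k (ξ, ξs) τ = ∫ τ in (0 : ℝ)..1, ∫ p, k p τ := by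
  have hi : Integrable (Function.uncurry k)
      ((volume : Measure (E3 × E3)).prod (volume.restrict (Ioc (0 : ℝ) 1))) := by
    have h1 : Integrable (fun q : (E3 × E3) × ℝ => bd q.1)
        ((volume : Measure (E3 × E3)).prod (volume.restrict (Ioc (0 : ℝ) 1))) := by
      simpa using hbd.mul_prod (integrable_const (1 : ℝ) (μ := volume.restrict (Ioc (0 : ℝ) 1)))
    refine h1.mono' hk.aestronglyMeasurable ?_
    have h2 : ∀ᵐ τ ∂(volume.restrict (Ioc (0 : ℝ) 1)), τ ∈ Ioc (0 : ℝ) 1 :=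
      ae_restrict_mem measurableSet_Ioc
    have h3 := (Measure.quasiMeasurePreserving_snd (μ := (volume : Measure (E3 × E3)))
      (ν := volume.restrict (Ioc (0 : ℝ) 1))).ae h2
    filter_upwards [h3] with q hq using hb q.1 q.2 hq
  simp only [intervalIntegral.integral_of_le zero_le_one]
  have h1 : Integrable (fun p : E3 × E3 => ∫ τ in Ioc (0 : ℝ) 1, k p τ)
      ((volume : Measure E3).prod volume) := hi.integral_prod_left
  rw [← integral_integral_swap hi]
  exact (integral_prod (μ := (volume : Measure E3)) (ν := volume) _ h1).symm

/-! ### The fluxes as fluxes of two-point quantities -/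

namespace Slice

variable {m σ : ℝ} {S : ℝ → ℝ} {b : EReal} {D : Set E3} {F G : E3 → E3 → ℝ}
  (h : Slice m σ S b D F G)

include h

/-- Fubini moves the `τ`-integral outside the velocity integrals. All points of the segment lie in
one ball, so the majorant is independent of `τ`. -/
lemma kin_integral_interval (α : S2) (X : E3) :
    ∫ ξ, ∫ ξs, ∫ τ in (0 : ℝ)..1,
      cutFactor m σ S D F (X + (τ * σ) • (α : E3)) (X + ((τ - 1) * σ) • (α : E3)) *
      (F (X + (τ * σ) • (α : E3)) ξ * F (X + ((τ - 1) * σ) • (α : E3)) ξs *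
        ((Real.log (F (X + (τ * σ) • (α : E3)) (post α ξ ξs))
          - Real.log (F (X + (τ * σ) • (α : E3)) ξ)) * vplus α ξ ξs))
    = ∫ τ in (0 : ℝ)..1, kinPair m σ S D F α (X + (τ * σ) • (α : E3))
        (X + ((τ - 1) * σ) • (α : E3)) := by
  obtain ⟨C, hC0, hC⟩ := h.kin_bound (‖X‖ + |σ| + 1)
  obtain ⟨B, hB0, hB⟩ := h.cutFactor_bdd (‖X‖ + |σ|)
  simp only [← Real.norm_eq_abs] at hC
  have hcy : Continuous fun q : (E3 × E3) × ℝ => X + (q.2 * σ) • (α : E3) := by fun_prop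
  have hcz : Continuous fun q : (E3 × E3) × ℝ => X + ((q.2 - 1) * σ) • (α : E3) := by fun_prop
  have hcut := h.measurable_cutFactor.comp (hcy.measurable.prodMk hcz.measurable)
  have hp := (continuous_post_pair α).measurable.comp
    (measurable_fst : Measurable fun q : (E3 × E3) × ℝ => q.1)
  have hv := (continuous_vplus_pair α).measurable.comp
    (measurable_fst : Measurable fun q : (E3 × E3) × ℝ => q.1)
  simp only [Function.comp_def] at hp hv hcut
  have hm := h.measurable_kin_comp hcy.measurable hcz.measurable
    (measurable_fst.fst : Measurable fun q : (E3 × E3) × ℝ => q.1.1)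
    (measurable_fst.snd : Measurable fun q : (E3 × E3) × ℝ => q.1.2) hp hv
  have key := integral_pair_interval (k := fun p τ =>
      cutFactor m σ S D F (X + (τ * σ) • (α : E3)) (X + ((τ - 1) * σ) • (α : E3)) *
      (F (X + (τ * σ) • (α : E3)) p.1 * F (X + ((τ - 1) * σ) • (α : E3)) p.2 *
        ((Real.log (F (X + (τ * σ) • (α : E3)) (post α p.1 p.2))
          - Real.log (F (X + (τ * σ) • (α : E3)) p.1)) * vplus α p.1 p.2)))
    (bd := fun p => B * (C * (wt p.1 * wt p.2))) (hcut.mul hm)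
    ((integrable_wt_pair.const_mul C).const_mul B) ?_
  · refine key.trans ?_
    simp only [kinPair, integral_const_mul]
  · intro p τ hτ
    have h1 : ‖X + (τ * σ) • (α : E3)‖ ≤ ‖X‖ + |σ| := by
      refine (norm_add_smul_dir_le _ _ _).trans (add_le_add le_rfl ?_)
      rw [abs_mul, abs_of_nonneg hτ.1.le]
      exact mul_le_of_le_one_left (abs_nonneg _) hτ.2
    have h2 : ‖X + ((τ - 1) * σ) • (α : E3)‖ ≤ ‖X‖ + |σ| := by
      refine (norm_add_smul_dir_le _ _ _).trans (add_le_add le_rfl ?_)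
      rw [abs_mul, abs_sub_comm, abs_of_nonneg (sub_nonneg.2 hτ.2)]
      exact mul_le_of_le_one_left (abs_nonneg _) (by linarith [hτ.1])
    by_cases hD : X + (τ * σ) • (α : E3) ∈ D ∧ X + ((τ - 1) * σ) • (α : E3) ∈ D
    · have hY : X + (τ * σ) • (α : E3) ∈ D ∩ ball (0 : E3) (‖X‖ + |σ| + 1) :=
        ⟨hD.1, by rw [mem_ball_zero_iff]; linarith⟩
      have hZ : X + ((τ - 1) * σ) • (α : E3) ∈ D ∩ ball (0 : E3) (‖X‖ + |σ| + 1) :=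
        ⟨hD.2, by rw [mem_ball_zero_iff]; linarith⟩
      have h3 := hC _ hY _ hZ α p
      have h4 := hB _ _ h1 h2
      rw [norm_mul]
      exact mul_le_mul h4 h3 (norm_nonneg _) hB0
    · rw [cutFactor_of_notMem (by tauto), zero_mul, norm_zero]
      have := wt_pos p.1
      have := wt_pos p.2
      positivity

/-- The logarithm of the quotient splits only where `F` is positive; elsewhere the cut-off factor is
zero. -/
lemma kineticFlux_eq : kineticFlux m σ S D F
    = fun X => (σ ^ 3 / (2 * m)) • fluxOf σ (kinPair m σ S D F) X := by
  funext X
  rw [kineticFlux, fluxOf]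
  congr 2
  funext α
  rw [← h.kin_integral_interval α X, ← integral_smul_const]
  refine integral_congr_ae (ae_of_all _ fun ξ => ?_)
  simp only []
  rw [← integral_smul_const]
  refine integral_congr_ae (ae_of_all _ fun ξs => ?_)
  simp only []
  rw [← intervalIntegral.integral_smul_const]
  congr 1
  funext τ
  congr 1
  by_cases hD : X + (τ * σ) • (α : E3) ∈ D ∧ X + ((τ - 1) * σ) • (α : E3) ∈ D
  · rw [Real.log_div (h.pos _ hD.1 _).ne' (h.pos _ hD.1 _).ne', vplus]
    ring
  · rw [cutFactor_of_notMem (by tauto)]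
    ring

/-- The product ρ(Y)ρ(Z)(v(Y) - v(Z)) equals ρ(Z)j(Y) - ρ(Y)j(Z) with j = ρv, which is free of
division and extends by zero. -/
lemma collisionalFlux_eq : collisionalFlux m σ S D F = fun X =>
    (∫ x in (0 : ℝ)..crowding m σ D F X, S x) • momentum F X
      - (σ ^ 3 / (2 * m)) • fluxOf σ (flowPair m σ S D F) X := by
  funext X
  rw [collisionalFlux, fluxOf]
  congr 1
  · rw [collisionalH, ← h.density_smul_flow X, smul_smul, mul_comm]
  · congr 2
    funext α
    rw [← intervalIntegral.integral_smul_const]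
    congr 1
    funext τ
    congr 1
    rw [flowPair, ← h.density_smul_flow, ← h.density_smul_flow]
    by_cases hY : X + (τ * σ) • (α : E3) ∈ D
    · by_cases hZ : X + ((τ - 1) * σ) • (α : E3) ∈ D
      · simp only [chi, indicator_of_mem hY, indicator_of_mem hZ, inner_sub_left, inner_smul_left,
          conj_trivial]
        ring
      · simp [chi, hZ, h.density_zero hZ]
    · simp [chi, hY]

/-- The weak form of the divergence of the kinetic flux. -/
lemma integral_fderiv_kineticFlux {φ : E3 → ℝ} (hφ : ContDiff ℝ 1 φ) (hc : HasCompactSupport φ) :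
    ∫ X, fderiv ℝ φ X (kineticFlux m σ S D F X)
      = ∫ X, φ X * (σ ^ 2 / (2 * m) * (pairAvg σ (kinPair m σ S D F) X
        - pairAvg σ (pairSwap (kinPair m σ S D F)) X)) := by
  have h1 := h.kinPair_pairFn.toTwoPoint.integral_fderiv_fluxOf (σ := σ) hφ hc
  rw [h.kineticFlux_eq]
  simp only [map_smul, smul_eq_mul, integral_const_mul]
  calc _ = σ ^ 2 / (2 * m) * (σ * ∫ X, fderiv ℝ φ X (fluxOf σ (kinPair m σ S D F) X)) := by ring
    _ = _ := by
      rw [h1, ← integral_const_mul]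
      refine integral_congr_ae (ae_of_all _ fun X => ?_)
      simp only []
      rw [h.kinPair_pairFn.toTwoPoint.sourceOf_eq]
      ring

end Slice

/-! ### The gradient of ball averages -/

section BallDerivative

lemma LocBdd.locallyIntegrable {V : Type*} [NormedAddCommGroup V] [MeasurableSpace V]
    [BorelSpace V] [SecondCountableTopology V] {u : E3 → V} (hu : LocBdd u) :
    LocallyIntegrable u := by
  intro X
  obtain ⟨C, hC⟩ := hu.bdd (‖X‖ + 1)
  refine ⟨closedBall X 1, closedBall_mem_nhds X one_pos, ?_⟩
  refine Measure.integrableOn_of_bounded (M := C) measure_closedBall_lt_top.ne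
    hu.meas.aestronglyMeasurable ?_
  filter_upwards [ae_restrict_mem measurableSet_closedBall] with Y hY
  rw [mem_closedBall_iff_norm] at hY
  exact hC Y (by linarith [norm_le_norm_add_norm_sub' Y X])

lemma LocBdd.of_bound {u : E3 → ℝ} (hu : Measurable u) {C : ℝ} (hC : ∀ Y, |u Y| ≤ C) : LocBdd u :=
  ⟨hu, fun _ => ⟨C, fun Y _ => hC Y⟩⟩

lemma LocBdd.measurable_shift {u : E3 → ℝ} (hu : LocBdd u) (σ : ℝ) (e : E3) :
    Measurable fun q : E3 × S2 => u (q.1 - σ • (q.2 : E3)) * inner ℝ (q.2 : E3) e := by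
  have hcd := continuous_dir
  have h1 : Measurable fun q : E3 × S2 => u (q.1 - σ • (q.2 : E3)) :=
    hu.meas.comp (Continuous.measurable (by fun_prop))
  have h2 : Continuous fun q : E3 × S2 => inner ℝ (q.2 : E3) e := by fun_prop
  exact h1.mul h2.measurable

lemma abs_inner_dir_le (α : S2) (e : E3) : |inner ℝ (α : E3) e| ≤ ‖e‖ := by
  refine (abs_real_inner_le_norm _ _).trans ?_
  rw [norm_dir, one_mul]

lemma LocBdd.integrable_shift {u : E3 → ℝ} (hu : LocBdd u) (σ : ℝ) (X e : E3) :
    Integrable (fun α : S2 => u (X - σ • (α : E3)) * inner ℝ (α : E3) e) solidAngle := by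
  obtain ⟨C, hC⟩ := hu.bdd (‖X‖ + |σ|)
  refine Integrable.of_bound (C := C * ‖e‖)
    ((hu.measurable_shift σ e).comp measurable_prodMk_left).aestronglyMeasurable
    (ae_of_all _ fun α => ?_)
  rw [norm_mul]
  have h1 := hC _ (norm_sub_smul_dir_le X σ α)
  exact mul_le_mul h1 (abs_inner_dir_le α e) (norm_nonneg _) ((norm_nonneg _).trans h1)

lemma LocBdd.shift_avg {u : E3 → ℝ} (hu : LocBdd u) (σ : ℝ) (e : E3) :
    LocBdd fun X => ∫ α : S2, u (X - σ • (α : E3)) * inner ℝ (α : E3) e ∂solidAngle := by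
  refine ⟨?_, fun r => ?_⟩
  · have : StronglyMeasurable (Function.uncurry fun (X : E3) (α : S2) =>
        u (X - σ • (α : E3)) * inner ℝ (α : E3) e) := (hu.measurable_shift σ e).stronglyMeasurable
    exact this.integral_prod_right.measurable
  · obtain ⟨C, hC⟩ := hu.bdd (r + |σ|)
    refine ⟨C * ‖e‖ * solidAngle.real univ, fun X hX =>
      norm_integral_le_of_norm_le_const (ae_of_all _ fun α => ?_)⟩
    have h1 := hC _ ((norm_sub_smul_dir_le X σ α).trans (by linarith))
    rw [norm_mul]
    exact mul_le_mul h1 (abs_inner_dir_le α e) (norm_nonneg _) ((norm_nonneg _).trans h1)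

/-- `u` may jump, so the derivative is identified by testing: integrate by parts, move the average
onto the test function by self-adjointness, apply the divergence theorem on the ball there, and
translate back. The average is Lipschitz, so its weak and line derivatives agree almost everywhere.
-/
lemma ballInt_lineDeriv_ae {σ : ℝ} (hσ : 0 < σ) {u : E3 → ℝ} (hu : Measurable u) {C : ℝ}
    (hC : ∀ Y, |u Y| ≤ C) (e : E3) : ∀ᵐ X, lineDeriv ℝ (ballInt σ u) X e
      = - (σ ^ 2 * ∫ α : S2, u (X - σ • (α : E3)) * inner ℝ (α : E3) e ∂solidAngle) := by
  have huL := LocBdd.of_bound hu hC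
  obtain ⟨K, hK⟩ := exists_lipschitzWith_ballInt hσ hu hC
  have hr := (huL.shift_avg σ e).locallyIntegrable
  refine ae_eq_of_integral_contDiff_smul_eq (hK.locallyIntegrable_lineDeriv _) (hr.smul (σ ^ 2)).neg
    fun ψ hψ hc => ?_
  have hψ1 : ContDiff ℝ 1 ψ := hψ.of_le (by exact_mod_cast le_top)
  obtain ⟨L, hL⟩ := hψ1.lipschitzWith_of_hasCompactSupport hc one_ne_zero
  have h1 := hK.integral_lineDeriv_mul_eq (μ := volume) hL hc e
  have h2 : ∀ X, lineDeriv ℝ ψ X (-e) = - fderiv ℝ ψ X e := fun X => by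
    rw [(hψ1.differentiable one_ne_zero X).lineDeriv_eq_fderiv, map_neg]
  have h3 := huL.integral_mul_ballInt σ (ψ := fun X => fderiv ℝ ψ X e)
    ((hψ1.continuous_fderiv one_ne_zero).clm_apply continuous_const) (hc.fderiv_apply (𝕜 := ℝ) e)
  have h4 : ∀ Y, ballInt σ (fun X => fderiv ℝ ψ X e) Y
      = σ ^ 2 * ∫ α : S2, ψ (Y + σ • (α : E3)) * inner ℝ (α : E3) e ∂solidAngle := fun Y => by
    rw [ballInt_eq, integral_translate_ball_fderiv hσ hψ1 hc]
  have h5 := integral_shift_dir (w := fun (α : S2) Y => u Y * inner ℝ (α : E3) e)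
    ((hu.comp measurable_snd).mul (by
      have hcd := continuous_dir
      exact Continuous.measurable (by fun_prop)))
    (fun r => ⟨C * ‖e‖, fun α Y _ => by
      rw [abs_mul]
      exact mul_le_mul (hC Y) (abs_inner_dir_le α e) (abs_nonneg _) ((abs_nonneg _).trans (hC Y))⟩)
    σ hψ.continuous hc
  calc ∫ X, ψ X • lineDeriv ℝ (ballInt σ u) X e
      = ∫ X, lineDeriv ℝ (ballInt σ u) X e * ψ X := by simp only [smul_eq_mul, mul_comm]
    _ = - ∫ X, fderiv ℝ ψ X e * ballInt σ u X := by
        rw [h1, ← integral_neg]; simp only [h2, neg_mul]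
    _ = - (σ ^ 2 * ∫ X, ψ X * ∫ α : S2, u (X - σ • (α : E3)) * inner ℝ (α : E3) e ∂solidAngle) := by
        rw [h3, ← h5, ← integral_const_mul]
        congr 2
        funext Y
        rw [h4, mul_left_comm, ← integral_const_mul]
        congr 2
        funext α
        ring
    _ = _ := by
        rw [← integral_const_mul, ← integral_neg]
        congr 1
        funext X
        simp only [smul_eq_mul]
        ring

/-- The gradient of ball averages. -/
lemma ballInt_fderiv_ae {σ : ℝ} (hσ : 0 < σ) {u : E3 → ℝ} (hu : Measurable u) {C : ℝ}
    (hC : ∀ Y, |u Y| ≤ C) : ∀ᵐ X, DifferentiableAt ℝ (ballInt σ u) X ∧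
      ∀ e, fderiv ℝ (ballInt σ u) X e
      = - (σ ^ 2 * ∫ α : S2, u (X - σ • (α : E3)) * inner ℝ (α : E3) e ∂solidAngle) := by
  obtain ⟨K, hK⟩ := exists_lipschitzWith_ballInt hσ hu hC
  have huL := LocBdd.of_bound hu hC
  have h1 : ∀ᵐ X, ∀ i : Fin 3, lineDeriv ℝ (ballInt σ u) X (EuclideanSpace.single i 1)
      = - (σ ^ 2 * ∫ α : S2, u (X - σ • (α : E3))
        * inner ℝ (α : E3) (EuclideanSpace.single i 1) ∂solidAngle) :=
    ae_all_iff.2 fun i => ballInt_lineDeriv_ae hσ hu hC _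
  filter_upwards [hK.ae_differentiableAt, h1] with X hX h1X
  refine ⟨hX, fun e => ?_⟩
  rw [← sum_coord_smul_apply]
  have h2 : ∀ i : Fin 3, e i * fderiv ℝ (ballInt σ u) X (EuclideanSpace.single i 1)
      = - (σ ^ 2 * ∫ α : S2, e i * (u (X - σ • (α : E3))
        * inner ℝ (α : E3) (EuclideanSpace.single i 1)) ∂solidAngle) := fun i => by
    rw [← hX.lineDeriv_eq_fderiv, h1X i, integral_const_mul]; ring
  simp only [h2]
  rw [Finset.sum_neg_distrib, ← Finset.mul_sum, ← integral_finsetSum _ fun i _ =>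
    (huL.integrable_shift σ X _).const_mul _]
  congr 3
  funext α
  have h3 := sum_coord_smul_apply (innerSL ℝ (α : E3)) e
  simp only [innerSL_apply_apply] at h3
  rw [← h3, Finset.mul_sum]
  exact Finset.sum_congr rfl fun i _ => by ring

end BallDerivative

/-! ### The rate of crowding and the collisional balance -/

/-- The time derivative of the crowding function. -/
def crowdRate (m σ : ℝ) (G : E3 → E3 → ℝ) (X : E3) : ℝ := (1 / m) * ballInt σ (fun Y => ∫ ξ, G Y ξ) X

namespace Slice

variable {m σ : ℝ} {S : ℝ → ℝ} {b : EReal} {D : Set E3} {F G : E3 → E3 → ℝ}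
  (h : Slice m σ S b D F G)

include h

/-- The boundary condition in weak form. -/
lemma integral_rate_mul {φ : E3 → ℝ} (hφ : ContDiff ℝ ∞ φ) (hc : HasCompactSupport φ) :
    ∫ X, (∫ ξ, G X ξ) * φ X = ∫ X, fderiv ℝ φ X (momentum F X) := by
  have hφ1 : ContDiff ℝ 1 φ := hφ.of_le (by exact_mod_cast le_top)
  have h1 := h.noflux φ ⟨hφ, hc, subset_univ _⟩
  simp only [h.density_smul_flow] at h1
  have i1 := integrable_fderiv_apply hφ1 hc h.momentum_locBdd.locallyIntegrable
  have i2 : Integrable fun X => φ X * ∫ ξ, G X ξ :=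
    h.rate_locBdd.locallyIntegrable.integrable_smul_left_of_hasCompactSupport hφ.continuous hc
  -- Mass conservation replaces the divergence of the momentum by -∂_tρ, so impermeability becomes
  -- the weak continuity equation for test functions that need not vanish on ∂D.
  have e1 : ∫ X in D, (fderiv ℝ φ X (momentum F X) + φ X * div (momentum F) X)
      = ∫ X in D, (fderiv ℝ φ X (momentum F X) - φ X * ∫ ξ, G X ξ) :=
    setIntegral_congr_fun h.hD.measurableSet fun X hX => by
      rw [h.rate_eq_neg_div hX]; ring
  rw [e1, setIntegral_eq_integral_of_forall_compl_eq_zero, integral_sub i1 i2] at h1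
  · simp only [mul_comm _ (φ _)]
    linarith
  · intro X hX
    simp [h.momentum_zero hX, h.G_zero X hX]

/-- When tested, the ball average moves onto the test function. The averaged test function is
admissible in the boundary condition, so no term from ∂D appears even when the ball about `X`
crosses it. What remains is the divergence theorem on the ball. -/
lemma crowdRate_ae : ∀ᵐ X, crowdRate m σ G X
    = σ ^ 2 / m * ∫ α : S2, inner ℝ (α : E3) (momentum F (X - σ • (α : E3))) ∂solidAngle := by
  have hj := h.momentum_locBdd
  have hcd := continuous_dir
  have hw : Measurable fun q : S2 × E3 => inner ℝ (q.1 : E3) (momentum F q.2) :=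
    Measurable.inner (continuous_dir.measurable.comp measurable_fst) (hj.meas.comp measurable_snd)
  have hb : ∀ r : ℝ, ∃ C : ℝ, ∀ (α : S2) Y, ‖Y‖ ≤ r → |inner ℝ (α : E3) (momentum F Y)| ≤ C :=
    fun r => (hj.bdd r).imp fun C hC α Y hY => (abs_inner_dir_le α _).trans (hC Y hY)
  have hloc : LocBdd fun X => ∫ α : S2, inner ℝ (α : E3) (momentum F (X - σ • (α : E3))) ∂solidAngle := by
    refine ⟨?_, fun r => ?_⟩
    · have : StronglyMeasurable (Function.uncurry fun (X : E3) (α : S2) =>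
          inner ℝ (α : E3) (momentum F (X - σ • (α : E3)))) := by
        refine Measurable.stronglyMeasurable ?_
        exact hw.comp (f := fun q : E3 × S2 => (q.2, q.1 - σ • (q.2 : E3)))
          (Continuous.measurable (by fun_prop))
      exact this.integral_prod_right.measurable
    · obtain ⟨C, hC⟩ := hb (r + |σ|)
      exact ⟨C * solidAngle.real univ, fun X hX => norm_integral_le_of_norm_le_const
        (ae_of_all _ fun α => hC α _ ((norm_sub_smul_dir_le X σ α).trans (by linarith)))⟩
  have hg := h.rate_locBdd
  have hbl : LocallyIntegrable (crowdRate m σ G) := by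
    have h1 : LocBdd (ballInt σ fun Y => ∫ ξ, G Y ξ) := by
      refine ⟨?_, fun r => ?_⟩
      · have : StronglyMeasurable (Function.uncurry fun X Y : E3 =>
            (∫ ξ, G Y ξ) * heaviside (σ - ‖Y - X‖)) :=
          ((hg.meas.comp measurable_snd).mul
            (measurable_heaviside.comp (by fun_prop))).stronglyMeasurable
        exact this.integral_prod_right.measurable
      · obtain ⟨C, hC⟩ := hg.bdd (r + σ)
        refine ⟨C * (volume : Measure E3).real (closedBall 0 σ), fun X hX => ?_⟩
        rw [ballInt_eq]
        refine norm_setIntegral_le_of_norm_le_const measure_closedBall_lt_top fun z hz => ?_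
        rw [mem_closedBall_zero_iff] at hz
        exact hC _ ((norm_add_le _ _).trans (add_le_add hX hz))
    exact h1.locallyIntegrable.smul (1 / m)
  refine ae_eq_of_integral_contDiff_smul_eq hbl (hloc.locallyIntegrable.smul (σ ^ 2 / m))
    fun ψ hψ hc => ?_
  have hψ1 : ContDiff ℝ 1 ψ := hψ.of_le (by exact_mod_cast le_top)
  obtain ⟨hB, hBc, hBd⟩ := contDiff_ballInt σ hψ hc
  have h1 := hg.integral_mul_ballInt σ hψ.continuous hc
  rw [h.integral_rate_mul hB hBc] at h1
  have h4 : ∀ Y, fderiv ℝ (ballInt σ ψ) Y (momentum F Y)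
      = σ ^ 2 * ∫ α : S2, ψ (Y + σ • (α : E3)) * inner ℝ (α : E3) (momentum F Y) ∂solidAngle :=
    fun Y => by rw [hBd, ballInt_eq, integral_translate_ball_fderiv h.hσ hψ1 hc]
  simp only [h4, integral_const_mul] at h1
  rw [integral_shift_dir hw hb σ hψ.continuous hc] at h1
  simp only [crowdRate, smul_eq_mul]
  calc _ = (1 / m) * ∫ X, ψ X * ballInt σ (fun Y => ∫ ξ, G Y ξ) X := by
        rw [← integral_const_mul]; congr 1; funext X; ring
    _ = σ ^ 2 / m * ∫ X, ψ X * ∫ α : S2, inner ℝ (α : E3) (momentum F (X - σ • (α : E3))) ∂solidAngle := by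
        rw [h1]; ring
    _ = _ := by rw [← integral_const_mul]; congr 1; funext X; ring

end Slice

/-- The primitive of a bounded continuous function is Lipschitz. -/
lemma exists_lipschitzWith_primitive {s : ℝ → ℝ} (hs : Continuous s) {C : ℝ} (hC : ∀ x, |s x| ≤ C) :
    (∀ x, HasDerivAt (fun x => ∫ y in (0 : ℝ)..x, s y) (s x) x) ∧
      ∃ K, LipschitzWith K fun x => ∫ y in (0 : ℝ)..x, s y := by
  have h1 : ∀ x, HasDerivAt (fun x => ∫ y in (0 : ℝ)..x, s y) (s x) x := fun x =>
    intervalIntegral.integral_hasDerivAt_right (hs.intervalIntegrable _ _)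
      (hs.stronglyMeasurableAtFilter _ _) hs.continuousAt
  refine ⟨h1, C.toNNReal, lipschitzWith_of_nnnorm_deriv_le (fun x => (h1 x).differentiableAt)
    fun x => ?_⟩
  rw [(h1 x).deriv, ← NNReal.coe_le_coe, coe_nnnorm]
  exact (hC x).trans (Real.le_coe_toNNReal C)

/-- The time derivative of the collisional part of the H-function. -/
def collRate (m σ : ℝ) (S : ℝ → ℝ) (D : Set E3) (F G : E3 → E3 → ℝ) (X : E3) : ℝ :=
  (∫ ξ, G X ξ) * (∫ x in (0 : ℝ)..crowding m σ D F X, S x)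
    + density F X * (S (crowding m σ D F X) * crowdRate m σ G X)

namespace Slice

variable {m σ : ℝ} {S : ℝ → ℝ} {b : EReal} {D : Set E3} {F G : E3 → E3 → ℝ}
  (h : Slice m σ S b D F G)

include h

lemma integrable_shift_momentum (X : E3) : Integrable
    (fun α : S2 => inner ℝ (α : E3) (momentum F (X - σ • (α : E3)))) solidAngle := by
  obtain ⟨C, hC⟩ := h.momentum_locBdd.bdd (‖X‖ + |σ|)
  have hcd := continuous_dir
  refine Integrable.of_bound (C := C) (Measurable.aestronglyMeasurable ?_) (ae_of_all _ fun α =>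
    (abs_inner_dir_le α _).trans (hC _ (norm_sub_smul_dir_le X σ α)))
  exact Measurable.inner continuous_dir.measurable
    (h.momentum_locBdd.meas.comp (Continuous.measurable (by fun_prop)))

/-- Up to the factor -m/σ², the bracket is j·∇R + ρ ∂_t R almost everywhere, with j the momentum:
the two sphere integrals are those of the gradient and of the rate of R. -/
lemma pairAvg_flowPair {X : E3} (hX : X ∈ D) : pairAvg σ (flowPair m σ S D F) X =
    S (crowding m σ D F X) *
      ((∫ α : S2, density F (X - σ • (α : E3)) * inner ℝ (α : E3) (momentum F X) ∂solidAngle)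
      - density F X * ∫ α : S2, inner ℝ (α : E3) (momentum F (X - σ • (α : E3))) ∂solidAngle) := by
  rw [← integral_const_mul, ← integral_sub (h.density_locBdd.integrable_shift σ X _)
    ((h.integrable_shift_momentum X).const_mul _), pairAvg, ← integral_const_mul]
  congr 1
  funext α
  rw [flowPair, indicator_of_mem hX, inner_sub_left, inner_smul_left, inner_smul_left,
    real_inner_comm, real_inner_comm (α : E3) (momentum F (X - σ • (α : E3)))]
  simp

/-- The weak form of the divergence of the transport part of the collisional flux. -/
lemma integral_fderiv_transport {φ : E3 → ℝ} (hφ : IsTest D φ) :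
    Integrable (fun X => fderiv ℝ φ X ((∫ x in (0 : ℝ)..crowding m σ D F X, S x) • momentum F X)) ∧
    Integrable (fun X => φ X * (collRate m σ S D F G X
      + σ ^ 2 / m * pairAvg σ (flowPair m σ S D F) X)) ∧
    ∫ X, fderiv ℝ φ X ((∫ x in (0 : ℝ)..crowding m σ D F X, S x) • momentum F X)
      = ∫ X, φ X * (collRate m σ S D F G X + σ ^ 2 / m * pairAvg σ (flowPair m σ S D F) X) := by
  obtain ⟨hs, hc, hsub⟩ := hφ
  have hφz : ∀ X, X ∉ tsupport φ → φ X = 0 ∧ fderiv ℝ φ X = 0 := fun X hX => by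
    have hz2 : φ =ᶠ[𝓝 X] fun _ => 0 := by
      filter_upwards [(isClosed_tsupport φ).isOpen_compl.mem_nhds hX] with Y hY
      simp [image_eq_zero_of_notMem_tsupport hY]
    exact ⟨image_eq_zero_of_notMem_tsupport hX, by simp [hz2.fderiv_eq]⟩
  by_cases hne : (tsupport φ).Nonempty
  swap
  · have hz := fun X => hφz X fun hX => hne ⟨X, hX⟩
    simp [hz]
  obtain ⟨Y0, hY0⟩ := hne
  obtain ⟨r, hr⟩ := hc.isCompact.isBounded.subset_closedBall 0
  have hr' : ∀ X ∈ tsupport φ, ‖X‖ ≤ r := fun X hX => by simpa using hr hX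
  -- Density and `S` are replaced by bounded versions that agree with them for points in the support
  -- of `φ`. Then R and its composite with the primitive are globally Lipschitz, as the divergence
  -- theorem requires.
  obtain ⟨u, hum, ⟨C, hC⟩, hu1, hu2⟩ := h.density_locBdd.exists_truncation σ r
  obtain ⟨K, hK⟩ := exists_lipschitzWith_ballInt h.hσ hum hC
  obtain ⟨c, hc0, hcb, hcR⟩ := h.exists_crowding_bound (hsub hY0) r
  obtain ⟨s, hsc, hsS, Cs, hCs⟩ := h.exists_extension hc0 hcb
  obtain ⟨hder, L, hL⟩ := exists_lipschitzWith_primitive hsc hCs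
  set Φ : ℝ → ℝ := fun x => ∫ y in (0 : ℝ)..x, s y with hΦ
  set R : E3 → ℝ := fun X => (1 / m) • ballInt σ u X with hRdef
  have hRL : LipschitzWith (‖(1 / m : ℝ)‖₊ * K) R := (lipschitzWith_smul (1 / m : ℝ)).comp hK
  have hUL := hL.comp hRL
  have hReq : ∀ X ∈ tsupport φ, R X = crowding m σ D F X := fun X hX => by
    simp only [h.crowding_eq, ← hu2 X (hr' X hX), hRdef, smul_eq_mul]
  have hSeq : ∀ X ∈ tsupport φ, s (R X) = S (crowding m σ D F X) := fun X hX => by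
    rw [hReq X hX]
    exact hsS _ (h.crowding_nonneg X) (hcR X (hsub hX) (hr' X hX))
  have hUeq : ∀ X ∈ tsupport φ, (Φ ∘ R) X = ∫ x in (0 : ℝ)..crowding m σ D F X, S x := fun X hX => by
    rw [Function.comp, hReq X hX, hΦ]
    refine intervalIntegral.integral_congr fun x hx => ?_
    rw [uIcc_of_le (h.crowding_nonneg X)] at hx
    exact hsS x hx.1 (hx.2.trans (hcR X (hsub hX) (hr' X hX)))
  obtain ⟨i1, i2, e⟩ := integral_lipschitz_div h.hD h.momentum_contDiffOn ⟨hs, hc, hsub⟩ hUL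
  have i3 : Integrable fun X => (φ X * (Φ ∘ R) X) * ∫ ξ, G X ξ :=
    h.rate_locBdd.locallyIntegrable.integrable_smul_left_of_hasCompactSupport
      (hs.continuous.mul hUL.continuous) hc.mul_right
  have hpt : (fun X => fderiv ℝ φ X ((∫ x in (0 : ℝ)..crowding m σ D F X, S x) • momentum F X))
      = fun X => (Φ ∘ R) X * (fderiv ℝ φ X (momentum F X) + φ X * div (momentum F) X)
        + (φ X * (Φ ∘ R) X) * ∫ ξ, G X ξ := by
    funext X
    by_cases hX : X ∈ tsupport φ
    · rw [h.rate_eq_neg_div (hsub hX), hUeq X hX, map_smul, smul_eq_mul]; ring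
    · simp [hφz X hX]
  -- The chain rule needs only the derivative of R, which exists almost everywhere. The terms with
  -- the undifferentiated primitive cancel by mass conservation.
  have hae : (fun X => - (φ X * fderiv ℝ (Φ ∘ R) X (momentum F X)) + (φ X * (Φ ∘ R) X) * ∫ ξ, G X ξ)
      =ᵐ[volume] fun X => φ X * (collRate m σ S D F G X
        + σ ^ 2 / m * pairAvg σ (flowPair m σ S D F) X) := by
    filter_upwards [h.crowdRate_ae, ballInt_fderiv_ae h.hσ hum hC] with X h1 h2
    by_cases hX : X ∈ tsupport φ
    · have hRd : HasFDerivAt R ((1 / m) • fderiv ℝ (ballInt σ u) X) X :=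
        h2.1.hasFDerivAt.const_smul (1 / m)
      have hUd := ((hder (R X)).comp_hasFDerivAt X hRd).fderiv
      have hsh : ∀ α : S2, u (X - σ • (α : E3)) = density F (X - σ • (α : E3)) := fun α => by
        refine hu1 _ ((norm_sub_smul_dir_le X σ α).trans ?_)
        rw [abs_of_pos h.hσ]; linarith [hr' X hX]
      have hUd2 : fderiv ℝ (Φ ∘ R) X (momentum F X) = S (crowding m σ D F X) * ((1 / m) *
          - (σ ^ 2 * ∫ α : S2, density F (X - σ • (α : E3))
            * inner ℝ (α : E3) (momentum F X) ∂solidAngle)) := by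
        have h3 := h2.2 (momentum F X)
        simp only [hsh] at h3
        rw [← h3, ← hSeq X hX]
        exact congrArg (fun L : E3 →L[ℝ] ℝ => L (momentum F X)) hUd
      rw [hUd2, hUeq X hX, h.pairAvg_flowPair (hsub hX), collRate, h1]
      ring
    · simp [hφz X hX]
  rw [hpt]
  refine ⟨i1.add i3, (i2.neg.add i3).congr hae, ?_⟩
  have i2' : Integrable fun X => -(φ X * fderiv ℝ (Φ ∘ R) X (momentum F X)) := i2.neg
  rw [integral_add i1 i3, e, ← integral_congr_ae hae, integral_add i2' i3, integral_neg]

/-- The weak form of the divergence of the collisional flux. -/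
lemma integral_fderiv_collisionalFlux {φ : E3 → ℝ} (hφ : IsTest D φ) :
    Integrable (fun X => φ X * collRate m σ S D F G X) ∧
    ∫ X, fderiv ℝ φ X (collisionalFlux m σ S D F X)
      = ∫ X, φ X * (collRate m σ S D F G X + exchange m σ S D F X) := by
  obtain ⟨i1, i2, e⟩ := h.integral_fderiv_transport hφ
  obtain ⟨hs, hc, hsub⟩ := hφ
  have hφ1 : ContDiff ℝ 1 φ := hs.of_le (by exact_mod_cast le_top)
  have hfl := h.flowPair_pairFn.toTwoPoint
  have hs1 : Integrable fun X => φ X * pairAvg σ (flowPair m σ S D F) X :=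
    (hfl.pairAvg_locBdd σ).locallyIntegrable.integrable_smul_left_of_hasCompactSupport
      hs.continuous hc
  have hs2 : Integrable fun X => φ X * pairAvg σ (pairSwap (flowPair m σ S D F)) X :=
    (hfl.swap.pairAvg_locBdd σ).locallyIntegrable.integrable_smul_left_of_hasCompactSupport
      hs.continuous hc
  have hflux : LocBdd (fluxOf σ (flowPair m σ S D F)) :=
    ⟨(hfl.stronglyMeasurable_fluxOf σ).measurable, hfl.fluxOf_bdd σ⟩
  have i4 := integrable_fderiv_apply hφ1 hc hflux.locallyIntegrable
  have e4 := hfl.integral_fderiv_fluxOf (σ := σ) hφ1 hc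
  have i5 : Integrable fun X => φ X * collRate m σ S D F G X := by
    refine (i2.sub (hs1.const_mul (σ ^ 2 / m))).congr (ae_of_all _ fun X => ?_)
    simp only [Pi.sub_apply]; ring
  refine ⟨i5, ?_⟩
  rw [h.collisionalFlux_eq]
  simp only [map_sub, map_smul _ (σ ^ 3 / (2 * m)), smul_eq_mul]
  have i6 : Integrable fun X => φ X * sourceOf σ (flowPair m σ S D F) X := by
    simp only [hfl.sourceOf_eq, mul_sub]
    exact hs1.sub hs2
  rw [integral_sub i1 (i4.const_mul _), integral_const_mul, e,
    -- One power of `σ` is the length of the segment in the weak divergence formula. The full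
    -- average from the transport term minus half the antisymmetric part leaves half the symmetric
    -- part, the exchange term.
    show σ ^ 3 / (2 * m) = σ ^ 2 / (2 * m) * σ by ring, mul_assoc, e4, ← integral_const_mul,
    ← integral_sub i2 (i6.const_mul _)]
  congr 1
  funext X
  have hexch : pairAvg σ (exchPair m σ S D F) X = pairAvg σ (flowPair m σ S D F) X
      + pairAvg σ (pairSwap (flowPair m σ S D F)) X := by
    rw [pairAvg, pairAvg, pairAvg, ← integral_add (hfl.integrable_avg σ X)
      (hfl.swap.integrable_avg σ X)]
    simp only [h.exchPair_eq]
  rw [h.exchange_eq, hexch, hfl.sourceOf_eq]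
  have := h.hm.ne'
  field_simp
  ring

end Slice

lemma div_add {J J' : E3 → E3} {X : E3} (hJ : DifferentiableAt ℝ J X)
    (hJ' : DifferentiableAt ℝ J' X) : div (fun Y => J Y + J' Y) X = div J X + div J' X := by
  simp only [div, fderiv_fun_add hJ hJ', _root_.add_apply, PiLp.add_apply,
    Finset.sum_add_distrib]

section Test

variable {D : Set E3} {φ : E3 → ℝ}

lemma IsTest.apply_eq_zero (hφ : IsTest D φ) {X : E3} (hX : X ∉ D) : φ X = 0 ∧ fderiv ℝ φ X = 0 := by
  have hX' : X ∉ tsupport φ := fun hc => hX (hφ.2.2 hc)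
  have hz2 : φ =ᶠ[𝓝 X] fun _ => 0 := by
    filter_upwards [(isClosed_tsupport φ).isOpen_compl.mem_nhds hX'] with Y hY
    simp [image_eq_zero_of_notMem_tsupport hY]
  exact ⟨image_eq_zero_of_notMem_tsupport hX', by simp [hz2.fderiv_eq]⟩

lemma IsTest.integrable_mul (hφ : IsTest D φ) {g : E3 → ℝ} (hg : LocallyIntegrableOn g D) :
    Integrable fun X => φ X * g X := by
  obtain ⟨hs, hc, hsub⟩ := hφ
  have h1 : Integrable ((tsupport φ).indicator g) :=
    (integrable_indicator_iff (isClosed_tsupport φ).measurableSet).2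
      (hg.integrableOn_compact_subset hsub hc)
  refine (h1.locallyIntegrable.integrable_smul_left_of_hasCompactSupport hs.continuous hc).congr
    (ae_of_all _ fun X => ?_)
  by_cases hX : X ∈ tsupport φ
  · simp [hX]
  · simp [hX, image_eq_zero_of_notMem_tsupport hX]

lemma IsTest.integrable_fderiv (hφ : IsTest D φ) {J : E3 → E3} (hJ : LocallyIntegrableOn J D) :
    Integrable fun X => fderiv ℝ φ X (J X) := by
  have h1 : Integrable ((tsupport φ).indicator J) :=
    (integrable_indicator_iff (isClosed_tsupport φ).measurableSet).2
      (hJ.integrableOn_compact_subset hφ.2.2 hφ.2.1)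
  refine (integrable_fderiv_apply (hφ.1.of_le (by exact_mod_cast le_top)) hφ.2.1
    h1.locallyIntegrable).congr (ae_of_all _ fun X => ?_)
  have hφ' : IsTest (tsupport φ) φ := ⟨hφ.1, hφ.2.1, subset_rfl⟩
  by_cases hX : X ∈ tsupport φ
  · simp [hX]
  · simp [hφ'.apply_eq_zero hX]

end Test

/-! ### Pointwise and distributional balances at a fixed time -/

/-- The time derivative of the kinetic part of the H-function. -/
def kinRate (F G : E3 → E3 → ℝ) (X : E3) : ℝ := ∫ ξ, (1 + Real.log (F X ξ)) * G X ξ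

namespace Slice

variable {m σ : ℝ} {S : ℝ → ℝ} {b : EReal} {D : Set E3} {F G : E3 → E3 → ℝ}
  (h : Slice m σ S b D F G)

include h

lemma primitive_continuousOn :
    ContinuousOn (fun X => ∫ x in (0 : ℝ)..crowding m σ D F X, S x) D := by
  intro X hX
  obtain ⟨c, hc0, hcb, hcR⟩ := h.exists_crowding_bound hX (‖X‖ + 1)
  obtain ⟨s, hsc, hsS, Cs, hCs⟩ := h.exists_extension hc0 hcb
  obtain ⟨-, L, hL⟩ := exists_lipschitzWith_primitive hsc hCs
  have h1 := hL.continuous.comp h.continuous_crowding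
  refine (h1.continuousAt.congr ?_).continuousWithinAt
  filter_upwards [h.hD.mem_nhds hX, ball_mem_nhds X one_pos] with Y hY hYX
  rw [mem_ball_iff_norm] at hYX
  refine intervalIntegral.integral_congr fun x hx => ?_
  rw [uIcc_of_le (h.crowding_nonneg Y)] at hx
  exact hsS x hx.1 (hx.2.trans (hcR Y hY (by linarith [norm_le_norm_add_norm_sub' Y X])))

lemma collRate_continuousOn : ContinuousOn (collRate m σ S D F G) D :=
  (h.rate_continuousOn.mul h.primitive_continuousOn).add (h.density_contDiffOn.continuousOn.mul
    (h.factor_continuousOn.mul (continuous_const.mul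
      (h.rate_locBdd.continuous_ballInt h.hσ)).continuousOn))

lemma kinRate_continuousOn : ContinuousOn (kinRate F G) D :=
  continuousOn_moment h.hD h.entropyRate_cont h.entropyRate_rapid

lemma pairAvg_prodPair (X : E3) : pairAvg σ (prodPair m σ S D F) X =
    pairAvg σ (exchPair m σ S D F) X - pairAvg σ (kinPair m σ S D F) X
      - pairAvg σ (pairSwap (kinPair m σ S D F)) X := by
  have h1 := h.exchPair_pairFn.toTwoPoint
  have h2 := h.kinPair_pairFn.toTwoPoint
  rw [pairAvg, pairAvg, pairAvg, pairAvg, ← integral_sub (h1.integrable_avg σ X)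
    (h2.integrable_avg σ X), ← integral_sub ((h1.sub h2).integrable_avg σ X)
    (h2.swap.integrable_avg σ X)]
  rfl

/-- The kinetic balance up to the kinetic flux. -/
lemma kinRate_add_div {X : E3} (hX : X ∈ D) : kinRate F G X + div (convectiveFlux F) X
    + σ ^ 2 / (2 * m) * (pairAvg σ (pairSwap (kinPair m σ S D F)) X
      - pairAvg σ (kinPair m σ S D F) X)
    = exchange m σ S D F X - σ ^ 2 / (2 * m) * pairAvg σ (prodPair m σ S D F) X := by
  rw [kinRate, h.entropyRate_add_div_eq hX, h.exchange_eq, h.pairAvg_prodPair]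
  have := h.hm.ne'
  field_simp
  ring

/-- The weak divergence has a density that is continuous at `X`, since the boundary is seen only in
a null set of directions; where the flux is C¹ this density is the classical divergence. -/
lemma div_kineticFlux {X : E3} (hX : X ∈ D) (hJ : ContDiffAt ℝ 1 (kineticFlux m σ S D F) X)
    (hnull : solidAngle {α : S2 | X + σ • (α : E3) ∈ frontier D} = 0) :
    div (kineticFlux m σ S D F) X = σ ^ 2 / (2 * m) * (pairAvg σ (pairSwap (kinPair m σ S D F)) X
      - pairAvg σ (kinPair m σ S D F) X) := by
  have hk := h.kinPair_pairFn
  have h1 := div_eq_neg_of_weak h.hD hX hJ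
    (h := fun X => σ ^ 2 / (2 * m) * (pairAvg σ (kinPair m σ S D F) X
        - pairAvg σ (pairSwap (kinPair m σ S D F)) X))
    (continuousAt_const.mul ((hk.continuousAt_pairAvg h.hD hX hnull).sub
      (hk.swap.continuousAt_pairAvg h.hD hX hnull)))
    ((((hk.toTwoPoint.pairAvg_locBdd σ).locallyIntegrable.sub
      (hk.toTwoPoint.swap.pairAvg_locBdd σ).locallyIntegrable).smul
        (σ ^ 2 / (2 * m))).locallyIntegrableOn D)
    fun φ hφ => h.integral_fderiv_kineticFlux (hφ.1.of_le (by exact_mod_cast le_top)) hφ.2.1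
  rw [h1]; ring

lemma exchange_locallyIntegrable : LocallyIntegrable (exchange m σ S D F) := by
  have h1 : exchange m σ S D F = fun X => σ ^ 2 / (2 * m) * pairAvg σ (exchPair m σ S D F) X :=
    funext fun X => h.exchange_eq
  rw [h1]
  exact (h.exchPair_pairFn.toTwoPoint.pairAvg_locBdd σ).locallyIntegrable.smul (σ ^ 2 / (2 * m))

lemma div_collisionalFlux {X : E3} (hX : X ∈ D)
    (hJ : ContDiffAt ℝ 1 (collisionalFlux m σ S D F) X)
    (hnull : solidAngle {α : S2 | X + σ • (α : E3) ∈ frontier D} = 0) :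
    div (collisionalFlux m σ S D F) X = - (collRate m σ S D F G X + exchange m σ S D F X) := by
  have h2 : ContinuousAt (exchange m σ S D F) X := by
    have h1 : exchange m σ S D F = fun X => σ ^ 2 / (2 * m) * pairAvg σ (exchPair m σ S D F) X :=
      funext fun X => h.exchange_eq
    rw [h1]
    exact continuousAt_const.mul (h.exchPair_pairFn.continuousAt_pairAvg h.hD hX hnull)
  exact div_eq_neg_of_weak h.hD hX hJ
    (h := fun X => collRate m σ S D F G X + exchange m σ S D F X)
    ((h.collRate_continuousOn.continuousAt (h.hD.mem_nhds hX)).add h2)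
    ((h.collRate_continuousOn.locallyIntegrableOn h.hD.measurableSet).add
      (h.exchange_locallyIntegrable.locallyIntegrableOn D))
    fun φ hφ => (h.integral_fderiv_collisionalFlux hφ).2

lemma convectiveFlux_differentiableAt {X : E3} (hX : X ∈ D) :
    DifferentiableAt ℝ (convectiveFlux F) X :=
  (h.convectiveFlux_contDiffOn.contDiffAt (h.hD.mem_nhds hX)).differentiableAt one_ne_zero

/-- The local balance at a point. -/
lemma pointwise_balance {X : E3} (hX : X ∈ D) (hJk : ContDiffAt ℝ 1 (kineticFlux m σ S D F) X)
    (hJc : ContDiffAt ℝ 1 (collisionalFlux m σ S D F) X)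
    (hnull : solidAngle {α : S2 | X + σ • (α : E3) ∈ frontier D} = 0) :
    kinRate F G X + div (fun Y => convectiveFlux F Y + kineticFlux m σ S D F Y) X
        = exchange m σ S D F X - σ ^ 2 / (2 * m) * pairAvg σ (prodPair m σ S D F) X ∧
      collRate m σ S D F G X + div (collisionalFlux m σ S D F) X = - exchange m σ S D F X ∧
      kinRate F G X + collRate m σ S D F G X + div (fluxH m σ S D F) X
        = - (σ ^ 2 / (2 * m) * pairAvg σ (prodPair m σ S D F) X) := by
  have hdc := h.convectiveFlux_differentiableAt hX
  have hdk := hJk.differentiableAt one_ne_zero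
  have h1 := div_add hdc hdk
  have h2 := h.div_kineticFlux hX hJk hnull
  have h3 := h.div_collisionalFlux hX hJc hnull
  have h4 := h.kinRate_add_div hX
  have h5 : div (fluxH m σ S D F) X = div (fun Y => convectiveFlux F Y + kineticFlux m σ S D F Y) X
      + div (collisionalFlux m σ S D F) X :=
    div_add (hdc.add hdk) (hJc.differentiableAt one_ne_zero)
  refine ⟨?_, ?_, ?_⟩
  · rw [h1, h2]; linarith
  · rw [h3]; ring
  · rw [h5, h1, h2, h3]; linarith

lemma kineticFlux_locBdd : LocBdd (kineticFlux m σ S D F) := by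
  have hk := h.kinPair_pairFn.toTwoPoint
  rw [h.kineticFlux_eq]
  refine ⟨(hk.stronglyMeasurable_fluxOf σ).measurable.const_smul (σ ^ 3 / (2 * m)), fun r => ?_⟩
  obtain ⟨C, hC⟩ := hk.fluxOf_bdd σ r
  exact ⟨‖σ ^ 3 / (2 * m)‖ * C, fun X hX => by
    rw [norm_smul]; exact mul_le_mul_of_nonneg_left (hC X hX) (norm_nonneg _)⟩

lemma collisionalFlux_locallyIntegrableOn :
    LocallyIntegrableOn (collisionalFlux m σ S D F) D := by
  have hfl := h.flowPair_pairFn.toTwoPoint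
  have hflux : LocBdd (fluxOf σ (flowPair m σ S D F)) :=
    ⟨(hfl.stronglyMeasurable_fluxOf σ).measurable, hfl.fluxOf_bdd σ⟩
  rw [h.collisionalFlux_eq]
  exact ((h.primitive_continuousOn.smul h.momentum_contDiffOn.continuousOn).locallyIntegrableOn
    h.hD.measurableSet).sub ((hflux.locallyIntegrable.smul (σ ^ 3 / (2 * m))).locallyIntegrableOn D)

lemma fluxH_locallyIntegrableOn : LocallyIntegrableOn (fluxH m σ S D F) D :=
  ((h.convectiveFlux_contDiffOn.continuousOn.locallyIntegrableOn h.hD.measurableSet).add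
    (h.kineticFlux_locBdd.locallyIntegrable.locallyIntegrableOn D)).add
    h.collisionalFlux_locallyIntegrableOn

lemma rate_locallyIntegrableOn :
    LocallyIntegrableOn (fun X => kinRate F G X + collRate m σ S D F G X) D :=
  (h.kinRate_continuousOn.add h.collRate_continuousOn).locallyIntegrableOn h.hD.measurableSet

/-- The weak form of the local balance. -/
lemma weak_balance {φ : E3 → ℝ} (hφ : IsTest D φ) :
    ∫ X in D, ((kinRate F G X + collRate m σ S D F G X) * φ X
      - fderiv ℝ φ X (fluxH m σ S D F X))
      = - ∫ X, φ X * (σ ^ 2 / (2 * m) * pairAvg σ (prodPair m σ S D F) X) := by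
  have hφ1 : ContDiff ℝ 1 φ := hφ.1.of_le (by exact_mod_cast le_top)
  have hcv := h.convectiveFlux_contDiffOn
  have hk := h.kinPair_pairFn.toTwoPoint
  have hconv := hcv.continuousOn.locallyIntegrableOn (μ := volume) h.hD.measurableSet
  have iK := hφ.integrable_mul (h.kinRate_continuousOn.locallyIntegrableOn h.hD.measurableSet)
  have iC := hφ.integrable_mul (h.collRate_continuousOn.locallyIntegrableOn h.hD.measurableSet)
  have iE := hφ.integrable_mul (h.exchange_locallyIntegrable.locallyIntegrableOn D)
  have iP := hφ.integrable_mul ((((h.prodPair_pairFn.toTwoPoint.pairAvg_locBdd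
    σ).locallyIntegrable).smul (σ ^ 2 / (2 * m))).locallyIntegrableOn D)
  have iS := hφ.integrable_mul ((((hk.pairAvg_locBdd σ).locallyIntegrable.sub
      (hk.swap.pairAvg_locBdd σ).locallyIntegrable).smul
        (σ ^ 2 / (2 * m))).locallyIntegrableOn D)
  have i1 := hφ.integrable_fderiv hconv
  have i2 := hφ.integrable_fderiv (h.kineticFlux_locBdd.locallyIntegrable.locallyIntegrableOn D)
  have i3 := hφ.integrable_fderiv h.collisionalFlux_locallyIntegrableOn
  have e1 := integral_div_eq h.hD hcv hφ
  have e2 := h.integral_fderiv_kineticFlux hφ1 hφ.2.1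
  have e3 := (h.integral_fderiv_collisionalFlux hφ).2
  simp only [Pi.smul_apply, Pi.sub_apply, smul_eq_mul] at iP iS
  -- The convective flux is C¹ on all of `D`, so the kinetic balance up to J^(k) is used pointwise;
  -- only J^(k) and J^(c) are treated weakly.
  have e4 : ∫ X, φ X * div (convectiveFlux F) X =
      ∫ X, (φ X * exchange m σ S D F X
        - φ X * (σ ^ 2 / (2 * m) * pairAvg σ (prodPair m σ S D F) X)
        - φ X * kinRate F G X + φ X * (σ ^ 2 / (2 * m) * (pairAvg σ (kinPair m σ S D F) X
          - pairAvg σ (pairSwap (kinPair m σ S D F)) X))) := by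
    congr 1
    funext X
    by_cases hX : X ∈ D
    · have := h.kinRate_add_div hX
      linear_combination φ X * this
    · simp [hφ.apply_eq_zero hX]
  rw [setIntegral_eq_integral_of_forall_compl_eq_zero fun X hX => by simp [hφ.apply_eq_zero hX]]
  have e5 : (fun X => (kinRate F G X + collRate m σ S D F G X) * φ X
      - fderiv ℝ φ X (fluxH m σ S D F X)) = fun X => φ X * kinRate F G X
      + φ X * collRate m σ S D F G X - (fderiv ℝ φ X (convectiveFlux F X)
      + fderiv ℝ φ X (kineticFlux m σ S D F X) + fderiv ℝ φ X (collisionalFlux m σ S D F X)) := by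
    funext X
    simp only [fluxH, map_add]; ring
  have i12 : Integrable fun X => fderiv ℝ φ X (convectiveFlux F X)
      + fderiv ℝ φ X (kineticFlux m σ S D F X) := i1.add i2
  have i123 : Integrable fun X => fderiv ℝ φ X (convectiveFlux F X)
      + fderiv ℝ φ X (kineticFlux m σ S D F X) + fderiv ℝ φ X (collisionalFlux m σ S D F X) :=
    i12.add i3
  have iKC : Integrable fun X => φ X * kinRate F G X + φ X * collRate m σ S D F G X := iK.add iC
  have iEP : Integrable fun X => φ X * exchange m σ S D F X
        - φ X * (σ ^ 2 / (2 * m) * pairAvg σ (prodPair m σ S D F) X) := iE.sub iP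
  have iEPK : Integrable fun X => φ X * exchange m σ S D F X
        - φ X * (σ ^ 2 / (2 * m) * pairAvg σ (prodPair m σ S D F) X) - φ X * kinRate F G X :=
    iEP.sub iK
  have e6 : ∫ X, φ X * (collRate m σ S D F G X + exchange m σ S D F X)
      = (∫ X, φ X * collRate m σ S D F G X) + ∫ X, φ X * exchange m σ S D F X := by
    rw [← integral_add iC iE]; congr 1; funext X; ring
  rw [integral_add iEPK iS, integral_sub iEP iK, integral_sub iE iP] at e4
  rw [e5, integral_sub iKC i123, integral_add iK iC, integral_add i12 i3,
    integral_add i1 i2, e1, e2, e3, e4, e6]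
  ring

lemma weak_balance_nonpos {φ : E3 → ℝ} (hφ : IsTest D φ) (h0 : ∀ X, 0 ≤ φ X) :
    ∫ X in D, ((kinRate F G X + collRate m σ S D F G X) * φ X
      - fderiv ℝ φ X (fluxH m σ S D F X)) ≤ 0 := by
  rw [h.weak_balance hφ, neg_nonpos]
  have := h.hm
  exact integral_nonneg fun X => mul_nonneg (h0 X)
    (mul_nonneg (by positivity) (h.pairAvg_prodPair_nonneg X))

/-- The weak balance is an equality on an open set exactly under detailed balance. -/
lemma weak_balance_eq_zero_iff {U : Set E3} (hU : IsOpen U) (hUD : U ⊆ D) :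
    (∀ φ : E3 → ℝ, IsTest U φ → ∫ X in D, ((kinRate F G X + collRate m σ S D F G X) * φ X
      - fderiv ℝ φ X (fluxH m σ S D F X)) = 0) ↔ ∀ X ∈ U, DetailedBalance m σ S D F X := by
  have hm := h.hm
  have hσ := h.hσ
  have hc : σ ^ 2 / (2 * m) ≠ 0 := by positivity
  constructor
  · intro h0
    -- A distribution given by a locally integrable density vanishes on `U` only if the density is
    -- zero almost everywhere there.
    refine h.detailedBalance_of_ae hU hUD ((ae_restrict_iff' hU.measurableSet).2 ?_)
    have hl := (((h.prodPair_pairFn.toTwoPoint.pairAvg_locBdd σ).locallyIntegrable).smul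
      (σ ^ 2 / (2 * m))).locallyIntegrableOn U
    have h1 := hU.ae_eq_zero_of_integral_contDiff_smul_eq_zero hl fun φ hs hcs hsub => by
      have h2 := h0 φ ⟨hs, hcs, hsub⟩
      rw [h.weak_balance ⟨hs, hcs, hsub.trans hUD⟩, neg_eq_zero] at h2
      simpa using h2
    filter_upwards [h1] with X hX hXU
    have h3 := hX hXU
    simp only [Pi.smul_apply, smul_eq_mul] at h3
    exact (mul_eq_zero.1 h3).resolve_left hc
  · intro hdb φ hφ
    rw [h.weak_balance ⟨hφ.1, hφ.2.1, hφ.2.2.trans hUD⟩, neg_eq_zero]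
    refine integral_eq_zero_of_ae (ae_of_all _ fun X => ?_)
    by_cases hX : X ∈ U
    · simp [(h.pairAvg_prodPair_eq_zero_iff (hUD hX)).2 (hdb X hX)]
    · simp [hφ.apply_eq_zero hX]

end Slice

section Congr

/-! ### All quantities depend only on the distribution function inside the domain -/

variable {m σ : ℝ} {S : ℝ → ℝ} {D : Set E3} {F g : E3 → E3 → ℝ} (hF : EqOn F g D)

include hF

lemma density_congr : EqOn (density F) (density g) D := fun X hX => by
  rw [density, density, hF hX]

lemma flow_congr : EqOn (flow F) (flow g) D := fun X hX => by
  rw [flow, flow, density_congr hF hX, hF hX]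

lemma crowding_congr (hD : IsOpen D) : crowding m σ D F = crowding m σ D g := by
  funext X
  rw [crowding, crowding, setIntegral_congr_fun hD.measurableSet fun Y hY => by
    simp only [density_congr hF hY]; rfl]

lemma cutFactor_congr (hD : IsOpen D) : cutFactor m σ S D F = cutFactor m σ S D g := by
  funext X Y
  rw [cutFactor, cutFactor, enskogFactor, enskogFactor, crowding_congr hF hD]

lemma cutFactor_mul_congr (hD : IsOpen D) {X Y : E3} {u v : ℝ} (h : X ∈ D → Y ∈ D → u = v) :
    cutFactor m σ S D F X Y * u = cutFactor m σ S D g X Y * v := by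
  rw [cutFactor_congr hF hD]
  by_cases hXY : X ∈ D ∧ Y ∈ D
  · rw [h hXY.1 hXY.2]
  · rw [cutFactor_of_notMem (by tauto), zero_mul, zero_mul]

lemma collision_congr (hD : IsOpen D) : EqOn (collision m σ S D F) (collision m σ S D g) D := by
  intro X hX
  funext ξ
  rw [collision, collision, gain, gain, loss, loss]
  congr 3
  · funext α
    congr 1
    funext ξs
    simp only [mul_assoc]
    exact cutFactor_mul_congr hF hD fun h1 h2 => by rw [hF h1, hF h2]
  · funext α
    congr 1
    funext ξs
    simp only [mul_assoc]
    exact cutFactor_mul_congr hF hD fun h1 h2 => by rw [hF h1, hF h2]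

lemma collisionalH_congr (hD : IsOpen D) :
    EqOn (collisionalH m σ S D F) (collisionalH m σ S D g) D := fun X hX => by
  rw [collisionalH, collisionalH, density_congr hF hX, crowding_congr hF hD]

lemma convectiveFlux_congr : EqOn (convectiveFlux F) (convectiveFlux g) D := fun X hX => by
  rw [convectiveFlux, convectiveFlux, hF hX]

lemma kineticFlux_congr (hD : IsOpen D) : kineticFlux m σ S D F = kineticFlux m σ S D g := by
  funext X
  rw [kineticFlux, kineticFlux]
  congr 2
  funext α
  congr 1
  funext ξ
  congr 1
  funext ξs
  congr 1
  funext τ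
  congr 1
  simp only [mul_assoc]
  exact cutFactor_mul_congr hF hD fun h1 h2 => by rw [hF h1, hF h2]

lemma collisionalFlux_congr (hD : IsOpen D) :
    EqOn (collisionalFlux m σ S D F) (collisionalFlux m σ S D g) D := by
  intro X hX
  rw [collisionalFlux, collisionalFlux, collisionalH_congr hF hD hX, flow_congr hF hX]
  congr 3
  funext α
  congr 1
  funext τ
  congr 1
  rw [crowding_congr hF hD]
  by_cases h1 : X + (τ * σ) • (α : E3) ∈ D
  · by_cases h2 : X + ((τ - 1) * σ) • (α : E3) ∈ D
    · rw [flow_congr hF h1, flow_congr hF h2, density_congr hF h1, density_congr hF h2]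
    · simp [chi, h2]
  · simp [chi, h1]

lemma fluxH_congr (hD : IsOpen D) : EqOn (fluxH m σ S D F) (fluxH m σ S D g) D := fun X hX => by
  rw [fluxH, fluxH, convectiveFlux_congr hF hX, kineticFlux_congr hF hD,
    collisionalFlux_congr hF hD hX]

lemma exchange_congr (hD : IsOpen D) : exchange m σ S D F = exchange m σ S D g := by
  funext X
  rw [exchange, exchange]
  congr 2
  funext α
  congr 1
  funext ξ
  congr 1
  funext ξs
  simp only [mul_assoc]
  exact cutFactor_mul_congr hF hD fun h1 h2 => by rw [hF h1, hF h2]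

lemma detailedBalance_congr (hD : IsOpen D) {X : E3} :
    DetailedBalance m σ S D F X ↔ DetailedBalance m σ S D g X := by
  refine forall_congr' fun α => ?_
  rw [cutFactor_congr hF hD]
  by_cases h : X ∈ D ∧ X - σ • (α : E3) ∈ D
  · rw [hF h.1, hF h.2]
  · rw [cutFactor_of_notMem (by tauto)]
    simp

end Congr

lemma div_congr {D : Set E3} (hD : IsOpen D) {J J' : E3 → E3} (hJ : EqOn J J' D) :
    EqOn (div J) (div J') D := fun X hX => by
  rw [div, div, (hJ.eventuallyEq_of_mem (hD.mem_nhds hX)).fderiv_eq]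

/-- Extension of a distribution function by zero outside the domain. -/
def zeroExt (D : Set E3) (g : E3 → E3 → ℝ) (X ξ : E3) : ℝ := D.indicator (fun Y => g Y ξ) X

lemma zeroExt_eqOn (D : Set E3) (g : E3 → E3 → ℝ) : EqOn (zeroExt D g) g D := fun X hX => by
  funext ξ
  rw [zeroExt, indicator_of_mem hX]

lemma zeroExt_of_notMem {D : Set E3} {X : E3} (hX : X ∉ D) (g : E3 → E3 → ℝ) (ξ : E3) :
    zeroExt D g X ξ = 0 := by rw [zeroExt, indicator_of_notMem hX]

/-- The time derivative of a distribution function. -/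
def timeDeriv (f : ℝ → E3 → E3 → ℝ) (t : ℝ) (X ξ : E3) : ℝ := deriv (fun s => f s X ξ) t

/-! ### From the solution to its fixed-time data; time derivatives -/

section Regular

variable {D : Set E3} {T : Set ℝ} {f : ℝ → E3 → E3 → ℝ} (h : IsRegular D T f)

include h

lemma IsRegular.contDiffAt (hD : IsOpen D) (hT : IsOpen T) {t : ℝ} (ht : t ∈ T) {X : E3} (hX : X ∈ D)
    (ξ : E3) : ContDiffAt ℝ 1 (fun p : ℝ × E3 × E3 => f p.1 p.2.1 p.2.2) (t, X, ξ) :=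
  h.contDiff.contDiffAt ((hT.prod (hD.prod isOpen_univ)).mem_nhds ⟨ht, hX, mem_univ _⟩)

lemma IsRegular.hasDerivAt (hD : IsOpen D) (hT : IsOpen T) {t : ℝ} (ht : t ∈ T) {X : E3}
    (hX : X ∈ D) (ξ : E3) : HasDerivAt (fun s => f s X ξ) (timeDeriv f t X ξ) t := by
  have h1 : DifferentiableAt ℝ (fun s => f s X ξ) t :=
    ((h.contDiffAt hD hT ht hX ξ).differentiableAt one_ne_zero).comp t
      (f := fun s : ℝ => (s, X, ξ)) (by fun_prop)
  exact h1.hasDerivAt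

lemma IsRegular.timeDeriv_eq_fderiv (hD : IsOpen D) (hT : IsOpen T) {t : ℝ} (ht : t ∈ T) {X : E3}
    (hX : X ∈ D) (ξ : E3) : timeDeriv f t X ξ
      = fderiv ℝ (fun p : ℝ × E3 × E3 => f p.1 p.2.1 p.2.2) (t, X, ξ) (1, 0, 0) := by
  have h1 := ((h.contDiffAt hD hT ht hX ξ).differentiableAt one_ne_zero).hasFDerivAt
  have h2 : HasDerivAt (fun s : ℝ => (s, X, ξ)) (1, 0, 0) t :=
    (hasDerivAt_id t).prodMk (hasDerivAt_const t (X, ξ))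
  exact (h1.comp_hasDerivAt t h2).deriv

lemma IsRegular.timeDeriv_continuousOn (hD : IsOpen D) (hT : IsOpen T) {t : ℝ} (ht : t ∈ T) :
    ContinuousOn (Function.uncurry (timeDeriv f t)) (D ×ˢ univ) := by
  have h1 := h.contDiff.continuousOn_fderiv_of_isOpen (hT.prod (hD.prod isOpen_univ)) le_rfl
  have h2 : ContinuousOn (fun q : E3 × E3 => fderiv ℝ (fun p : ℝ × E3 × E3 => f p.1 p.2.1 p.2.2)
      (t, q.1, q.2)) (D ×ˢ univ) :=
    h1.comp (f := fun q : E3 × E3 => (t, q.1, q.2)) (by fun_prop) fun q hq => ⟨ht, hq.1, mem_univ _⟩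
  refine (h2.clm_apply (continuousOn_const (c := ((1 : ℝ), (0 : E3), (0 : E3))))).congr
    fun q hq => ?_
  exact h.timeDeriv_eq_fderiv hD hT ht hq.1 q.2

lemma IsRegular.smooth_slice {t : ℝ} (ht : t ∈ T) :
    ContDiffOn ℝ 1 (Function.uncurry (f t)) (D ×ˢ univ) :=
  h.contDiff.comp (f := fun q : E3 × E3 => (t, q.1, q.2)) (by fun_prop)
    fun q hq => ⟨ht, hq.1, mem_univ _⟩

lemma IsRegular.timeDeriv_log (hD : IsOpen D) (hT : IsOpen T) {t : ℝ} (ht : t ∈ T) {X : E3}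
    (hX : X ∈ D) (ξ : E3) :
    timeDeriv f t X ξ = f t X ξ * deriv (fun s => Real.log (f s X ξ)) t := by
  have h1 := (h.hasDerivAt hD hT ht hX ξ).log (h.pos t ht X hX ξ).ne'
  rw [h1.deriv, mul_div_cancel₀ _ (h.pos t ht X hX ξ).ne']

lemma IsRegular.rapid {K : Set ℝ} (hKT : K ⊆ T) (hK : IsCompact K) (r : ℝ) :
    Rapid (K ×ˢ (D ∩ ball (0 : E3) r)) fun p ξ => f p.1 p.2 ξ := by
  intro n
  obtain ⟨C, hC⟩ := h.decay K hKT hK r n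
  refine ⟨C, fun p hp ξ => ?_⟩
  rw [Real.norm_eq_abs, abs_of_pos (h.pos p.1 (hKT hp.1) p.2 hp.2.1 ξ)]
  exact hC p.1 hp.1 p.2 hp.2 ξ

lemma IsRegular.log_poly {K : Set ℝ} (hKT : K ⊆ T) (hK : IsCompact K) (r : ℝ) :
    PolyB (K ×ˢ (D ∩ ball (0 : E3) r)) fun p ξ => Real.log (f p.1 p.2 ξ) := by
  obtain ⟨C, n, hC⟩ := h.log_bound K hKT hK r
  exact ⟨C, n, fun p hp ξ => (hC p.1 hp.1 p.2 hp.2 ξ).1⟩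

/-- ∂_t f = f ∂_t ln f, so the polynomial bound on the logarithmic derivative transfers rapid decay
to ∂_t f. -/
lemma IsRegular.rapid_timeDeriv (hD : IsOpen D) (hT : IsOpen T) {K : Set ℝ} (hKT : K ⊆ T)
    (hK : IsCompact K) (r : ℝ) :
    Rapid (K ×ˢ (D ∩ ball (0 : E3) r)) fun p ξ => timeDeriv f p.1 p.2 ξ := by
  obtain ⟨C, n, hC⟩ := h.log_bound K hKT hK r
  refine (h.rapid hKT hK r).mul_poly
    (g := fun p ξ => deriv (fun s => Real.log (f s p.2 ξ)) p.1)
    ⟨C, n, fun p hp ξ => (hC p.1 hp.1 p.2 hp.2 ξ).2⟩ fun p hp ξ => ?_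
  rw [h.timeDeriv_log hD hT (hKT hp.1) hp.2.1, norm_mul]

end Regular

lemma Rapid.slice {V : Type*} [NormedAddCommGroup V] {K : Set ℝ} {A : Set E3}
    {u : ℝ × E3 → E3 → V} (hu : Rapid (K ×ˢ A) u) {t : ℝ} (ht : t ∈ K) :
    Rapid A fun X ξ => u (t, X) ξ := fun n =>
  (hu n).imp fun _ hC X hX ξ => hC (t, X) ⟨ht, hX⟩ ξ

lemma Rapid.congr {ι V : Type*} [NormedAddCommGroup V] {A : Set ι} {u w : ι → E3 → V}
    (hu : Rapid A u) (hw : ∀ x ∈ A, w x = u x) : Rapid A w := fun n =>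
  (hu n).imp fun _ hC x hx ξ => by rw [hw x hx]; exact hC x hx ξ

/-- The fixed-time data of a solution. -/
lemma slice_of_solution {m σ : ℝ} (hm : 0 < m) (hσ : 0 < σ) {S : ℝ → ℝ} {b : EReal}
    (hS : ContDiffOn ℝ 1 S {x : ℝ | 0 ≤ x ∧ (x : EReal) < b})
    (hS0 : ∀ x : ℝ, 0 ≤ x → (x : EReal) < b → 0 ≤ S x)
    {D : Set E3} (hD : IsOpen D) {T : Set ℝ} (hT : IsOpen T) {f : ℝ → E3 → E3 → ℝ}
    (hreg : IsRegular D T f)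
    (hR : ∀ t ∈ T, ∀ X ∈ closure D, (crowding m σ D (f t) X : EReal) < b)
    (hsol : SolvesEnskog m σ S D T f)
    (himp : ∀ t ∈ T, NoNormalFlux D (fun X => density (f t) X • flow (f t) X))
    {t : ℝ} (ht : t ∈ T) :
    Slice m σ S b D (zeroExt D (f t)) (zeroExt D (timeDeriv f t)) := by
  have hF := zeroExt_eqOn D (f t)
  have hG := zeroExt_eqOn D (timeDeriv f t)
  have hts : ({t} : Set ℝ) ⊆ T := singleton_subset_iff.2 ht
  refine
    { hm := hm, hσ := hσ, hD := hD, hS := hS, hS0 := hS0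
      pos := fun X hX ξ => by rw [hF hX]; exact hreg.pos t ht X hX ξ
      zero := fun X hX ξ => zeroExt_of_notMem hX _ _
      smooth := (hreg.smooth_slice ht).congr fun q hq => congrFun (hF hq.1) q.2
      rapid := fun r => ((hreg.rapid hts isCompact_singleton r).slice (mem_singleton t)).congr
        fun X hX => hF hX.1
      log_poly := fun r => ?_
      grad_poly := fun L hL hLc => ?_
      G_zero := fun X hX ξ => zeroExt_of_notMem hX _ _
      G_cont := (hreg.timeDeriv_continuousOn hD hT ht).congr fun q hq => congrFun (hG hq.1) q.2
      G_rapid := fun r => ((hreg.rapid_timeDeriv hD hT hts isCompact_singleton r).slice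
        (mem_singleton t)).congr fun X hX => hG hX.1
      eqn := fun X hX ξ => ?_
      crowd_lt := fun X hX => by rw [crowding_congr hF hD]; exact hR t ht X hX
      noflux := fun φ hφ => ?_ }
  · obtain ⟨C, n, hC⟩ := hreg.log_poly hts isCompact_singleton r
    exact ⟨C, n, fun X hX ξ => by simp only [hF hX.1]; exact hC (t, X) ⟨mem_singleton t, hX⟩ ξ⟩
  · obtain ⟨C, n, hC⟩ := hreg.log_grad_bound {t} hts isCompact_singleton L hL hLc
    refine ⟨C, n, fun X hX ξ => ?_⟩
    have he : (fun Y => Real.log (zeroExt D (f t) Y ξ)) =ᶠ[𝓝 X] fun Y => Real.log (f t Y ξ) := by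
      filter_upwards [hD.mem_nhds (hL hX)] with Y hY
      rw [hF hY]
    simp only [he.fderiv_eq]
    exact hC t (mem_singleton t) X hX ξ
  · have he : (fun Y => zeroExt D (f t) Y ξ) =ᶠ[𝓝 X] fun Y => f t Y ξ := by
      filter_upwards [hD.mem_nhds hX] with Y hY
      rw [hF hY]
    rw [he.fderiv_eq, hG hX, collision_congr hF hD hX]
    exact hsol t ht X hX ξ
  · have hJ : EqOn (fun X => density (zeroExt D (f t)) X • flow (zeroExt D (f t)) X)
        (fun X => density (f t) X • flow (f t) X) D := fun X hX => by
      simp only [density_congr hF hX, flow_congr hF hX]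
    rw [← himp t ht φ hφ]
    refine setIntegral_congr_fun hD.measurableSet fun X hX => ?_
    simp only []
    rw [div_congr hD hJ hX, density_congr hF hX, flow_congr hF hX]

/-- Differentiation of velocity moments with respect to a parameter. -/
lemma hasDerivAt_moment {u u' : ℝ → E3 → ℝ} {K : Set ℝ} {t : ℝ} (hK : K ∈ 𝓝 t)
    (hc : ∀ s ∈ K, Continuous (u s)) (hc' : Continuous (u' t)) (hu : Rapid K u)
    (hu' : Rapid K u') (hd : ∀ s ∈ K, ∀ ξ, HasDerivAt (fun s => u s ξ) (u' s ξ) s) :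
    HasDerivAt (fun s => ∫ ξ, u s ξ) (∫ ξ, u' t ξ) t := by
  obtain ⟨C, -, hC⟩ := hu.bound
  obtain ⟨C', -, hC'⟩ := hu'.bound
  have htK := mem_of_mem_nhds hK
  exact (hasDerivAt_integral_of_dominated_loc_of_deriv_le (bound := fun ξ => C' * wt ξ) hK
    (by filter_upwards [hK] with s hs using (hc s hs).aestronglyMeasurable)
    ((integrable_wt.const_mul C).mono' (hc t htK).aestronglyMeasurable
      (ae_of_all _ fun ξ => hC t htK ξ)) hc'.aestronglyMeasurable
    (ae_of_all _ fun ξ s hs => hC' s hs ξ) (integrable_wt.const_mul C')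
    (ae_of_all _ fun ξ s hs => hd s hs ξ)).2

lemma Rapid.slice_left {V : Type*} [NormedAddCommGroup V] {K : Set ℝ} {A : Set E3}
    {u : ℝ × E3 → E3 → V} (hu : Rapid (K ×ˢ A) u) {X : E3} (hX : X ∈ A) :
    Rapid K fun s ξ => u (s, X) ξ := fun n =>
  (hu n).imp fun _ hC s hs ξ => hC (s, X) ⟨hs, hX⟩ ξ

lemma exists_closedBall_subset {T : Set ℝ} (hT : IsOpen T) {t : ℝ} (ht : t ∈ T) :
    ∃ K ⊆ T, IsCompact K ∧ K ∈ 𝓝 t := by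
  obtain ⟨ε, hε, hεT⟩ := nhds_basis_closedBall.mem_iff.1 (hT.mem_nhds ht)
  exact ⟨_, hεT, isCompact_closedBall t ε, closedBall_mem_nhds t hε⟩

section Regular

variable {D : Set E3} {T : Set ℝ} {f : ℝ → E3 → E3 → ℝ} (h : IsRegular D T f)
  (hD : IsOpen D) (hT : IsOpen T) {t : ℝ} (ht : t ∈ T)

include h hD hT ht

lemma IsRegular.hasDerivAt_density {X : E3} (hX : X ∈ D) :
    HasDerivAt (fun s => density (f s) X) (∫ ξ, timeDeriv f t X ξ) t := by
  obtain ⟨K, hKT, hKc, hK⟩ := exists_closedBall_subset hT ht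
  exact hasDerivAt_moment hK
    (fun s hs => continuous_slice (h.smooth_slice (hKT hs)).continuousOn hX)
    (continuous_slice (h.timeDeriv_continuousOn hD hT ht) hX)
    ((h.rapid hKT hKc _).slice_left (mem_inter_ball hX))
    ((h.rapid_timeDeriv hD hT hKT hKc _).slice_left (mem_inter_ball hX))
    fun s hs ξ => h.hasDerivAt hD hT (hKT hs) hX ξ

lemma IsRegular.hasDerivAt_kineticH {X : E3} (hX : X ∈ D) :
    HasDerivAt (fun s => kineticH (f s) X) (kinRate (f t) (timeDeriv f t) X) t := by
  obtain ⟨K, hKT, hKc, hK⟩ := exists_closedBall_subset hT ht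
  have hXb := mem_inter_ball hX
  have hlog := h.log_poly hKT hKc (‖X‖ + 1)
  have hlog1 : PolyB (K ×ˢ (D ∩ ball (0 : E3) (‖X‖ + 1)))
      fun p ξ => 1 + Real.log (f p.1 p.2 ξ) := (polyB_const _ (1 : ℝ)).add hlog
  have hcf : ∀ s ∈ K, Continuous (f s X) := fun s hs =>
    continuous_slice (h.smooth_slice (hKT hs)).continuousOn hX
  have hcl : ∀ s ∈ K, Continuous fun ξ => Real.log (f s X ξ) := fun s hs =>
    (hcf s hs).log fun ξ => (h.pos s (hKT hs) X hX ξ).ne'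
  have hr1 : Rapid (K ×ˢ (D ∩ ball (0 : E3) (‖X‖ + 1)))
      fun p ξ => f p.1 p.2 ξ * Real.log (f p.1 p.2 ξ) :=
    (h.rapid hKT hKc (‖X‖ + 1)).mul_poly hlog fun p _ ξ => norm_mul_le _ _
  have hr2 : Rapid (K ×ˢ (D ∩ ball (0 : E3) (‖X‖ + 1)))
      fun p ξ => (1 + Real.log (f p.1 p.2 ξ)) * timeDeriv f p.1 p.2 ξ :=
    (h.rapid_timeDeriv hD hT hKT hKc (‖X‖ + 1)).mul_poly hlog1 fun p _ ξ => by
      rw [norm_mul, mul_comm]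
  refine hasDerivAt_moment hK (fun s hs => (hcf s hs).mul (hcl s hs))
    (u' := fun s ξ => (1 + Real.log (f s X ξ)) * timeDeriv f s X ξ)
    ((continuous_const.add (hcl t (mem_of_mem_nhds hK))).mul
      (continuous_slice (h.timeDeriv_continuousOn hD hT ht) hX))
    (hr1.slice_left hXb) (hr2.slice_left hXb) fun s hs ξ => ?_
  have h1 := h.hasDerivAt hD hT (hKT hs) hX ξ
  have h0 := (h.pos s (hKT hs) X hX ξ).ne'
  refine (h1.mul (h1.log h0)).congr_deriv ?_
  field_simp
  ring

/-- The bound is uniform in times near `t` and in positions up to ∂D. It is the majorant for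
differentiating the crowding function, whose ball may reach the boundary. -/
lemma IsRegular.exists_timeDeriv_bound (r : ℝ) : ∃ K ∈ 𝓝 t, K ⊆ T ∧ ∃ C : ℝ, 0 ≤ C ∧
    ∀ s ∈ K, ∀ Y ∈ D, ‖Y‖ ≤ r → ‖∫ ξ, timeDeriv f s Y ξ‖ ≤ C := by
  obtain ⟨K, hKT, hKc, hK⟩ := exists_closedBall_subset hT ht
  obtain ⟨C, hC0, hC⟩ := (h.rapid_timeDeriv hD hT hKT hKc (r + 1)).bound
  refine ⟨K, hK, hKT, ∫ ξ, C * wt ξ, integral_nonneg fun ξ => mul_nonneg hC0 (wt_pos ξ).le,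
    fun s hs Y hY hYr => ?_⟩
  have hYb : Y ∈ D ∩ ball (0 : E3) (r + 1) := ⟨hY, by rw [mem_ball_zero_iff]; linarith⟩
  exact norm_integral_le_of_norm_le (integrable_wt.const_mul C)
    (ae_of_all _ fun ξ => hC (s, Y) ⟨hs, hYb⟩ ξ)

end Regular

section Solution

variable {m σ : ℝ} {S : ℝ → ℝ} {b : EReal} {D : Set E3} {T : Set ℝ} {f : ℝ → E3 → E3 → ℝ}
  (h : IsRegular D T f) (hT : IsOpen T)
  (hs : ∀ t ∈ T, Slice m σ S b D (zeroExt D (f t)) (zeroExt D (timeDeriv f t)))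
  {t : ℝ} (ht : t ∈ T)

include h hT hs ht

lemma hasDerivAt_density_zeroExt (Y : E3) : HasDerivAt (fun s => density (zeroExt D (f s)) Y)
    (∫ ξ, zeroExt D (timeDeriv f t) Y ξ) t := by
  have hD := (hs t ht).hD
  by_cases hY : Y ∈ D
  · have h1 := h.hasDerivAt_density hD hT ht hY
    simp only [density_congr (zeroExt_eqOn D _) hY, zeroExt_eqOn D _ hY]
    exact h1
  · simp only [density, zeroExt_of_notMem hY, integral_zero]
    exact hasDerivAt_const t 0

/-- Only density rates on the ball of radius `σ` about `X` contribute, and there they are uniformly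
bounded, so a constant times the indicator of the ball dominates. -/
lemma hasDerivAt_crowding (X : E3) : HasDerivAt (fun s => crowding m σ D (f s) X)
    (crowdRate m σ (zeroExt D (timeDeriv f t)) X) t := by
  have hD := (hs t ht).hD
  have h0 : (fun s => crowding m σ D (f s) X) =ᶠ[𝓝 t]
      fun s => (1 / m) * ballInt σ (density (zeroExt D (f s))) X := by
    filter_upwards [hT.mem_nhds ht] with s hsT
    rw [← (hs s hsT).crowding_eq, crowding_congr (zeroExt_eqOn D _) hD]
  refine HasDerivAt.congr_of_eventuallyEq ?_ h0
  refine HasDerivAt.const_mul (1 / m) ?_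
  obtain ⟨K, hK, hKT, C, hC0, hC⟩ := h.exists_timeDeriv_bound hD hT ht (‖X‖ + σ)
  have hCl : LocBdd fun _ : E3 => C := ⟨measurable_const, fun _ => ⟨‖C‖, fun _ _ => le_rfl⟩⟩
  have hheav : Measurable fun Y : E3 => heaviside (σ - ‖Y - X‖) :=
    measurable_heaviside.comp (by fun_prop)
  refine (hasDerivAt_integral_of_dominated_loc_of_deriv_le
    (F := fun s Y => density (zeroExt D (f s)) Y * heaviside (σ - ‖Y - X‖))
    (F' := fun s Y => (∫ ξ, zeroExt D (timeDeriv f s) Y ξ) * heaviside (σ - ‖Y - X‖))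
    (bound := fun Y => C * heaviside (σ - ‖Y - X‖)) hK ?_
    ((hs t ht).density_locBdd.integrable_ball σ X)
    ((hs t ht).rate_locBdd.meas.mul hheav).aestronglyMeasurable ?_
    (hCl.integrable_ball σ X) ?_).2
  · filter_upwards [hK] with s hsK
    exact ((hs s (hKT hsK)).density_locBdd.meas.mul hheav).aestronglyMeasurable
  · refine ae_of_all _ fun Y s hsK => ?_
    by_cases hY : Y ∈ closedBall X σ
    · rw [norm_mul, Real.norm_of_nonneg (heaviside_nonneg _)]
      refine mul_le_mul_of_nonneg_right ?_ (heaviside_nonneg _)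
      by_cases hYD : Y ∈ D
      · simp only [zeroExt_eqOn D _ hYD]
        refine hC s hsK Y hYD ?_
        rw [mem_closedBall_iff_norm] at hY
        linarith [norm_le_norm_add_norm_sub' Y X]
      · simpa [zeroExt_of_notMem hYD] using hC0
    · simp [heaviside_eq_indicator, hY]
  · exact ae_of_all _ fun Y s hsK =>
      (hasDerivAt_density_zeroExt h hT hs (hKT hsK) Y).mul_const _

lemma hasDerivAt_collisionalH {X : E3} (hX : X ∈ D) :
    HasDerivAt (fun s => collisionalH m σ S D (f s) X)
      (collRate m σ S D (zeroExt D (f t)) (zeroExt D (timeDeriv f t)) X) t := by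
  have hsl := hs t ht
  have hD := hsl.hD
  have hcr := crowding_congr (m := m) (σ := σ) (zeroExt_eqOn D (f t)) hD
  have hpos := hsl.crowding_pos hX
  have hlt := hsl.crowd_lt X (subset_closure hX)
  rw [hcr] at hpos hlt
  -- `S` is controlled only on [0, b); strict positivity of R gives a neighbourhood of its value
  -- inside the domain of continuity.
  have hopen : IsOpen {x : ℝ | 0 < x ∧ (x : EReal) < b} :=
    (isOpen_lt continuous_const continuous_id).inter
      (isOpen_lt continuous_coe_real_ereal continuous_const)
  have hcont : ContinuousOn S {x : ℝ | 0 < x ∧ (x : EReal) < b} :=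
    hsl.hS.continuousOn.mono fun x hx => ⟨hx.1.le, hx.2⟩
  have hint : IntervalIntegrable S volume 0 (crowding m σ D (f t) X) := by
    refine ContinuousOn.intervalIntegrable ?_
    rw [uIcc_of_le hpos.le]
    exact hsl.hS.continuousOn.mono fun x hx =>
      ⟨hx.1, (EReal.coe_le_coe_iff.2 hx.2).trans_lt hlt⟩
  have h1 := intervalIntegral.integral_hasDerivAt_right hint
    (hcont.stronglyMeasurableAtFilter hopen _ ⟨hpos, hlt⟩)
    (hcont.continuousAt (hopen.mem_nhds ⟨hpos, hlt⟩))
  have h2 := h1.comp t (hasDerivAt_crowding h hT hs ht X)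
  have h3 := h.hasDerivAt_density hD hT ht hX
  refine (h3.mul h2).congr_deriv ?_
  rw [collRate, hcr, density_congr (zeroExt_eqOn D (f t)) hX, zeroExt_eqOn D _ hX]
  rfl

lemma hasDerivAt_kineticH_zeroExt {X : E3} (hX : X ∈ D) :
    HasDerivAt (fun s => kineticH (f s) X)
      (kinRate (zeroExt D (f t)) (zeroExt D (timeDeriv f t)) X) t := by
  have h1 := h.hasDerivAt_kineticH (hs t ht).hD hT ht hX
  simp only [kinRate, zeroExt_eqOn D _ hX]
  exact h1

lemma hasDerivAt_localH {X : E3} (hX : X ∈ D) :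
    HasDerivAt (fun s => localH m σ S D (f s) X)
      (kinRate (zeroExt D (f t)) (zeroExt D (timeDeriv f t)) X
        + collRate m σ S D (zeroExt D (f t)) (zeroExt D (timeDeriv f t)) X) t :=
  (hasDerivAt_kineticH_zeroExt h hT hs ht hX).add (hasDerivAt_collisionalH h hT hs ht hX)

end Solution

/-! ### C¹ regularity of the fluxes away from the boundary -/

/-- `C¹` functions on `U` that are bounded by `B` together with their derivative. -/
structure C1Bdd (U : Set E3) (k : E3 → ℝ) (B : ℝ) : Prop where
  smooth : ContDiffOn ℝ 1 k U
  bdd : ∀ x ∈ U, ‖k x‖ ≤ B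
  fderiv_bdd : ∀ x ∈ U, ‖fderiv ℝ k x‖ ≤ B

section C1

variable {U V : Set E3} {k l : E3 → ℝ} {B C : ℝ}

lemma C1Bdd.mono (h : C1Bdd U k B) (hBC : B ≤ C) : C1Bdd U k C :=
  ⟨h.smooth, fun x hx => (h.bdd x hx).trans hBC, fun x hx => (h.fderiv_bdd x hx).trans hBC⟩

lemma C1Bdd.differentiableAt (h : C1Bdd U k B) (hU : IsOpen U) {x : E3} (hx : x ∈ U) :
    DifferentiableAt ℝ k x :=
  (h.smooth.contDiffAt (hU.mem_nhds hx)).differentiableAt one_ne_zero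

/-- The factor two comes from the two terms of the Leibniz rule; for the function itself it is only
slack. -/
lemma C1Bdd.mul (hU : IsOpen U) (h : C1Bdd U k B) (h' : C1Bdd U l C) :
    C1Bdd U (fun x => k x * l x) (2 * (B * C)) := by
  refine ⟨h.smooth.mul h'.smooth, fun x hx => ?_, fun x hx => ?_⟩
  · have h1 := mul_le_mul (h.bdd x hx) (h'.bdd x hx) (norm_nonneg _) ((norm_nonneg _).trans (h.bdd x hx))
    rw [norm_mul]
    linarith [(mul_nonneg (norm_nonneg (k x)) (norm_nonneg (l x))).trans h1]
  · rw [fderiv_fun_mul (h.differentiableAt hU hx) (h'.differentiableAt hU hx)]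
    refine (norm_add_le _ _).trans ?_
    rw [norm_smul, norm_smul]
    have h1 := mul_le_mul (h.bdd x hx) (h'.fderiv_bdd x hx) (norm_nonneg _)
      ((norm_nonneg _).trans (h.bdd x hx))
    have h2 := mul_le_mul (h'.bdd x hx) (h.fderiv_bdd x hx) (norm_nonneg _)
      ((norm_nonneg _).trans (h'.bdd x hx))
    linarith

lemma C1Bdd.add (hU : IsOpen U) (h : C1Bdd U k B) (h' : C1Bdd U l C) :
    C1Bdd U (fun x => k x + l x) (B + C) := by
  refine ⟨h.smooth.add h'.smooth, fun x hx => (norm_add_le _ _).trans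
    (add_le_add (h.bdd x hx) (h'.bdd x hx)), fun x hx => ?_⟩
  rw [fderiv_fun_add (h.differentiableAt hU hx) (h'.differentiableAt hU hx)]
  exact (norm_add_le _ _).trans (add_le_add (h.fderiv_bdd x hx) (h'.fderiv_bdd x hx))

lemma C1Bdd.sub (hU : IsOpen U) (h : C1Bdd U k B) (h' : C1Bdd U l C) :
    C1Bdd U (fun x => k x - l x) (B + C) := by
  refine ⟨h.smooth.sub h'.smooth, fun x hx => (norm_sub_le _ _).trans
    (add_le_add (h.bdd x hx) (h'.bdd x hx)), fun x hx => ?_⟩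
  rw [fderiv_fun_sub (h.differentiableAt hU hx) (h'.differentiableAt hU hx)]
  exact (norm_sub_le _ _).trans (add_le_add (h.fderiv_bdd x hx) (h'.fderiv_bdd x hx))

lemma C1Bdd.mul_const (hU : IsOpen U) (h : C1Bdd U k B) (c : ℝ) :
    C1Bdd U (fun x => k x * c) (B * |c|) := by
  refine ⟨h.smooth.mul contDiffOn_const, fun x hx => ?_, fun x hx => ?_⟩
  · rw [norm_mul]; exact mul_le_mul_of_nonneg_right (h.bdd x hx) (norm_nonneg _)
  · rw [fderiv_mul_const (h.differentiableAt hU hx), norm_smul, mul_comm]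
    exact mul_le_mul_of_nonneg_right (h.fderiv_bdd x hx) (norm_nonneg _)

lemma C1Bdd.shift (h : C1Bdd V k B) {v : E3} (hv : ∀ x ∈ U, x + v ∈ V) :
    C1Bdd U (fun x => k (x + v)) B := by
  refine ⟨h.smooth.comp (contDiff_id.add contDiff_const).contDiffOn hv, fun x hx => h.bdd _ (hv x hx),
    fun x hx => ?_⟩
  rw [fderiv_comp_add_right]
  exact h.fderiv_bdd _ (hv x hx)

lemma C1Bdd.integral {A : Type*} [MeasurableSpace A] {μ : Measure A} (hU : IsOpen U)
    {k : A → E3 → ℝ} {bd : A → ℝ} (hm : ∀ x ∈ U, AEStronglyMeasurable (fun a => k a x) μ)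
    (hb : Integrable bd μ) (h : ∀ᵐ a ∂μ, C1Bdd U (k a) (bd a)) :
    C1Bdd U (fun x => ∫ a, k a x ∂μ) (∫ a, bd a ∂μ) := by
  have h1 : ∀ᵐ a ∂μ, ContDiffOn ℝ 1 (fun x => k a x) U := h.mono fun a ha => ha.smooth
  have h2 : ∀ᵐ a ∂μ, ∀ x ∈ U, ‖k a x‖ ≤ bd a := h.mono fun a ha => ha.bdd
  have h3 : ∀ᵐ a ∂μ, ∀ x ∈ U, ‖fderiv ℝ (fun x => k a x) x‖ ≤ bd a := h.mono fun a ha => ha.fderiv_bdd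
  refine ⟨contDiffOn_integral_of_contDiffOn hU hm hb h1 h2 h3,
    fun x hx => norm_integral_le_of_norm_le hb (h2.mono fun a ha => ha x hx), fun x hx => ?_⟩
  rw [(hasFDerivAt_integral_of_contDiffOn hU hm hb h1 h2 h3 hx).2.fderiv]
  exact norm_integral_le_of_norm_le hb (h3.mono fun a ha => ha x hx)

/-- One bound serves all `e` in the unit ball, because `e` will be the direction of integration. -/
lemma exists_c1Bdd_inner {W L : Set E3} (hW : IsOpen W) {J : E3 → E3} (hJ : ContDiffOn ℝ 1 J W)
    (hL : L ⊆ W) (hLc : IsCompact L) (hVL : V ⊆ L) :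
    ∃ B, ∀ e : E3, ‖e‖ ≤ 1 → C1Bdd V (fun x => inner ℝ (J x) e) B := by
  obtain ⟨B1, hB1⟩ := hLc.exists_bound_of_continuousOn (hJ.continuousOn.mono hL)
  obtain ⟨B2, hB2⟩ := hLc.exists_bound_of_continuousOn
    ((hJ.continuousOn_fderiv_of_isOpen hW le_rfl).mono hL)
  refine ⟨max B1 B2, fun e he => ⟨(hJ.mono (hVL.trans hL)).inner ℝ contDiffOn_const,
    fun x hx => ?_, fun x hx => ?_⟩⟩
  · refine (norm_inner_le_norm _ _).trans ((mul_le_of_le_one_right (norm_nonneg _) he).trans ?_)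
    exact (hB1 x (hVL hx)).trans (le_max_left _ _)
  · have hd : DifferentiableAt ℝ J x :=
      (hJ.contDiffAt (hW.mem_nhds (hL (hVL hx)))).differentiableAt one_ne_zero
    have h1 : (fun x => inner ℝ (J x) e) = innerSL ℝ e ∘ J := by
      funext x; rw [Function.comp_apply, innerSL_apply_apply, real_inner_comm]
    rw [h1, ((innerSL ℝ e).hasFDerivAt.comp x hd.hasFDerivAt).fderiv]
    refine (ContinuousLinearMap.opNorm_comp_le _ _).trans ?_
    rw [innerSL_apply_norm]
    exact (mul_le_of_le_one_left (norm_nonneg _) he).trans ((hB2 x (hVL hx)).trans (le_max_right _ _))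

lemma exists_c1Bdd {W L : Set E3} (hW : IsOpen W) {g : E3 → ℝ} (hg : ContDiffOn ℝ 1 g W)
    (hL : L ⊆ W) (hLc : IsCompact L) (hVL : V ⊆ L) : ∃ B, C1Bdd V g B := by
  obtain ⟨B1, hB1⟩ := hLc.exists_bound_of_continuousOn (hg.continuousOn.mono hL)
  obtain ⟨B2, hB2⟩ := hLc.exists_bound_of_continuousOn
    ((hg.continuousOn_fderiv_of_isOpen hW le_rfl).mono hL)
  exact ⟨max B1 B2, hg.mono (hVL.trans hL), fun x hx => (hB1 x (hVL hx)).trans (le_max_left _ _),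
    fun x hx => (hB2 x (hVL hx)).trans (le_max_right _ _)⟩

end C1

/-- Fluxes of two-point quantities that are `C¹` along translations are `C¹`. -/
lemma TwoPoint.contDiffOn_fluxOf {W : S2 → E3 → E3 → ℝ} (hW : TwoPoint W) {σ : ℝ} {U : Set E3}
    (hU : IsOpen U) {B : ℝ} (h : ∀ (α : S2), ∀ τ ∈ Ioc (0 : ℝ) 1, C1Bdd U
      (fun X => W α (X + (τ * σ) • (α : E3)) (X + ((τ - 1) * σ) • (α : E3))) B) :
    ContDiffOn ℝ 1 (fluxOf σ W) U := by
  have hm : ∀ X : E3, Measurable fun q : S2 × ℝ =>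
      W q.1 (X + (q.2 * σ) • (q.1 : E3)) (X + ((q.2 - 1) * σ) • (q.1 : E3)) := fun X =>
    (hW.meas_inner σ).comp measurable_prodMk_left
  set ν : Measure ℝ := volume.restrict (Ioc (0 : ℝ) 1) with hν
  have h1 : ∀ α : S2, C1Bdd U (fun X => ∫ τ in (0 : ℝ)..1,
      W α (X + (τ * σ) • (α : E3)) (X + ((τ - 1) * σ) • (α : E3))) B := fun α => by
    simp only [intervalIntegral.integral_of_le zero_le_one]
    have h2 := C1Bdd.integral (μ := ν) hU (k := fun τ X =>
      W α (X + (τ * σ) • (α : E3)) (X + ((τ - 1) * σ) • (α : E3))) (bd := fun _ => B)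
      (fun X _ => ((hm X).comp measurable_prodMk_left).aestronglyMeasurable)
      (integrable_const B) (by
        filter_upwards [ae_restrict_mem measurableSet_Ioc] with τ hτ using h α τ hτ)
    simpa [hν] using h2
  refine contDiffOn_integral_of_contDiffOn (bound := fun _ => B) hU (fun X _ => ?_)
    (integrable_const B) (ae_of_all _ fun α => (h1 α).smooth.smul contDiffOn_const)
    (ae_of_all _ fun α X hX => ?_) (ae_of_all _ fun α X hX => ?_)
  · exact (((hW.stronglyMeasurable_avg σ).comp_measurable
      (measurable_prodMk_left (x := X))).smul continuous_dir.stronglyMeasurable).aestronglyMeasurable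
  · rw [norm_smul, norm_dir, mul_one]
    exact (h1 α).bdd X hX
  · rw [(((h1 α).differentiableAt hU hX).hasFDerivAt.smul_const (α : E3)).fderiv,
      ContinuousLinearMap.norm_smulRight_apply, norm_dir, mul_one]
    exact (h1 α).fderiv_bdd X hX

lemma C1Bdd.congr {U : Set E3} {k l : E3 → ℝ} {B : ℝ} (hU : IsOpen U) (h : C1Bdd U k B)
    (hkl : EqOn l k U) : C1Bdd U l B := by
  refine ⟨h.smooth.congr hkl, fun x hx => by rw [hkl hx]; exact h.bdd x hx, fun x hx => ?_⟩
  rw [(hkl.eventuallyEq_of_mem (hU.mem_nhds hx)).fderiv_eq]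
  exact h.fderiv_bdd x hx

/-- The bound for the integrand of the kinetic transfer and its derivative. -/
lemma kin_weight_bound {A E : ℝ} (hE : 0 ≤ E) (n : ℕ) (α : S2) (ξ ξs : E3) :
    2 * (2 * (A * ((1 + ‖ξ‖) ^ (n + 5))⁻¹ * (A * ((1 + ‖ξs‖) ^ (n + 5))⁻¹)) *
      ((E * (1 + ‖post α ξ ξs‖) ^ n + E * (1 + ‖ξ‖) ^ n) * |vplus α ξ ξs|))
    ≤ 4 * A ^ 2 * (E * (2 ^ n + 1)) * (wt ξ * wt ξs) := by
  have ha : 0 < 1 + ‖ξ‖ := by positivity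
  have hb : 0 < 1 + ‖ξs‖ := by positivity
  have hb1 : 1 ≤ 1 + ‖ξs‖ := by linarith [norm_nonneg ξs]
  have h1 : (1 + ‖post α ξ ξs‖) ^ n ≤ (2 * ((1 + ‖ξ‖) * (1 + ‖ξs‖))) ^ n :=
    pow_le_pow_left₀ (by positivity) (norm_post_le α ξ ξs) n
  have h2 : (1 + ‖ξ‖) ^ n ≤ ((1 + ‖ξ‖) * (1 + ‖ξs‖)) ^ n :=
    pow_le_pow_left₀ ha.le (le_mul_of_one_le_right ha.le hb1) n
  have h3 : (E * (1 + ‖post α ξ ξs‖) ^ n + E * (1 + ‖ξ‖) ^ n) * |vplus α ξ ξs|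
      ≤ (E * (2 * ((1 + ‖ξ‖) * (1 + ‖ξs‖))) ^ n + E * ((1 + ‖ξ‖) * (1 + ‖ξs‖)) ^ n)
        * ((1 + ‖ξ‖) * (1 + ‖ξs‖)) :=
    mul_le_mul (add_le_add (mul_le_mul_of_nonneg_left h1 hE) (mul_le_mul_of_nonneg_left h2 hE))
      (abs_vplus_le α ξ ξs) (abs_nonneg _) (by positivity)
  have h4 : 0 ≤ A * ((1 + ‖ξ‖) ^ (n + 5))⁻¹ * (A * ((1 + ‖ξs‖) ^ (n + 5))⁻¹) := by
    have : 0 ≤ A ^ 2 * (((1 + ‖ξ‖) ^ (n + 5))⁻¹ * ((1 + ‖ξs‖) ^ (n + 5))⁻¹) := by positivity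
    linarith
  refine (mul_le_mul_of_nonneg_left (mul_le_mul_of_nonneg_left h3
    (mul_nonneg zero_le_two h4)) zero_le_two).trans (le_of_eq ?_)
  -- Of the `n + 5` powers available, `n` compensate the logarithms and one the collision velocity,
  -- leaving the four of the weight.
  simp only [wt, mul_pow, pow_add]
  field_simp
  ring

lemma isOpen_pos_lt (b : EReal) : IsOpen {x : ℝ | 0 < x ∧ (x : EReal) < b} :=
  (isOpen_lt continuous_const continuous_id).inter
    (isOpen_lt continuous_coe_real_ereal continuous_const)

namespace Slice

variable {m σ : ℝ} {S : ℝ → ℝ} {b : EReal} {D : Set E3} {F G : E3 → E3 → ℝ}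
  (h : Slice m σ S b D F G)

include h

/-- Written as an integral over a fixed ball of translates of ρ, the crowding function inherits
their smoothness, provided no translate leaves `D`. -/
lemma crowding_contDiffOn {X : E3} {r : ℝ} (hr : closedBall X (r + σ) ⊆ D) :
    ContDiffOn ℝ 1 (crowding m σ D F) (ball X r) := by
  obtain ⟨B, hB⟩ := exists_c1Bdd (V := ball X (r + σ)) h.hD h.density_contDiffOn hr
    (isCompact_closedBall X (r + σ)) ball_subset_closedBall
  have h1 : crowding m σ D F = fun Y => (1 / m) * ∫ z in closedBall (0 : E3) σ, density F (Y + z) := by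
    funext Y; rw [h.crowding_eq, ballInt_eq]
  rw [h1]
  refine contDiffOn_const.mul (C1Bdd.integral (bd := fun _ => B) isOpen_ball (fun Y _ => ?_) ?_ ?_).smooth
  · exact (h.density_locBdd.meas.comp (measurable_const_add Y)).aestronglyMeasurable
  · exact integrableOn_const (isCompact_closedBall (0 : E3) σ).measure_lt_top.ne
  · filter_upwards [ae_restrict_mem isClosed_closedBall.measurableSet] with z hz
    refine hB.shift fun Y hY => ?_
    rw [mem_ball_iff_norm] at hY ⊢
    rw [mem_closedBall_zero_iff] at hz
    rw [add_sub_right_comm]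
    exact (norm_add_le _ _).trans_lt (by linarith)

lemma crowding_mem {X : E3} (hX : X ∈ D) :
    crowding m σ D F X ∈ {x : ℝ | 0 < x ∧ (x : EReal) < b} :=
  ⟨h.crowding_pos hX, h.crowd_lt X (subset_closure hX)⟩

lemma factor_contDiffOn {V : Set E3} (hVD : V ⊆ D) (hc : ContDiffOn ℝ 1 (crowding m σ D F) V) :
    ContDiffOn ℝ 1 (fun X => S (crowding m σ D F X)) V :=
  h.hS.comp hc fun _ hX => ⟨h.crowding_nonneg _, (h.crowding_mem (hVD hX)).2⟩

/-- The primitive of `S` is C¹ on the open interval (0, b), and R takes its values there on `D`. -/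
lemma primitive_contDiffOn {V : Set E3} (hVD : V ⊆ D) (hc : ContDiffOn ℝ 1 (crowding m σ D F) V) :
    ContDiffOn ℝ 1 (fun X => ∫ x in (0 : ℝ)..crowding m σ D F X, S x) V := by
  have hO := isOpen_pos_lt b
  have hSO : ContinuousOn S {x : ℝ | 0 < x ∧ (x : EReal) < b} :=
    h.hS.continuousOn.mono fun x hx => ⟨hx.1.le, hx.2⟩
  have hd : ∀ x ∈ {x : ℝ | 0 < x ∧ (x : EReal) < b},
      HasDerivAt (fun u => ∫ y in (0 : ℝ)..u, S y) (S x) x := fun x hx => by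
    have hint : IntervalIntegrable S volume 0 x := by
      refine (h.hS.continuousOn.mono fun y hy => ?_).intervalIntegrable
      rw [uIcc_of_le hx.1.le] at hy
      exact ⟨hy.1, (EReal.coe_le_coe_iff.2 hy.2).trans_lt hx.2⟩
    exact intervalIntegral.integral_hasDerivAt_right hint
      (hSO.stronglyMeasurableAtFilter hO x hx) (hSO.continuousAt (hO.mem_nhds hx))
  have hΦ : ContDiffOn ℝ 1 (fun u => ∫ y in (0 : ℝ)..u, S y) {x : ℝ | 0 < x ∧ (x : EReal) < b} := by
    rw [show (1 : WithTop ℕ∞) = 0 + 1 by simp, contDiffOn_succ_iff_deriv_of_isOpen hO]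
    refine ⟨fun x hx => (hd x hx).differentiableAt.differentiableWithinAt, by simp, ?_⟩
    rw [contDiffOn_zero]
    exact hSO.congr fun x hx => (hd x hx).deriv
  exact hΦ.comp hc fun X hX => h.crowding_mem (hVD hX)

section TwoPointSmoothness

variable {U V L : Set E3} (hU : IsOpen U) (hL : L ⊆ D) (hLc : IsCompact L)
  (hVL : V ⊆ L)

include hL hLc hVL

lemma exists_c1Bdd_F (k : ℕ) :
    ∃ C, ∀ ξ, C1Bdd V (fun X => F X ξ) (C * ((1 + ‖ξ‖) ^ k)⁻¹) := by
  obtain ⟨r, hr⟩ := exists_subset_ball hL hLc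
  obtain ⟨A, hA⟩ := h.rapid r k
  obtain ⟨B, hB⟩ := h.rapid_fderiv hL hLc k
  refine ⟨max A B, fun ξ => ⟨(contDiffOn_slice h.smooth ξ).mono (hVL.trans hL), fun X hX => ?_,
    fun X hX => ?_⟩⟩ <;> rw [← div_eq_mul_inv, le_div_iff₀ (by positivity), mul_comm]
  · exact (hA X (hr (hVL hX)) ξ).trans (le_max_left _ _)
  · exact (hB X (hVL hX) ξ).trans (le_max_right _ _)

lemma exists_c1Bdd_log : ∃ C, 0 ≤ C ∧ ∃ n : ℕ, ∀ ξ,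
    C1Bdd V (fun X => Real.log (F X ξ)) (C * (1 + ‖ξ‖) ^ n) := by
  obtain ⟨r, hr⟩ := exists_subset_ball hL hLc
  obtain ⟨A, n, hA⟩ := h.log_poly r
  obtain ⟨B, k, hB⟩ := h.grad_poly L hL hLc
  have h1 : ∀ ξ : E3, 1 ≤ 1 + ‖ξ‖ := fun ξ => by linarith [norm_nonneg ξ]
  refine ⟨max |A| |B|, (abs_nonneg A).trans (le_max_left _ _), n + k, fun ξ =>
    ⟨((contDiffOn_slice h.smooth ξ).mono (hVL.trans hL)).log
      fun X hX => (h.pos X (hL (hVL hX)) ξ).ne', fun X hX => ?_, fun X hX => ?_⟩⟩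
  · refine (hA X (hr (hVL hX)) ξ).trans (mul_le_mul ((le_abs_self A).trans (le_max_left _ _))
      (pow_le_pow_right₀ (h1 ξ) (Nat.le_add_right _ _)) (by positivity)
      ((abs_nonneg A).trans (le_max_left _ _)))
  · refine (hB X (hVL hX) ξ).trans (mul_le_mul ((le_abs_self B).trans (le_max_right _ _))
      (pow_le_pow_right₀ (h1 ξ) (Nat.le_add_left _ _)) (by positivity)
      ((abs_nonneg A).trans (le_max_left _ _)))

include hU

/-- The bound must not depend on the direction or on the shifts, which will be τσα and (τ - 1)σα: it
then dominates the integrals over `α` and `τ`. -/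
lemma exists_c1Bdd_flowPair {s : ℝ} (hs : C1Bdd V (fun X => S (crowding m σ D F X)) s) :
    ∃ B, ∀ (α : S2) (v w : E3), (∀ X ∈ U, X + v ∈ V) → (∀ X ∈ U, X + w ∈ V) →
      C1Bdd U (fun X => flowPair m σ S D F α (X + v) (X + w)) B := by
  obtain ⟨ρ, hρ⟩ := exists_c1Bdd h.hD h.density_contDiffOn hL hLc hVL
  obtain ⟨j, hj⟩ := exists_c1Bdd_inner h.hD h.momentum_contDiffOn hL hLc hVL
  refine ⟨2 * (s * (2 * (ρ * j) + 2 * (ρ * j))), fun α v w hv hw => ?_⟩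
  have hjα := hj α (norm_dir α).le
  refine C1Bdd.congr hU ((hs.shift hv).mul hU
    ((((hρ.shift hw).mul hU (hjα.shift hv))).sub hU ((hρ.shift hv).mul hU (hjα.shift hw))))
    fun X hX => ?_
  simp only [flowPair]
  rw [indicator_of_mem (hL (hVL (hv X hX))), inner_sub_left, real_inner_smul_left,
    real_inner_smul_left]

lemma exists_c1Bdd_kinPair {s : ℝ} (hs : C1Bdd V (fun X => S (crowding m σ D F X)) s) :
    ∃ B, ∀ (α : S2) (v w : E3), (∀ X ∈ U, X + v ∈ V) → (∀ X ∈ U, X + w ∈ V) →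
      C1Bdd U (fun X => kinPair m σ S D F α (X + v) (X + w)) B := by
  obtain ⟨E, hE0, n, hE⟩ := h.exists_c1Bdd_log hL hLc hVL
  obtain ⟨A, hA⟩ := h.exists_c1Bdd_F hL hLc hVL (n + 5)
  refine ⟨2 * ((s + s) * ∫ p : E3 × E3, 4 * A ^ 2 * (E * (2 ^ n + 1)) * (wt p.1 * wt p.2)),
    fun α v w hv hw => ?_⟩
  have hkin := C1Bdd.integral (μ := (volume : Measure (E3 × E3))) hU
    (k := fun p X => F (X + v) p.1 * F (X + w) p.2 *
      ((Real.log (F (X + v) (post α p.1 p.2)) - Real.log (F (X + v) p.1)) * vplus α p.1 p.2))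
    (bd := fun p => 4 * A ^ 2 * (E * (2 ^ n + 1)) * (wt p.1 * wt p.2))
    (fun X hX => (h.continuous_kin_integrand (hL (hVL (hv X hX)))
      (hL (hVL (hw X hX))) α).aestronglyMeasurable)
    (integrable_wt_pair.const_mul _)
    (ae_of_all _ fun p => ((((hA p.1).shift hv).mul hU ((hA p.2).shift hw)).mul hU
      ((((hE (post α p.1 p.2)).shift hv).sub hU ((hE p.1).shift hv)).mul_const hU
        (vplus α p.1 p.2))).mono (kin_weight_bound hE0 n α p.1 p.2))
  refine C1Bdd.congr hU (((hs.shift hv).add hU (hs.shift hw)).mul hU hkin) fun X hX => ?_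
  simp only [kinPair]
  rw [cutFactor_of_mem (hL (hVL (hv X hX))) (hL (hVL (hw X hX)))]

end TwoPointSmoothness

/-- The collisional fluxes are `C¹` at distance more than `2σ` from the boundary. -/
lemma contDiffAt_fluxes {X : E3} (hX : closedBall X (2 * σ) ⊆ D) :
    ContDiffAt ℝ 1 (kineticFlux m σ S D F) X ∧ ContDiffAt ℝ 1 (collisionalFlux m σ S D F) X := by
  have hσ := h.hσ
  obtain ⟨δ, hδ, hδD⟩ := (isCompact_closedBall X (2 * σ)).exists_cthickening_subset_open h.hD hX
  rw [cthickening_closedBall hδ.le (by positivity)] at hδD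
  have hL : closedBall X (σ + δ / 2) ⊆ D := (closedBall_subset_closedBall (by linarith)).trans hδD
  -- The radius `2σ` is spent in two halves: the flux looks at points up to `σ` away, and R at each
  -- of them looks another `σ` further. Compactness leaves a margin `δ` for a neighbourhood of `X`.
  have hR : ContDiffOn ℝ 1 (crowding m σ D F) (ball X (σ + δ)) :=
    h.crowding_contDiffOn ((closedBall_subset_closedBall (by linarith)).trans hδD)
  have hWD : ball X (σ + δ) ⊆ D :=
    (ball_subset_ball (by linarith)).trans (ball_subset_closedBall.trans hδD)
  have hLW : closedBall X (σ + δ / 2) ⊆ ball X (σ + δ) := closedBall_subset_ball (by linarith)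
  have hLc := isCompact_closedBall X (σ + δ / 2)
  have hVL : ball X (σ + δ / 2) ⊆ closedBall X (σ + δ / 2) := ball_subset_closedBall
  obtain ⟨s, hs⟩ := exists_c1Bdd isOpen_ball (h.factor_contDiffOn hWD hR) hLW hLc hVL
  have hU : IsOpen (ball X (δ / 2)) := isOpen_ball
  have hmem : ∀ (α : S2) (c : ℝ), |c| ≤ σ → ∀ Y ∈ ball X (δ / 2),
      Y + c • (α : E3) ∈ ball X (σ + δ / 2) := fun α c hc Y hY => by
    rw [mem_ball_iff_norm] at hY ⊢
    rw [add_sub_right_comm]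
    exact (norm_add_smul_dir_le _ _ _).trans_lt (by linarith)
  have h1 : ∀ τ ∈ Ioc (0 : ℝ) 1, |τ * σ| ≤ σ := fun τ hτ => by
    rw [abs_mul, abs_of_pos hτ.1, abs_of_pos hσ]
    exact mul_le_of_le_one_left hσ.le hτ.2
  have h2 : ∀ τ ∈ Ioc (0 : ℝ) 1, |(τ - 1) * σ| ≤ σ := fun τ hτ => by
    rw [abs_mul, abs_sub_comm, abs_of_nonneg (sub_nonneg.2 hτ.2), abs_of_pos hσ]
    exact mul_le_of_le_one_left hσ.le (by linarith [hτ.1])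
  have hXU : ball X (δ / 2) ∈ 𝓝 X := ball_mem_nhds X (by linarith)
  obtain ⟨A, hA⟩ := h.exists_c1Bdd_kinPair hU hL hLc hVL hs
  obtain ⟨B, hB⟩ := h.exists_c1Bdd_flowPair hU hL hLc hVL hs
  have hkin := h.kinPair_pairFn.toTwoPoint.contDiffOn_fluxOf (σ := σ) hU fun α τ hτ =>
    hA α _ _ (hmem α _ (h1 τ hτ)) (hmem α _ (h2 τ hτ))
  have hflow := h.flowPair_pairFn.toTwoPoint.contDiffOn_fluxOf (σ := σ) hU fun α τ hτ =>
    hB α _ _ (hmem α _ (h1 τ hτ)) (hmem α _ (h2 τ hτ))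
  have hXW : ball X (σ + δ) ∈ 𝓝 X := ball_mem_nhds X (by linarith)
  rw [h.kineticFlux_eq, h.collisionalFlux_eq]
  exact ⟨(hkin.contDiffAt hXU).const_smul _,
    (((h.primitive_contDiffOn hWD hR).smul (h.momentum_contDiffOn.mono hWD)).contDiffAt hXW).sub
      ((hflow.contDiffAt hXU).const_smul (σ ^ 3 / (2 * m)))⟩

end Slice

end Enskog

end

theorem mainTheorem1
    (m σ : ℝ) (hm : 0 < m) (hσ : 0 < σ)
    -- the function `S : [0, b) → [0, ∞)`, where `0 < b ≤ ∞`
    (S : ℝ → ℝ) (b : EReal)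
    (hS : ContDiffOn ℝ 1 S {x : ℝ | 0 ≤ x ∧ (x : EReal) < b})
    (hS0 : ∀ x : ℝ, 0 ≤ x → (x : EReal) < b → 0 ≤ S x)
    (D : Set Enskog.E3) (hD : IsOpen D) (T : Set ℝ) (hT : IsOpen T)
    (f : ℝ → Enskog.E3 → Enskog.E3 → ℝ)
    (hreg : Enskog.IsRegular D T f)
    (hR : ∀ t ∈ T, ∀ X ∈ closure D, (Enskog.crowding m σ D (f t) X : EReal) < b)
    (hsol : Enskog.SolvesEnskog m σ S D T f)
    -- impermeable boundary: `ρ v · n = 0` on `∂D`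
    (himp : ∀ t ∈ T, Enskog.NoNormalFlux D
      (fun X => Enskog.density (f t) X • Enskog.flow (f t) X))
    (t : ℝ) (ht : t ∈ T) :
    -- the derivatives of `H^(k)`, `H^(c)` and of the convective flux exist at every point of `D`
    (∀ X ∈ D,
      DifferentiableAt ℝ (fun s => Enskog.kineticH (f s) X) t ∧
      DifferentiableAt ℝ (fun s => Enskog.collisionalH m σ S D (f s) X) t ∧
      DifferentiableAt ℝ (Enskog.convectiveFlux (f t)) X) ∧
    -- the collisional contributions to the flux are `C¹` at distance more than `2σ` from `∂D`
    (∀ X ∈ D, closedBall X (2 * σ) ⊆ D →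
      ContDiffAt ℝ 1 (Enskog.kineticFlux m σ S D (f t)) X ∧
      ContDiffAt ℝ 1 (Enskog.collisionalFlux m σ S D (f t)) X) ∧
    -- the pointwise statement, wherever these contributions are `C¹`
    (∀ X ∈ D,
      ContDiffAt ℝ 1 (Enskog.kineticFlux m σ S D (f t)) X →
      ContDiffAt ℝ 1 (Enskog.collisionalFlux m σ S D (f t)) X →
      Enskog.solidAngle {α : Enskog.S2 | X + σ • (α : Enskog.E3) ∈ frontier D} = 0 →
        deriv (fun s => Enskog.kineticH (f s) X) t
            + Enskog.div (fun Y => Enskog.convectiveFlux (f t) Y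
                + Enskog.kineticFlux m σ S D (f t) Y) X
          ≤ Enskog.exchange m σ S D (f t) X ∧
        deriv (fun s => Enskog.collisionalH m σ S D (f s) X) t
            + Enskog.div (Enskog.collisionalFlux m σ S D (f t)) X
          = - Enskog.exchange m σ S D (f t) X ∧
        deriv (fun s => Enskog.localH m σ S D (f s) X) t
            + Enskog.div (Enskog.fluxH m σ S D (f t)) X ≤ 0 ∧
        (deriv (fun s => Enskog.localH m σ S D (f s) X) t
            + Enskog.div (Enskog.fluxH m σ S D (f t)) X = 0
          ↔ Enskog.DetailedBalance m σ S D (f t) X)) ∧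
    -- the statement on all of `D`, with the divergence in the sense of distributions
    LocallyIntegrableOn (fun X => deriv (fun s => Enskog.localH m σ S D (f s) X) t) D ∧
    LocallyIntegrableOn (Enskog.fluxH m σ S D (f t)) D ∧
    (∀ φ : Enskog.E3 → ℝ, Enskog.IsTest D φ → (∀ X, 0 ≤ φ X) →
      Enskog.weakBalance m σ S D f t φ ≤ 0) ∧
    (∀ U : Set Enskog.E3, IsOpen U → U ⊆ D →
      ((∀ φ : Enskog.E3 → ℝ, Enskog.IsTest U φ → Enskog.weakBalance m σ S D f t φ = 0)
        ↔ ∀ X ∈ U, Enskog.DetailedBalance m σ S D (f t) X)) := by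
  -- The values of `f` outside `D` are arbitrary. All quantities in the claim depend, at points of
  -- `D`, only on `f` inside `D`, so the statement is proved for the zero extension and carried
  -- back.
  have hs : ∀ s ∈ T, Enskog.Slice m σ S b D (Enskog.zeroExt D (f s))
      (Enskog.zeroExt D (Enskog.timeDeriv f s)) := fun s hsT =>
    Enskog.slice_of_solution hm hσ hS hS0 hD hT hreg hR hsol himp hsT
  have h := hs t ht
  have hF := Enskog.zeroExt_eqOn D (f t)
  have hkin := Enskog.kineticFlux_congr (m := m) (σ := σ) (S := S) hF hD
  have hcoll := Enskog.collisionalFlux_congr (m := m) (σ := σ) (S := S) hF hD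
  have hflux := Enskog.fluxH_congr (m := m) (σ := σ) (S := S) hF hD
  have hconv := Enskog.convectiveFlux_congr hF
  have hexch := Enskog.exchange_congr (m := m) (σ := σ) (S := S) hF hD
  have hdK := fun X (hX : X ∈ D) => Enskog.hasDerivAt_kineticH_zeroExt hreg hT hs ht hX
  have hdC := fun X (hX : X ∈ D) => Enskog.hasDerivAt_collisionalH hreg hT hs ht hX
  have hdH := fun X (hX : X ∈ D) => Enskog.hasDerivAt_localH hreg hT hs ht hX
  have hcollAt : ∀ X ∈ D, Enskog.collisionalFlux m σ S D (Enskog.zeroExt D (f t)) =ᶠ[nhds X]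
      Enskog.collisionalFlux m σ S D (f t) := fun X hX =>
    hcoll.eventuallyEq_of_mem (hD.mem_nhds hX)
  have hweak : ∀ φ : Enskog.E3 → ℝ, Enskog.weakBalance m σ S D f t φ = ∫ X in D,
      ((Enskog.kinRate (Enskog.zeroExt D (f t)) (Enskog.zeroExt D (Enskog.timeDeriv f t)) X
        + Enskog.collRate m σ S D (Enskog.zeroExt D (f t))
          (Enskog.zeroExt D (Enskog.timeDeriv f t)) X) * φ X
        - fderiv ℝ φ X (Enskog.fluxH m σ S D (Enskog.zeroExt D (f t)) X)) := fun φ =>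
    setIntegral_congr_fun hD.measurableSet fun X hX => by
      simp only [(hdH X hX).deriv, hflux hX]
  refine ⟨fun X hX => ⟨(hdK X hX).differentiableAt, (hdC X hX).differentiableAt,
      (h.convectiveFlux_differentiableAt hX).congr_of_eventuallyEq
        (hconv.eventuallyEq_of_mem (hD.mem_nhds hX)).symm⟩,
    fun X hX hball => ?_, fun X hX hJk hJc hnull => ?_, ?_, ?_, fun φ hφ h0 => ?_,
    fun U hU hUD => ?_⟩
  · rw [← hkin]
    exact ⟨(h.contDiffAt_fluxes hball).1,
      (h.contDiffAt_fluxes hball).2.congr_of_eventuallyEq (hcollAt X hX).symm⟩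
  · obtain ⟨h1, h2, h3⟩ := h.pointwise_balance hX (hkin ▸ hJk)
      (hJc.congr_of_eventuallyEq (hcollAt X hX)) hnull
    have hd1 := Enskog.div_congr hD (fun Y hY => by
      simp only [hconv hY, hkin] : EqOn (fun Y => Enskog.convectiveFlux (Enskog.zeroExt D (f t)) Y
        + Enskog.kineticFlux m σ S D (Enskog.zeroExt D (f t)) Y)
        (fun Y => Enskog.convectiveFlux (f t) Y + Enskog.kineticFlux m σ S D (f t) Y) D) hX
    have hc : 0 < σ ^ 2 / (2 * m) := by positivity
    have hp := mul_nonneg hc.le (h.pairAvg_prodPair_nonneg X)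
    rw [(hdK X hX).deriv, (hdC X hX).deriv, (hdH X hX).deriv, ← hd1,
      ← Enskog.div_congr hD hcoll hX, ← Enskog.div_congr hD hflux hX, ← hexch,
      ← Enskog.detailedBalance_congr hF hD, ← h.pairAvg_prodPair_eq_zero_iff hX, h1, h2, h3]
    refine ⟨by linarith, rfl, by linarith, ?_⟩
    -- The total balance is minus a positive constant times the averaged production, so equality
    -- means that the production vanishes.
    rw [neg_eq_zero, mul_eq_zero, or_iff_right hc.ne']
  · exact h.rate_locallyIntegrableOn.congr
      (ae_restrict_of_forall_mem hD.measurableSet fun X hX => (hdH X hX).deriv.symm)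
  · exact h.fluxH_locallyIntegrableOn.congr (ae_restrict_of_forall_mem hD.measurableSet hflux)
  · rw [hweak]
    exact h.weak_balance_nonpos hφ h0
  · simp only [hweak]
    exact (h.weak_balance_eq_zero_iff hU hUD).trans
      (forall₂_congr fun X _ => Enskog.detailedBalance_congr hF hD)
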